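/- Let $G$ be an undirected simple graph with $n\ge 1$ vertices. A labeling of the vertices by bitvectors of a common length is \emph{correct} if the distance of any two vertices in $G$ equals the Hamming distance of their labels, and $G$ is a \emph{partial cube} if it has a correct labeling. For edges $pq$, $rs$ of $G$ write $pq\sim_G rs$ if $d(p,r)+d(q,s)\ne d(p,s)+d(q,r)$ (Winkler's relation), and $[e]$ for the set of edges related to $e$. Consider the following recursive algorithm, called for a graph $G$ and a limit $L$ on the number of edge classes; the initial call has $L=n-1$. In a recursive call, $n$ and $m$ denote the numbers of vertices and edges of the graph of that call. "Reject" means to terminate with the claim that the graph is not a partial cube. 1. If $G$ has one vertex, return the empty list of classes and a label of length $0$. 2. Reject if the maximum degree $d$ exceeds $L$. Reject if $G$ is not connected, is not bipartite, or has too many edges, i.e. $m>n\log_2 n$. (In this last test $\log_2 n$ may be rounded up: $G$ may be rejected whenever $m>n\log_2 n$, and must be rejected if $m>n\lceil\log_2 n\rceil$.) 3. Choose a vertex $p$ of maximum degree $d$ and enumerate its neighbors as $q_0,\dots,q_{d-1}$. Every vertex $v$ gets a bitvector $D_v$ of length $d$. At first, all bits are $0$ except that $D_{q_i}[i]=1$.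 A breadth-first traversal from $p$ replaces $D_w$ by the disjunction $D_w\lor D_v$ for each edge from a vertex $v$ to a vertex $w$ that is farther from $p$. When it is complete, reject if for some edge $vw$ the vectors $D_v$, $D_w$ differ in two or more bits. Let $E_i$ be the set of edges $vw$ with $D_v[i]\ne D_w[i]$, and $\mathcal E=\{E_0,\dots,E_{d-1}\}$. 4. Contract all edges in $\bigcup_i E_i$. Reject if an edge outside $\bigcup_i E_i$ becomes a self-loop. Remove self-loops and multiple adjacencies to obtain a graph $G'$. 5. Call the algorithm for $G'$ with limit $L-d$; reject if it rejects. Otherwise return the classes of $G'$, with each edge of $G'$ replaced by the edges of $G$ that it represents, followed by the classes in $\mathcal E$; the label of a vertex $v$ is the label of its image in $G'$, followed by $D_v$. Then the following hold. (a) The algorithm always terminates, whatever choices of $p$ and of the enumerations it makes, either with a rejection or with a list of edge classes and a labeling. It can be carried out in time $O(n^2)$: there are constants $c$, $C$ and a program for a word RAM (arithmetic operations $+,-,\times$ modulo the word range, bitwise Boolean operations, comparisons and array accesses on words take one step each) such that, on every machine whose words have at least $c(\lfloor\log_2 n\rfloor+1)$ bits and for every $G$, given as a list of its edges, the program halts after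 at most $Cn^2$ steps with the result of a run of the algorithm for $G$. (b) Whenever the algorithm returns classes and labels, whether or not $G$ is a partial cube, the classes form a partition of the edge set of $G$ into nonempty sets, and the class corresponding to each bit is exactly the cut that separates the vertices for which that bit is $0$ from the vertices for which it is $1$, that is, the set of all edges between these two sets of vertices. (c) If $G$ is a partial cube, the algorithm does not reject; $\sim_G$ is an equivalence relation on the edges, the classes returned are exactly its equivalence classes $[e]$, each listed once, and the labeling returned is correct. -/

import Mathlib

universe u

/-! ## A word RAM with unit-cost operations -/

namespace WordRAM

/-- The unit-cost operations on `w`-bit words: arithmetic (modulo `2 ^ w`), bitwise Boolean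
operations, and comparisons (with value `1` for true and `0` for false). -/
inductive Op
  | add | sub | mul | land | lor | lxor | eq | lt

/-- The result of an operation on two `w`-bit words. -/
def Op.apply (w : ℕ) : Op → ℕ → ℕ → ℕ
  | .add, a, b => (a + b) % 2 ^ w
  | .sub, a, b => (a + 2 ^ w - b) % 2 ^ w
  | .mul, a, b => (a * b) % 2 ^ w
  | .land, a, b => a &&& b
  | .lor, a, b => a ||| b
  | .lxor, a, b => a ^^^ b
  | .eq, a, b => if a = b then 1 else 0
  | .lt, a, b => if a < b then 1 else 0

/-- Terms over constants, registers and array cells; `get a t` is the cell of the array number `a`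
whose index is the value of `t`. -/
inductive Term
  | const (c : ℕ)
  | reg (x : ℕ)
  | get (a : ℕ) (t : Term)
  | op (o : Op) (s t : Term)

/-- Structured programs. A program is a finite piece of syntax, so it uses only finitely many
registers and arrays. -/
inductive Prog
  | skip
  | assign (x : ℕ) (t : Term)
  | store (a : ℕ) (i t : Term)
  | seq (P Q : Prog)
  | ite (t : Term) (P Q : Prog)
  | loop (t : Term) (P : Prog)

/-- A memory state: the contents of the registers and of the arrays. -/
structure Mem where
  reg : ℕ → ℕ
  arr : ℕ → ℕ → ℕ

/-- The value of a term on a machine with words of `w` bits. -/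
def Term.val (w : ℕ) (σ : Mem) : Term → ℕ
  | .const c => c % 2 ^ w
  | .reg x => σ.reg x
  | .get a t => σ.arr a (t.val w σ)
  | .op o s t => o.apply w (s.val w σ) (t.val w σ)

/-- The number of steps that the evaluation of a term takes: one for every constant, register
access, array access and operation in it. -/
def Term.cost : Term → ℕ
  | .const _ => 1
  | .reg _ => 1
  | .get _ t => t.cost + 1
  | .op _ s t => s.cost + t.cost + 1

/-- `Exec w P σ k τ`: on a machine with words of `w` bits, the program `P`, started in the memory
state `σ`, halts after exactly `k` steps in the memory state `τ`. -/
inductive Exec (w : ℕ) : Prog → Mem → ℕ → Mem → Prop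
  | skip (σ : Mem) : Exec w .skip σ 1 σ
  | assign (σ : Mem) (x : ℕ) (t : Term) :
      Exec w (.assign x t) σ (t.cost + 1)
        { σ with reg := Function.update σ.reg x (t.val w σ) }
  | store (σ : Mem) (a : ℕ) (i t : Term) :
      Exec w (.store a i t) σ (i.cost + t.cost + 1)
        { σ with
          arr := Function.update σ.arr a (Function.update (σ.arr a) (i.val w σ) (t.val w σ)) }
  | seq {P Q : Prog} {σ τ ρ : Mem} {k l : ℕ} :
      Exec w P σ k τ → Exec w Q τ l ρ → Exec w (.seq P Q) σ (k + l + 1) ρ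
  | ite_true {t : Term} {P Q : Prog} {σ τ : Mem} {k : ℕ} :
      t.val w σ ≠ 0 → Exec w P σ k τ → Exec w (.ite t P Q) σ (t.cost + k + 1) τ
  | ite_false {t : Term} {P Q : Prog} {σ τ : Mem} {k : ℕ} :
      t.val w σ = 0 → Exec w Q σ k τ → Exec w (.ite t P Q) σ (t.cost + k + 1) τ
  | loop_done {t : Term} {P : Prog} {σ : Mem} :
      t.val w σ = 0 → Exec w (.loop t P) σ (t.cost + 1) σ
  | loop_step {t : Term} {P : Prog} {σ τ ρ : Mem} {k l : ℕ} :
      t.val w σ ≠ 0 → Exec w P σ k τ → Exec w (.loop t P) τ l ρ →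
        Exec w (.loop t P) σ (t.cost + k + l + 1) ρ

end WordRAM

/-! ## Partial cubes and Winkler's relation -/

namespace PartialCube

variable {V : Type u}

/-- A labeling by bitvectors of length `k` is correct if every graph distance is the Hamming
distance of the labels. (`edist` is `⊤` for vertices in different components.) -/
def IsCorrectLabeling (G : SimpleGraph V) {k : ℕ} (label : V → Fin k → Bool) : Prop :=
  ∀ u v, G.edist u v = (hammingDist (label u) (label v) : ℕ∞)

/-- A partial cube is a graph that has a correct labeling by bitvectors. -/
def IsPartialCube (G : SimpleGraph V) : Prop :=
  ∃ (k : ℕ) (label : V → Fin k → Bool), IsCorrectLabeling G label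

/-- Winkler's relation: `pq ∼ rs` if `d(p,r) + d(q,s) ≠ d(p,s) + d(q,r)`. (Exchanging `p` and `q`,
or `r` and `s`, exchanges the two sides.) -/
def Winkler (G : SimpleGraph V) (e f : Sym2 V) : Prop :=
  ∃ p q r s : V, e = s(p, q) ∧ f = s(r, s) ∧
    G.dist p r + G.dist q s ≠ G.dist p s + G.dist q r

/-- The set `[e]` of all edges that are related to `e`. -/
def winklerClass (G : SimpleGraph V) (e : Sym2 V) : Set (Sym2 V) :=
  {f | f ∈ G.edgeSet ∧ Winkler G e f}

/-! ## The labeling algorithm -/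

/-- What the algorithm returns when it does not reject: `k` sets of edges, and a label of `k` bits
for every vertex. -/
structure Output (V : Type u) where
  k : ℕ
  cls : Fin k → Set (Sym2 V)
  label : V → Fin k → Bool

/-- The bits of one coordinate of the breadth-first traversal from `p`: the bit is set at `q`
initially, and when the traversal goes along an edge from `v` to a vertex `w` farther from `p`, the
bit of `v` is joined to that of `w` by a disjunction. -/
inductive BfsBit (G : SimpleGraph V) (p q : V) : V → Prop
  | start : BfsBit G p q q
  | step {v w : V} :
      G.Adj v w → G.dist p w = G.dist p v + 1 → BfsBit G p q v → BfsBit G p q w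

open Classical in
/-- The bitvector `D_v` for the neighbors `q 0, …, q (d - 1)` of `p`. -/
noncomputable def bits (G : SimpleGraph V) {p : V} {d : ℕ} (q : Fin d ≃ G.neighborSet p)
    (v : V) (i : Fin d) : Bool :=
  decide (BfsBit G p (q i) v)

/-- An edge has bitvectors at its two ends that differ in at least two bits. -/
def HasClash (G : SimpleGraph V) {p : V} {d : ℕ} (q : Fin d ≃ G.neighborSet p) : Prop :=
  ∃ (u v : V) (i j : Fin d), G.Adj u v ∧ i ≠ j ∧
    bits G q u i ≠ bits G q v i ∧ bits G q u j ≠ bits G q v j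

/-- The `i`-th edge class found at `p`: the edges whose ends have bitvectors that differ in
bit `i`. -/
def foundClass (G : SimpleGraph V) {p : V} {d : ℕ} (q : Fin d ≃ G.neighborSet p) (i : Fin d) :
    Set (Sym2 V) :=
  {e | ∃ u v, e = s(u, v) ∧ G.Adj u v ∧ bits G q u i ≠ bits G q v i}

/-- All edges that belong to a class found at `p`. -/
def foundEdges (G : SimpleGraph V) {p : V} {d : ℕ} (q : Fin d ≃ G.neighborSet p) :
    Set (Sym2 V) :=
  ⋃ i, foundClass G q i

/-- The vertices of the graph after the contraction of the edges in `E`: the connected components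
of the graph with edge set `E`. -/
abbrev ContractedVertex (E : Set (Sym2 V)) : Type u :=
  (SimpleGraph.fromEdgeSet E).ConnectedComponent

/-- The vertex that represents `v` after the contraction of the edges in `E`. -/
abbrev toContracted (E : Set (Sym2 V)) (v : V) : ContractedVertex E :=
  (SimpleGraph.fromEdgeSet E).connectedComponentMk v

/-- The graph after the contraction of the edges in `E` and the removal of all self-loops and
multiple adjacencies. -/
def contract (G : SimpleGraph V) (E : Set (Sym2 V)) : SimpleGraph (ContractedVertex E) :=
  SimpleGraph.fromRel fun x y => ∃ u v, G.Adj u v ∧ toContracted E u = x ∧ toContracted E v = y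

/-- The contraction of `E` turns an edge outside `E` into a self-loop. -/
def HasBadLoop (G : SimpleGraph V) (E : Set (Sym2 V)) : Prop :=
  ∃ u v, G.Adj u v ∧ s(u, v) ∉ E ∧ toContracted E u = toContracted E v

/-- The output for `G`, made of the output for the contracted graph, carried back to the edges and
vertices of `G`, and of the classes and bitvectors found at `p`. -/
noncomputable def extend (G : SimpleGraph V) {p : V} {d : ℕ} (q : Fin d ≃ G.neighborSet p)
    (o : Output (ContractedVertex (foundEdges G q))) : Output V where
  k := o.k + d
  cls := Fin.append
    (fun i => {e | e ∈ G.edgeSet ∧ e.map (toContracted (foundEdges G q)) ∈ o.cls i})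
    (foundClass G q)
  label v := Fin.append (o.label (toContracted (foundEdges G q) v)) (bits G q v)

/-- The conditions for a recursive call, when the vertex `p` and the enumeration `q` of its
neighbors have been chosen: `p` has maximum degree, and no test leads to a rejection. -/
def Passes (G : SimpleGraph V) (L : ℕ) {p : V} {d : ℕ} (q : Fin d ≃ G.neighborSet p) : Prop :=
  (∀ v, (G.neighborSet v).ncard ≤ d) ∧ d ≤ L ∧ G.Connected ∧ G.IsBipartite ∧
    G.edgeSet.ncard ≤ Nat.card V * Nat.clog 2 (Nat.card V) ∧
    ¬ HasClash G q ∧ ¬ HasBadLoop G (foundEdges G q)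

/-- `Run G L r`: the recursive algorithm, called for the graph `G` with the limit `L` on the number
of classes, can terminate with the result `r`, where `none` is the claim that `G` is not a partial
cube. The vertex `p` of maximum degree `d` and the enumeration `q` of its neighbors are arbitrary.
In the test of the number of edges against `n * log₂ n`, a rounding up of `log₂ n` to the next
integer is allowed: too many edges may be reported as soon as there are more than `n * log₂ n`,
and must be reported if there are more than `n * ⌈log₂ n⌉`. -/
inductive Run : {V : Type u} → SimpleGraph V → ℕ → Option (Output V) → Prop
  | single {V : Type u} {G : SimpleGraph V} {L : ℕ} (hone : Nat.card V = 1) :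
      Run G L (some ⟨0, Fin.elim0, fun _ => Fin.elim0⟩)
  | reject_degree {V : Type u} {G : SimpleGraph V} {L : ℕ} (hone : Nat.card V ≠ 1)
      {v : V} (hdeg : L < (G.neighborSet v).ncard) :
      Run G L none
  | reject_disconnected {V : Type u} {G : SimpleGraph V} {L : ℕ} (hone : Nat.card V ≠ 1)
      (hconn : ¬ G.Connected) :
      Run G L none
  | reject_odd {V : Type u} {G : SimpleGraph V} {L : ℕ} (hone : Nat.card V ≠ 1)
      (hbip : ¬ G.IsBipartite) :
      Run G L none
  | reject_edges {V : Type u} {G : SimpleGraph V} {L : ℕ} (hone : Nat.card V ≠ 1)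
      (hmany : (Nat.card V : ℝ) * Real.logb 2 (Nat.card V) < (G.edgeSet.ncard : ℝ)) :
      Run G L none
  | reject_clash {V : Type u} {G : SimpleGraph V} {L : ℕ} (hone : Nat.card V ≠ 1)
      {p : V} {d : ℕ} (q : Fin d ≃ G.neighborSet p) (hmax : ∀ v, (G.neighborSet v).ncard ≤ d)
      (hclash : HasClash G q) :
      Run G L none
  | reject_loop {V : Type u} {G : SimpleGraph V} {L : ℕ} (hone : Nat.card V ≠ 1)
      {p : V} {d : ℕ} (q : Fin d ≃ G.neighborSet p) (hmax : ∀ v, (G.neighborSet v).ncard ≤ d)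
      (hloop : HasBadLoop G (foundEdges G q)) :
      Run G L none
  | recurse {V : Type u} {G : SimpleGraph V} {L : ℕ} (hone : Nat.card V ≠ 1)
      {p : V} {d : ℕ} (q : Fin d ≃ G.neighborSet p) (hpass : Passes G L q)
      {r : Option (Output (ContractedVertex (foundEdges G q)))}
      (hrec : Run (contract G (foundEdges G q)) (L - d) r) :
      Run G L (r.map (extend G q))

/-- Whatever choices are made, the algorithm called for `G` with the limit `L` does not make an
infinite chain of recursive calls. -/
inductive Terminates : {V : Type u} → SimpleGraph V → ℕ → Prop
  | intro {V : Type u} {G : SimpleGraph V} {L : ℕ}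
      (h : ∀ (p : V) (d : ℕ) (q : Fin d ≃ G.neighborSet p), Nat.card V ≠ 1 → Passes G L q →
        Terminates (contract G (foundEdges G q)) (L - d)) :
      Terminates G L

/-- The sets `cls i` are nonempty and pairwise disjoint, and their union is the set of edges. -/
def IsEdgePartition (G : SimpleGraph V) {k : ℕ} (cls : Fin k → Set (Sym2 V)) : Prop :=
  (∀ i, (cls i).Nonempty) ∧ (∀ i j, i ≠ j → Disjoint (cls i) (cls j)) ∧ ⋃ i, cls i = G.edgeSet

/-- Every `cls i` is the set of the edges that join a vertex with bit `i` equal to `0` and a vertex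
with bit `i` equal to `1`. -/
def IsCutLabeling (G : SimpleGraph V) {k : ℕ} (cls : Fin k → Set (Sym2 V))
    (label : V → Fin k → Bool) : Prop :=
  ∀ i u v, s(u, v) ∈ cls i ↔ G.Adj u v ∧ label u i ≠ label v i

/-- The sets `cls i` are exactly the classes `[e]` of Winkler's relation, each listed once, and
Winkler's relation is an equivalence relation on the edges. -/
def IsWinklerPartition (G : SimpleGraph V) {k : ℕ} (cls : Fin k → Set (Sym2 V)) : Prop :=
  Equivalence (fun e f : G.edgeSet => Winkler G e f) ∧ Function.Injective cls ∧
    Set.range cls = {C | ∃ e ∈ G.edgeSet, C = winklerClass G e}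

/-! ## Input and output of an implementation -/

/-- `e` lists every edge of `G` exactly once, by its two ends in some order. -/
def IsEdgeList {n m : ℕ} (G : SimpleGraph (Fin n)) (e : Fin m → Fin n × Fin n) : Prop :=
  Function.Injective (fun j => s((e j).1, (e j).2)) ∧
    Set.range (fun j => s((e j).1, (e j).2)) = G.edgeSet

/-- The initial memory: the numbers of vertices and of edges in registers `0` and `1`, the two ends
of the edge number `j` in the cells `j` of the arrays `0` and `1`, and `0` everywhere else. -/
def inputMem {n m : ℕ} (e : Fin m → Fin n × Fin n) : WordRAM.Mem where
  reg x := if x = 0 then n else if x = 1 then m else 0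
  arr a j :=
    if h : j < m then
      if a = 0 then ((e ⟨j, h⟩).1 : ℕ) else if a = 1 then ((e ⟨j, h⟩).2 : ℕ) else 0
    else 0

/-- The final memory `σ` represents the result `r`: register `0` is `0` for a rejection. Otherwise
it is `1`, the number of classes is in register `1`, the number of the class of the edge number `j`
is in cell `j` of the array `2`, and bit `i` of the label of the vertex `v` is in cell `v * n + i`
of the array `3`. -/
def Represents {n m : ℕ} (e : Fin m → Fin n × Fin n) (σ : WordRAM.Mem) :
    Option (Output (Fin n)) → Prop
  | none => σ.reg 0 = 0
  | some o => σ.reg 0 = 1 ∧ σ.reg 1 = o.k ∧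
      (∀ (j : Fin m) (i : Fin o.k), s((e j).1, (e j).2) ∈ o.cls i ↔ σ.arr 2 j = i) ∧
      ∀ (v : Fin n) (i : Fin o.k), σ.arr 3 (v * n + i) = (o.label v i).toNat

end PartialCube

/-!
The properties of the classes and labels that the algorithm returns are proved by induction on a
run, first for an arbitrary graph and then for a partial cube.

For an arbitrary graph, the bit of `D` for a neighbor `q` of `p` is `0` at `p` and `1` at `q`, so
every class found at `p` is nonempty, and `card_contracted_lt` shows that the contracted graph is
smaller; this gives termination. A class found at `p` is a cut by definition. The classes found at
`p` are disjoint because no edge has ends that differ in two bits. The other classes are the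
preimages of cuts of the contracted graph, and cover all other edges because none of these becomes
a loop (`extend_isEdgePartition`, `extend_isCutLabeling`).

A partial cube is an isometric subgraph of a cube. After the removal of constant coordinates, it is
described by the condition `IsCubical`, which does not mention distances: an edge flips exactly one
coordinate, and any vertex has an edge that flips a coordinate in the direction of any given other
vertex. In such a graph, the bit for the neighbor `q` of `p` tells whether a vertex differs from `p`
in the coordinate that is flipped by the edge `pq` (`IsCubical.bfsBit_iff`). Contracting the edges
found at `p` deletes these coordinates and leaves a graph that satisfies `IsCubical` again
(`IsCubical.contract`). No test rejects: the degrees are at most the number of coordinates, which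
is less than the number of vertices, and the number of edges is at most `n * log₂ n`
(`IsCubical.ncard_edgeSet_le`). Hence the bits that are returned are the coordinates, up to their
order, and two edges are related by Winkler's relation exactly if they flip the same coordinate
(`IsCubical.winkler_iff`).

For the running time, `program` implements the algorithm. With `d` the degree of the chosen vertex
and `Δ` the number of vertices that disappear in the contraction, one call takes `O(n * (d + Δ))`
steps unless it rejects, which can happen only once and takes `O(n²)` steps. Two ideas are needed.

* The bitvectors are computed for blocks of `b = ⌈log₂ n⌉` bits at a time, which fit into one word.
  One block takes a pass over the `m ≤ n * b` edges of the search, listed in the order of their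
  distance from `p`, and then `O(n)` steps for each of its bits (`block_spec`, `bitvectors_spec`).
  So `d` bits take `O(n * d)` steps even though `d * m` is too large.
* The contraction relabels all vertices whenever two representatives are merged. This takes `O(n)`
  steps, but it happens only `Δ` times (`merge_spec`).

The sum of all `d` is at most the initial limit `n - 1`, and the sum of all `Δ` is less than `n`, so
the total is `O(n²)` (`loop_spec`). Finally, the labels of the ends of an edge differ in exactly one
bit, whether or not the graph is a partial cube, so the number of the class of the edge can be read
off the difference of two sums, each of which is computed once per vertex (`mem_cls_iff_classOf`).
-/

namespace PartialCube

variable {V : Type u} {G : SimpleGraph V} {p : V} {d : ℕ}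

/-! ### Bitvectors and contraction for arbitrary graphs -/

theorem bits_eq_true (q : Fin d ≃ G.neighborSet p) (v : V) (i : Fin d) :
    bits G q v i = true ↔ BfsBit G p (q i) v := by
  simp [bits]

theorem toContracted_adj {E : Set (Sym2 V)} {u v : V} (h : s(u, v) ∈ E) :
    toContracted E u = toContracted E v := by
  rw [toContracted, toContracted, SimpleGraph.ConnectedComponent.eq]
  by_cases huv : u = v
  · subst huv; rfl
  · exact SimpleGraph.Adj.reachable (by simp [h, huv])

theorem toContracted_surjective (E : Set (Sym2 V)) : Function.Surjective (toContracted E) :=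
  fun x => x.exists_rep

theorem contract_adj {E : Set (Sym2 V)} {x y : ContractedVertex E} :
    (contract G E).Adj x y ↔
      x ≠ y ∧ ∃ u v, G.Adj u v ∧ toContracted E u = x ∧ toContracted E v = y := by
  simp only [contract, SimpleGraph.fromRel_adj]
  refine and_congr_right fun _ => ⟨?_, Or.inl⟩
  rintro (h | ⟨u, v, h, h1, h2⟩)
  · exact h
  · exact ⟨v, u, h.symm, h2, h1⟩

theorem mem_foundClass (q : Fin d ≃ G.neighborSet p) {i : Fin d} {u v : V} :
    s(u, v) ∈ foundClass G q i ↔ G.Adj u v ∧ bits G q u i ≠ bits G q v i := by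
  constructor
  · rintro ⟨a, b, h, hab, hne⟩
    rcases Sym2.eq_iff.1 h with ⟨rfl, rfl⟩ | ⟨rfl, rfl⟩
    · exact ⟨hab, hne⟩
    · exact ⟨hab.symm, hne.symm⟩
  · rintro ⟨h1, h2⟩
    exact ⟨u, v, rfl, h1, h2⟩

theorem mem_foundEdges (q : Fin d ≃ G.neighborSet p) {u v : V} :
    s(u, v) ∈ foundEdges G q ↔ G.Adj u v ∧ ∃ i, bits G q u i ≠ bits G q v i := by
  simp [foundEdges, mem_foundClass]

theorem foundEdges_subset (q : Fin d ≃ G.neighborSet p) : foundEdges G q ⊆ G.edgeSet := by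
  intro e
  induction e with
  | _ u v => exact fun h => ((mem_foundEdges q).1 h).1

theorem BfsBit.dist_pos {q v : V} (hq : G.Adj p q) (h : BfsBit G p q v) : 0 < G.dist p v := by
  induction h with
  | start => rw [SimpleGraph.dist_eq_one_iff_adj.2 hq]; exact one_pos
  | step _ h _ _ => omega

theorem bits_root (q : Fin d ≃ G.neighborSet p) (i : Fin d) : bits G q p i = false := by
  rw [← Bool.not_eq_true, bits_eq_true]
  intro h
  simpa using h.dist_pos (q i).2

theorem bits_neighbor (q : Fin d ≃ G.neighborSet p) (i : Fin d) : bits G q (q i) i = true :=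
  (bits_eq_true q _ i).2 .start

/-- The edge to the `i`-th neighbor belongs to the `i`-th class, so the class is nonempty. -/
theorem root_neighbor_mem_foundClass (q : Fin d ≃ G.neighborSet p) (i : Fin d) :
    s(p, (q i : V)) ∈ foundClass G q i := by
  rw [mem_foundClass, bits_root, bits_neighbor]
  exact ⟨(q i).2, by simp⟩

theorem ncard_neighborSet (q : Fin d ≃ G.neighborSet p) : (G.neighborSet p).ncard = d := by
  rw [← Nat.card_coe_set_eq, ← Nat.card_congr q, Nat.card_fin]

theorem exists_enumeration [Finite V] (G : SimpleGraph V) [Nonempty V] :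
    ∃ (p : V) (d : ℕ) (_ : Fin d ≃ G.neighborSet p), ∀ v, (G.neighborSet v).ncard ≤ d := by
  obtain ⟨p, hp⟩ := Finite.exists_max fun v => (G.neighborSet v).ncard
  exact ⟨p, _, (Finite.equivFin (G.neighborSet p)).symm, hp⟩

theorem pos_of_connected (q : Fin d ≃ G.neighborSet p) (hconn : G.Connected)
    (hone : Nat.card V ≠ 1) (hV : Finite V) : 0 < d := by
  have : Nontrivial V := by
    have := hconn.nonempty
    rw [← Finite.one_lt_card_iff_nontrivial]
    have := Nat.card_pos (α := V)
    omega
  obtain ⟨y, hy⟩ := hconn.preconnected.exists_adj_of_nontrivial p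
  rw [← ncard_neighborSet q, Set.ncard_pos]
  exact ⟨y, hy⟩

/-- The contraction identifies `p` with its neighbors. -/
theorem card_contracted_lt [Finite V] (q : Fin d ≃ G.neighborSet p) (hd : 0 < d) :
    Nat.card (ContractedVertex (foundEdges G q)) < Nat.card V := by
  refine lt_of_le_of_ne
    (Nat.card_le_card_of_surjective _ (toContracted_surjective _)) fun h => ?_
  have hb : Function.Bijective (toContracted (foundEdges G q)) :=
    (Nat.bijective_iff_surjective_and_card _).2 ⟨toContracted_surjective _, h.symm⟩
  have h1 := root_neighbor_mem_foundClass q ⟨0, hd⟩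
  exact G.ne_of_adj ((mem_foundClass q).1 h1).1
    (hb.1 (toContracted_adj (Set.mem_iUnion.2 ⟨_, h1⟩)))

instance [Nonempty V] (E : Set (Sym2 V)) : Nonempty (ContractedVertex E) :=
  ‹Nonempty V›.map (toContracted E)

/-! ### Termination, and existence of a run -/

theorem terminates [Finite V] (G : SimpleGraph V) (L : ℕ) : Terminates G L := by
  induction h : Nat.card V using Nat.strong_induction_on generalizing V L with
  | _ N ih =>
    refine .intro fun p d q hone hp => ?_
    have := card_contracted_lt q (pos_of_connected q hp.2.2.1 hone inferInstance)
    exact ih _ (h ▸ this) _ _ rfl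

/-- A failed test of the number of edges, in its lenient form, justifies the rejection. -/
theorem many_edges_of_not_le {n m : ℕ} (h : ¬ m ≤ n * Nat.clog 2 n) :
    (n : ℝ) * Real.logb 2 n < m := by
  rcases Nat.eq_zero_or_pos n with rfl | hn
  · simpa [Nat.pos_iff_ne_zero] using h
  have h1 : Real.logb 2 n ≤ (Nat.clog 2 n : ℝ) := by
    rw [Real.logb_le_iff_le_rpow one_lt_two (by exact_mod_cast hn), Real.rpow_natCast]
    exact_mod_cast Nat.le_pow_clog one_lt_two n
  refine (mul_le_mul_of_nonneg_left h1 n.cast_nonneg).trans_lt ?_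
  exact_mod_cast not_le.1 h

theorem exists_run [Finite V] [Nonempty V] (G : SimpleGraph V) (L : ℕ) : ∃ r, Run G L r := by
  induction h : Nat.card V using Nat.strong_induction_on generalizing V L with
  | _ N ih =>
    by_cases hone : Nat.card V = 1
    · exact ⟨_, .single hone⟩
    obtain ⟨p, d, q, hmax⟩ := exists_enumeration G
    by_cases hL : d ≤ L
    swap
    · exact ⟨none, .reject_degree hone (v := p) (by rw [ncard_neighborSet q]; omega)⟩
    by_cases hconn : G.Connected
    swap
    · exact ⟨none, .reject_disconnected hone hconn⟩
    by_cases hbip : G.IsBipartite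
    swap
    · exact ⟨none, .reject_odd hone hbip⟩
    by_cases hm : G.edgeSet.ncard ≤ Nat.card V * Nat.clog 2 (Nat.card V)
    swap
    · exact ⟨none, .reject_edges hone (many_edges_of_not_le hm)⟩
    by_cases hclash : HasClash G q
    · exact ⟨none, .reject_clash hone q hmax hclash⟩
    by_cases hloop : HasBadLoop G (foundEdges G q)
    · exact ⟨none, .reject_loop hone q hmax hloop⟩
    have hlt := card_contracted_lt q (pos_of_connected q hconn hone inferInstance)
    obtain ⟨r, hr⟩ := ih _ (h ▸ hlt) (contract G (foundEdges G q)) (L - d) rfl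
    exact ⟨_, .recurse hone q ⟨hmax, hL, hconn, hbip, hm, hclash, hloop⟩ hr⟩

/-! ### The returned classes are cuts and form a partition -/

theorem extend_isEdgePartition (q : Fin d ≃ G.neighborSet p) (hclash : ¬ HasClash G q)
    (hloop : ¬ HasBadLoop G (foundEdges G q)) {o : Output (ContractedVertex (foundEdges G q))}
    (ho : IsEdgePartition (contract G (foundEdges G q)) o.cls) :
    IsEdgePartition G (extend G q o).cls := by
  obtain ⟨hne, hdis, hun⟩ := ho
  have key : ∀ {e}, (∃ i, e.map (toContracted (foundEdges G q)) ∈ o.cls i) → ∀ j,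
      e ∉ foundClass G q j := by
    intro e ⟨i, hi⟩ j hj
    have h1 : e.map (toContracted (foundEdges G q)) ∈ (contract G (foundEdges G q)).edgeSet :=
      hun ▸ Set.mem_iUnion.2 ⟨i, hi⟩
    induction e with
    | _ u v =>
      rw [Sym2.map_mk, SimpleGraph.mem_edgeSet] at h1
      exact h1.ne (toContracted_adj (Set.mem_iUnion.2 ⟨j, hj⟩))
  refine ⟨fun i => ?_, fun i j hij => ?_, ?_⟩
  · induction i using Fin.addCases with
    | left i =>
      obtain ⟨e, he⟩ := hne i
      induction e with
      | _ x y =>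
        have h1 : s(x, y) ∈ (contract G (foundEdges G q)).edgeSet :=
          hun ▸ Set.mem_iUnion.2 ⟨i, he⟩
        obtain ⟨-, u, v, huv, rfl, rfl⟩ := contract_adj.1 h1
        exact ⟨s(u, v), by simpa [extend] using ⟨huv, he⟩⟩
    | right i => exact ⟨_, by simpa [extend] using root_neighbor_mem_foundClass q i⟩
  · rw [Set.disjoint_left]
    induction i using Fin.addCases with
    | left i =>
      induction j using Fin.addCases with
      | left j =>
        intro e he he'
        simp only [extend, Fin.append_left, Set.mem_ofPred_eq] at he he'
        refine Set.disjoint_left.1 (hdis i j ?_) he.2 he'.2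
        rintro rfl; exact hij rfl
      | right j =>
        intro e he he'
        simp only [extend, Fin.append_left, Fin.append_right, Set.mem_ofPred_eq] at he he'
        exact key ⟨i, he.2⟩ j he'
    | right i =>
      induction j using Fin.addCases with
      | left j =>
        intro e he' he
        simp only [extend, Fin.append_left, Fin.append_right, Set.mem_ofPred_eq] at he he'
        exact key ⟨j, he.2⟩ i he'
      | right j =>
        intro e he he'
        simp only [extend, Fin.append_right] at he he'
        induction e with
        | _ u v =>
          rw [mem_foundClass] at he he'
          refine hclash ⟨u, v, i, j, he.1, ?_, he.2, he'.2⟩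
          rintro rfl; exact hij rfl
  · ext e
    induction e with
    | _ u v =>
      rw [Set.mem_iUnion]
      constructor
      · rintro ⟨i, hi⟩
        induction i using Fin.addCases with
        | left i => simp only [extend, Fin.append_left, Set.mem_ofPred_eq] at hi; exact hi.1
        | right i =>
          simp only [extend, Fin.append_right, mem_foundClass] at hi; exact hi.1
      · intro huv
        by_cases hE : s(u, v) ∈ foundEdges G q
        · obtain ⟨i, hi⟩ := Set.mem_iUnion.1 hE
          exact ⟨Fin.natAdd _ i, by simpa [extend] using hi⟩
        · have h1 : s(toContracted (foundEdges G q) u, toContracted (foundEdges G q) v) ∈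
              (contract G (foundEdges G q)).edgeSet :=
            contract_adj.2 ⟨fun h => hloop ⟨u, v, huv, hE, h⟩, u, v, huv, rfl, rfl⟩
          rw [← hun, Set.mem_iUnion] at h1
          obtain ⟨i, hi⟩ := h1
          exact ⟨Fin.castAdd _ i, by simpa [extend] using ⟨huv, hi⟩⟩

theorem extend_isCutLabeling (q : Fin d ≃ G.neighborSet p)
    {o : Output (ContractedVertex (foundEdges G q))}
    (ho : IsCutLabeling (contract G (foundEdges G q)) o.cls o.label) :
    IsCutLabeling G (extend G q o).cls (extend G q o).label := by
  intro i u v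
  induction i using Fin.addCases with
  | left i =>
    simp only [extend, Fin.append_left, Set.mem_ofPred_eq, Sym2.map_mk, ho i, SimpleGraph.mem_edgeSet]
    refine ⟨fun h => ⟨h.1, h.2.2⟩, fun h => ⟨h.1, contract_adj.2 ⟨?_, u, v, h.1, rfl, rfl⟩, h.2⟩⟩
    intro h'
    exact h.2 (by rw [h'])
  | right i => simp only [extend, Fin.append_right, mem_foundClass]

theorem Run.isEdgePartition_isCutLabeling {L : ℕ} {r : Option (Output V)} (h : Run G L r)
    (o : Output V) (hr : r = some o) :
    IsEdgePartition G o.cls ∧ IsCutLabeling G o.cls o.label := by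
  induction h with
  | single hone =>
    cases hr
    have := (Nat.card_eq_one_iff_unique.1 hone).1
    refine ⟨⟨fun i => i.elim0, fun i => i.elim0, ?_⟩, fun i => i.elim0⟩
    ext e
    induction e with
    | _ u v =>
      simp only [Set.mem_iUnion, SimpleGraph.mem_edgeSet]
      exact ⟨fun ⟨i, _⟩ => i.elim0, fun h => (h.ne (Subsingleton.elim _ _)).elim⟩
  | recurse hone q hpass hrec ih =>
    obtain ⟨o', rfl, rfl⟩ := Option.map_eq_some_iff.1 hr
    obtain ⟨h1, h2⟩ := ih o' rfl
    exact ⟨extend_isEdgePartition q hpass.2.2.2.2.2.1 hpass.2.2.2.2.2.2 h1,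
      extend_isCutLabeling q h2⟩
  | _ => cases hr

variable {ι : Type*}

/-! ### Isometric embeddings into a cube, without superfluous coordinates -/

/-- `f` is an isometric embedding of `G` into a cube with coordinates `ι`, none of which is
constant, expressed without distances: an edge flips exactly one coordinate, and from every vertex
there is an edge that flips a coordinate in the direction of any given other vertex. -/
structure IsCubical (G : SimpleGraph V) (f : V → ι → Bool) : Prop where
  adj : ∀ {u v}, G.Adj u v → ∃ j, ∀ i, f u i ≠ f v i ↔ i = j
  step : ∀ {u v}, u ≠ v → ∃ w j, G.Adj u w ∧ f u j ≠ f v j ∧ ∀ i, f u i ≠ f w i ↔ i = j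
  nonconst : ∀ i, ∃ u v, f u i ≠ f v i

theorem hammingDist_flip [Fintype ι] {a x y : ι → Bool} {j : ι} (h : ∀ i, x i ≠ y i ↔ i = j)
    (ha : a j ≠ x j) : hammingDist a y + 1 = hammingDist a x := by
  classical
  have h1 : (Finset.univ.filter fun i => a i ≠ x i) =
      insert j (Finset.univ.filter fun i => a i ≠ y i) := by
    ext i
    have := h i
    by_cases hij : i = j
    · subst hij; simpa using ha
    · have : x i = y i := by simpa [hij] using this
      simp [hij, this]
  have h2 : j ∉ (Finset.univ.filter fun i => a i ≠ y i) := by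
    have := (h j).2 rfl
    simp only [Finset.mem_filter, Finset.mem_univ, true_and, not_not]
    revert ha this
    cases a j <;> cases x j <;> cases y j <;> decide
  simp only [hammingDist]
  rw [h1, Finset.card_insert_of_notMem h2]

theorem hammingDist_flip_eq_one [Fintype ι] {x y : ι → Bool} {j : ι}
    (h : ∀ i, x i ≠ y i ↔ i = j) : hammingDist x y = 1 := by
  have := hammingDist_flip (a := y) h ((h j).2 rfl).symm
  rw [hammingDist_self] at this
  rw [hammingDist_comm, ← this]

namespace IsCubical

variable {f : V → ι → Bool} (hf : IsCubical G f)
include hf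

theorem injective : Function.Injective f := by
  intro u v h
  by_contra hne
  obtain ⟨w, j, -, h1, -⟩ := hf.step hne
  exact h1 (congrFun h j)

theorem reachable_dist [Fintype ι] (u v : V) :
    G.Reachable u v ∧ G.dist u v ≤ hammingDist (f u) (f v) := by
  induction h : hammingDist (f u) (f v) generalizing u with
  | zero =>
    obtain rfl := hf.injective (hammingDist_eq_zero.1 h)
    simp
  | succ k ih =>
    have hne : u ≠ v := by rintro rfl; simp at h
    obtain ⟨w, j, hadj, hj, hw⟩ := hf.step hne
    have h1 := hammingDist_flip (a := f v) hw hj.symm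
    rw [hammingDist_comm (f v), hammingDist_comm (f v)] at h1
    obtain ⟨h2, h3⟩ := ih w (by omega)
    refine ⟨hadj.reachable.trans h2, ?_⟩
    obtain ⟨q, hq⟩ := h2.exists_walk_length_eq_dist
    have := SimpleGraph.dist_le (SimpleGraph.Walk.cons hadj q)
    rw [SimpleGraph.Walk.length_cons] at this
    omega

theorem dist_eq [Fintype ι] (u v : V) : G.dist u v = hammingDist (f u) (f v) := by
  obtain ⟨h1, h2⟩ := hf.reachable_dist u v
  refine le_antisymm h2 ?_
  obtain ⟨q, hq⟩ := h1.exists_walk_length_eq_dist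
  rw [← hq]
  clear hq h1 h2
  induction q with
  | nil => simp
  | cons h q ih =>
    obtain ⟨j, hj⟩ := hf.adj h
    have := hammingDist_flip_eq_one hj
    refine (hammingDist_triangle _ _ _).trans ((add_le_add this.le ih).trans_eq ?_)
    rw [SimpleGraph.Walk.length_cons, add_comm]

theorem connected [Finite ι] [Nonempty V] : G.Connected :=
  have := Fintype.ofFinite ι
  ⟨fun u v => (hf.reachable_dist u v).1⟩

theorem isBipartite [Finite ι] : G.IsBipartite := by
  have := Fintype.ofFinite ι
  rcases isEmpty_or_nonempty V with _ | ⟨⟨p⟩⟩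
  · exact ⟨⟨isEmptyElim, fun {a} => isEmptyElim a⟩⟩
  refine ⟨SimpleGraph.Coloring.mk
    (fun v => (⟨G.dist p v % 2, Nat.mod_lt _ two_pos⟩ : Fin 2)) fun {u v} h => ?_⟩
  obtain ⟨j, hj⟩ := hf.adj h
  simp only [ne_eq, Fin.mk.injEq, hf.dist_eq]
  by_cases hp : f p j = f u j
  · have := hammingDist_flip (a := f p) (x := f v) (y := f u)
      (fun i => ne_comm.trans (hj i)) (hp ▸ (hj j).2 rfl)
    omega
  · have := hammingDist_flip (a := f p) hj hp
    omega

/-! ### The number of edges and the number of coordinates -/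

/-- Different coordinates are flipped by different edges of a spanning tree. -/
theorem card_le [Fintype ι] [Finite V] [Nonempty V] : Fintype.card ι ≤ Nat.card V - 1 := by
  classical
  have := Fintype.ofFinite V
  obtain ⟨T, hTG, hT⟩ := hf.connected.exists_isTree_le
  have key : ∀ i, ∃ e : Sym2 V, e ∈ T.edgeFinset ∧ ∃ u v, e = s(u, v) ∧ f u i ≠ f v i := by
    intro i
    by_contra! hcon
    obtain ⟨u, v, huv⟩ := hf.nonconst i
    obtain ⟨q⟩ := hT.connected.preconnected u v
    apply huv
    clear huv
    induction q with
    | nil => rfl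
    | cons h q ih => exact (hcon _ (by simpa using h) _ _ rfl).trans ih
  choose e he x y hxy hne using key
  have hinj : Function.Injective e := by
    intro i j hij
    have hadj : G.Adj (x j) (y j) := hTG (by simpa [hxy j] using he j)
    obtain ⟨k, hk⟩ := hf.adj hadj
    have hj : j = k := (hk j).1 (hne j)
    have hi : i = k := by
      refine (hk i).1 ?_
      rcases Sym2.eq_iff.1 ((hxy i).symm.trans (hij.trans (hxy j))) with ⟨h1, h2⟩ | ⟨h1, h2⟩
      · rw [← h1, ← h2]; exact hne i
      · rw [← h1, ← h2]; exact (hne i).symm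
    rw [hi, hj]
  have h1 : Fintype.card ι ≤ T.edgeFinset.card := by
    rw [← Finset.card_univ]
    exact Finset.card_le_card_of_injOn e (fun i _ => he i) hinj.injOn
  have h2 := hT.card_edgeFinset
  rw [Nat.card_eq_fintype_card]
  omega

/-- Different edges at a vertex flip different coordinates. -/
theorem ncard_neighborSet_le [Fintype ι] [Finite V] (v : V) :
    (G.neighborSet v).ncard ≤ Fintype.card ι := by
  have key : ∀ w : G.neighborSet v, ∃ j, ∀ i, f v i ≠ f w i ↔ i = j := fun w => hf.adj w.2
  choose c hc using key
  rw [← Nat.card_coe_set_eq, ← Nat.card_eq_fintype_card]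
  refine Nat.card_le_card_of_injective c fun w w' h => Subtype.ext (hf.injective ?_)
  funext i
  have h1 := hc w i
  have h2 := hc w' i
  rw [← h] at h2
  have h3 := h1.trans h2.symm
  revert h3
  cases f v i <;> cases f w i <;> cases f w' i <;> decide

omit hf in
/-- The superadditivity of `x * log₂ x` that carries the induction over the coordinates: a matching
between two parts has at most as many edges as the smaller part has vertices. -/
theorem mul_logb_add_le (x y k : ℕ) (hx : k ≤ x) (hy : k ≤ y) :
    (x : ℝ) * Real.logb 2 x + y * Real.logb 2 y + k ≤ (x + y : ℕ) * Real.logb 2 (x + y : ℕ) := by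
  wlog hxy : x ≤ y generalizing x y
  · have := this y x hy hx (by omega)
    rw [add_comm y x] at this
    linarith
  rcases Nat.eq_zero_or_pos x with rfl | hpos
  · obtain rfl : k = 0 := by omega
    simp
  have hxr : (0 : ℝ) < x := by exact_mod_cast hpos
  have hyr : (0 : ℝ) < y := by exact_mod_cast hpos.trans_le hxy
  have hkr : (k : ℝ) ≤ x := by exact_mod_cast hx
  have hxyr : (x : ℝ) ≤ y := by exact_mod_cast hxy
  have h1 : Real.logb 2 x + 1 ≤ Real.logb 2 (x + y) := by
    have : Real.logb 2 x + 1 = Real.logb 2 (x * 2) := by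
      rw [Real.logb_mul hxr.ne' two_ne_zero, Real.logb_self_eq_one one_lt_two]
    rw [this]
    exact Real.logb_le_logb_of_le one_lt_two (by positivity) (by linarith)
  have h2 : Real.logb 2 y ≤ Real.logb 2 (x + y) :=
    Real.logb_le_logb_of_le one_lt_two hyr (by linarith)
  push_cast
  nlinarith [mul_le_mul_of_nonneg_left h1 hxr.le, mul_le_mul_of_nonneg_left h2 hyr.le]

/-- A set of vertices of a cube that agree outside the coordinates `T` spans at most
`n * log₂ n` edges, by induction on `T`: a new coordinate splits the set into two halves, and the
edges that flip it form a matching between them. -/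
theorem card_edges_le (T : Finset ι) (S : Finset V)
    (hS : ∀ u ∈ S, ∀ v ∈ S, ∀ i ∉ T, f u i = f v i) (E : Finset (V × V))
    (hE : ∀ e ∈ E, e.1 ∈ S ∧ e.2 ∈ S ∧ ∃ j, (∀ i, f e.1 i ≠ f e.2 i ↔ i = j) ∧ f e.1 j = false) :
    (E.card : ℝ) ≤ S.card * Real.logb 2 S.card := by
  classical
  induction T using Finset.induction_on generalizing S E with
  | empty =>
    have hE0 : E = ∅ := by
      rw [Finset.eq_empty_iff_forall_notMem]
      intro e he
      obtain ⟨h1, h2, j, hj, -⟩ := hE e he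
      exact (hj j).2 rfl (hS _ h1 _ h2 j (by simp))
    rw [hE0, Finset.card_empty, Nat.cast_zero]
    rcases Nat.eq_zero_or_pos S.card with h | h
    · simp [h]
    · exact mul_nonneg (Nat.cast_nonneg _) (Real.logb_nonneg one_lt_two (by exact_mod_cast h))
  | insert a T ha ih =>
    set S0 := S.filter fun v => f v a = false with hS0
    set S1 := S.filter fun v => ¬ f v a = false with hS1
    set E' := E.filter fun e => f e.1 a ≠ f e.2 a with hE'
    set E0 := (E.filter fun e => ¬ f e.1 a ≠ f e.2 a).filter fun e => f e.1 a = false with hE0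
    set E1 := (E.filter fun e => ¬ f e.1 a ≠ f e.2 a).filter fun e => ¬ f e.1 a = false with hE1
    have hScard : S0.card + S1.card = S.card := Finset.card_filter_add_card_filter_not _
    have hEcard : E'.card + (E0.card + E1.card) = E.card := by
      rw [hE0, hE1, Finset.card_filter_add_card_filter_not,
        Finset.card_filter_add_card_filter_not]
    have h0 : (E0.card : ℝ) ≤ S0.card * Real.logb 2 S0.card := by
      refine ih S0 (fun u hu v hv i hi => ?_) E0 fun e he => ?_
      · simp only [hS0, Finset.mem_filter] at hu hv
        by_cases hia : i = a
        · rw [hia, hu.2, hv.2]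
        · exact hS u hu.1 v hv.1 i (by simp [hia, hi])
      · simp only [hE0, Finset.mem_filter, not_not] at he
        obtain ⟨h1, h2, h3⟩ := hE e he.1.1
        exact ⟨by simp [hS0, h1, he.2], by simp [hS0, h2, ← he.1.2, he.2], h3⟩
    have h1 : (E1.card : ℝ) ≤ S1.card * Real.logb 2 S1.card := by
      refine ih S1 (fun u hu v hv i hi => ?_) E1 fun e he => ?_
      · simp only [hS1, Finset.mem_filter, Bool.not_eq_false] at hu hv
        by_cases hia : i = a
        · rw [hia, hu.2, hv.2]
        · exact hS u hu.1 v hv.1 i (by simp [hia, hi])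
      · simp only [hE1, Finset.mem_filter, not_not] at he
        obtain ⟨h1, h2, h3⟩ := hE e he.1.1
        exact ⟨by simp [hS1, h1, he.2], by simpa [hS1, h2, ← he.1.2] using he.2, h3⟩
    have hflip : ∀ e ∈ E', e.1 ∈ S0 ∧ e.2 ∈ S1 ∧ ∀ i, f e.1 i ≠ f e.2 i ↔ i = a := by
      intro e he
      simp only [hE', Finset.mem_filter] at he
      obtain ⟨h1, h2, j, hj, h3⟩ := hE e he.1
      obtain rfl : a = j := (hj a).1 he.2
      refine ⟨by simp [hS0, h1, h3], ?_, hj⟩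
      have := he.2
      rw [h3] at this
      simpa [hS1, h2] using this.symm
    have hext : ∀ e ∈ E', ∀ e' ∈ E', (f e.1 = f e'.1 ↔ f e.2 = f e'.2) := by
      intro e he e' he'
      have h1 := (hflip e he).2.2
      have h2 := (hflip e' he').2.2
      simp only [funext_iff]
      refine forall_congr' fun i => ?_
      have h3 := (h1 i).trans (h2 i).symm
      revert h3
      cases f e.1 i <;> cases f e.2 i <;> cases f e'.1 i <;> cases f e'.2 i <;> decide
    have hk0 : E'.card ≤ S0.card :=
      Finset.card_le_card_of_injOn Prod.fst (fun e he => (hflip e he).1)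
        fun e he e' he' h => Prod.ext h (hf.injective ((hext e he e' he').1 (congrArg f h)))
    have hk1 : E'.card ≤ S1.card :=
      Finset.card_le_card_of_injOn Prod.snd (fun e he => (hflip e he).2.1)
        fun e he e' he' h => Prod.ext (hf.injective ((hext e he e' he').2 (congrArg f h))) h
    have := mul_logb_add_le S0.card S1.card E'.card hk0 hk1
    rw [hScard] at this
    rw [← hEcard]
    push_cast
    linarith

theorem ncard_edgeSet_le [Finite ι] [Finite V] :
    (G.edgeSet.ncard : ℝ) ≤ Nat.card V * Real.logb 2 (Nat.card V) := by
  classical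
  have := Fintype.ofFinite V
  have := Fintype.ofFinite ι
  let E : Finset (V × V) := Finset.univ.filter fun e =>
    ∃ j, (∀ i, f e.1 i ≠ f e.2 i ↔ i = j) ∧ f e.1 j = false
  have h1 := hf.card_edges_le Finset.univ Finset.univ (by simp) E
    (fun e he => by simpa [E] using he)
  rw [Finset.card_univ, ← Nat.card_eq_fintype_card] at h1
  refine le_trans ?_ h1
  have h2 : G.edgeSet ⊆ (fun e : V × V => s(e.1, e.2)) '' (E : Set (V × V)) := by
    intro e he
    induction e with
    | _ u v =>
      obtain ⟨j, hj⟩ := hf.adj he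
      cases hu : f u j
      · exact ⟨(u, v), by simpa [E] using ⟨j, by simpa using hj, hu⟩, rfl⟩
      · refine ⟨(v, u), ?_, Sym2.eq_swap⟩
        have h3 := (hj j).2 rfl
        rw [hu] at h3
        simp only [E, Finset.coe_filter, Finset.mem_univ, true_and]
        exact ⟨j, fun i => ne_comm.trans (hj i), by simpa using h3.symm⟩
  have h3 := (Set.ncard_le_ncard h2 (Set.toFinite _)).trans
    (Set.ncard_image_le (Set.toFinite _))
  rw [Set.ncard_coe_finset] at h3
  exact_mod_cast h3

/-! ### One step of the algorithm in a partial cube -/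

variable {q : Fin d ≃ G.neighborSet p} {c : Fin d → ι}

/-- In a partial cube, the bit of the traversal that starts at a neighbor `q` of `p` tells whether
the coordinate `c` of the edge `pq` differs from its value at `p`. -/
theorem bfsBit_iff [Finite ι] {q : V} {c : ι} (hq : ∀ i, f p i ≠ f q i ↔ i = c) (v : V) :
    BfsBit G p q v ↔ f p c ≠ f v c := by
  have := Fintype.ofFinite ι
  constructor
  · intro h
    induction h with
    | start => exact (hq c).2 rfl
    | @step v w hvw hdist _ ih =>
      intro hcon
      obtain ⟨j, hj⟩ := hf.adj hvw
      have hcj : c = j := (hj c).1 fun h => ih (hcon.trans h.symm)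
      subst hcj
      have := hammingDist_flip (a := f p) hj ih
      rw [hf.dist_eq, hf.dist_eq] at hdist
      omega
  · intro h
    induction hk : hammingDist (f p) (f v) using Nat.strong_induction_on generalizing v with
    | _ k ih =>
      by_cases hv : v = q
      · subst hv; exact .start
      obtain ⟨w, j, hadj, hj, hw⟩ := hf.step hv
      have hjc : j ≠ c := by
        rintro rfl
        have h2 := (hq j).2 rfl
        revert h h2 hj
        cases f p j <;> cases f v j <;> cases f q j <;> decide
      have hpj : f p j = f q j := by simpa [hjc] using hq j
      have h1 := hammingDist_flip (a := f p) hw (hpj ▸ hj.symm)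
      have hwc : f v c = f w c := by simpa [hjc.symm] using hw c
      refine .step hadj.symm ?_ (ih _ (by omega) w (hwc ▸ h) rfl)
      rw [hf.dist_eq, hf.dist_eq, h1]

theorem exists_coordinates (q : Fin d ≃ G.neighborSet p) :
    ∃ c : Fin d → ι, Function.Injective c ∧ ∀ a i, f p i ≠ f (q a) i ↔ i = c a := by
  have key : ∀ a, ∃ j, ∀ i, f p i ≠ f (q a) i ↔ i = j := fun a => hf.adj (q a).2
  choose c hc using key
  refine ⟨c, fun a b h => q.injective (Subtype.ext (hf.injective ?_)), hc⟩
  funext i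
  have h1 := hc a i
  have h2 := hc b i
  rw [← h] at h2
  have h3 := h1.trans h2.symm
  revert h3
  cases f p i <;> cases f (q a) i <;> cases f (q b) i <;> decide

theorem bits_ne_iff [Finite ι] (hc : ∀ a i, f p i ≠ f (q a) i ↔ i = c a) (u v : V) (a : Fin d) :
    bits G q u a ≠ bits G q v a ↔ f u (c a) ≠ f v (c a) := by
  have h1 := (bits_eq_true q u a).trans (hf.bfsBit_iff (hc a) u)
  have h2 := (bits_eq_true q v a).trans (hf.bfsBit_iff (hc a) v)
  revert h1 h2
  cases bits G q u a <;> cases bits G q v a <;> cases f p (c a) <;> cases f u (c a) <;>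
    cases f v (c a) <;> decide

theorem not_hasClash [Finite ι] (q : Fin d ≃ G.neighborSet p) : ¬ HasClash G q := by
  rintro ⟨u, v, a, b, huv, hab, h1, h2⟩
  obtain ⟨c, hinj, hc⟩ := hf.exists_coordinates q
  rw [hf.bits_ne_iff hc] at h1 h2
  obtain ⟨j, hj⟩ := hf.adj huv
  exact hab (hinj (((hj _).1 h1).trans ((hj _).1 h2).symm))

theorem mem_foundEdges_iff [Finite ι] (hc : ∀ a i, f p i ≠ f (q a) i ↔ i = c a) {u v : V} {j : ι}
    (huv : G.Adj u v) (hj : ∀ i, f u i ≠ f v i ↔ i = j) :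
    s(u, v) ∈ foundEdges G q ↔ j ∈ Set.range c := by
  simp only [mem_foundEdges, huv, true_and, hf.bits_ne_iff hc, hj, Set.mem_range]

theorem toContracted_eq_iff [Finite ι] (hc : ∀ a i, f p i ≠ f (q a) i ↔ i = c a) (u v : V) :
    toContracted (foundEdges G q) u = toContracted (foundEdges G q) v ↔
      ∀ i ∉ Set.range c, f u i = f v i := by
  have := Fintype.ofFinite ι
  constructor
  · intro h
    obtain ⟨w⟩ := SimpleGraph.ConnectedComponent.eq.1 h
    clear h
    induction w with
    | nil => exact fun _ _ => rfl
    | @cons a b _ h _ ih =>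
      intro i hi
      refine Eq.trans ?_ (ih i hi)
      rw [SimpleGraph.fromEdgeSet_adj] at h
      have hab := ((mem_foundEdges q).1 h.1).1
      obtain ⟨j, hj⟩ := hf.adj hab
      by_contra hne
      have := (hf.mem_foundEdges_iff hc hab hj).1 h.1
      exact hi ((hj i).1 hne ▸ this)
  · intro h
    induction hk : hammingDist (f v) (f u) using Nat.strong_induction_on generalizing u with
    | _ k ih =>
      by_cases huv : u = v
      · rw [huv]
      obtain ⟨w, j, hadj, hj, hw⟩ := hf.step huv
      have hjc : j ∈ Set.range c := by
        by_contra hcon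
        exact hj (h j hcon)
      have h1 := hammingDist_flip (a := f v) hw hj.symm
      rw [toContracted_adj ((hf.mem_foundEdges_iff hc hadj hw).2 hjc)]
      refine ih _ (by omega) w (fun i hi => ?_) rfl
      have hij : i ≠ j := by rintro rfl; exact hi hjc
      have : f u i = f w i := by simpa [hij] using hw i
      rw [← this, h i hi]

theorem not_hasBadLoop [Finite ι] (q : Fin d ≃ G.neighborSet p) :
    ¬ HasBadLoop G (foundEdges G q) := by
  rintro ⟨u, v, huv, hmem, heq⟩
  obtain ⟨c, hinj, hc⟩ := hf.exists_coordinates q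
  obtain ⟨j, hj⟩ := hf.adj huv
  rw [hf.mem_foundEdges_iff hc huv hj] at hmem
  exact (hj j).2 rfl ((hf.toContracted_eq_iff hc u v).1 heq j hmem)

/-- The contraction removes the coordinates of the edges at `p` and leaves an isometric embedding
into the cube on the others. -/
theorem contract [Finite ι] (hc : ∀ a i, f p i ≠ f (q a) i ↔ i = c a) :
    ∃ g : ContractedVertex (foundEdges G q) → ↥(Set.range c)ᶜ → Bool,
      IsCubical (contract G (foundEdges G q)) g ∧
        ∀ v i, g (toContracted (foundEdges G q) v) i = f v i := by
  have := Fintype.ofFinite ι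
  let g : ContractedVertex (foundEdges G q) → ↥(Set.range c)ᶜ → Bool := fun x i => f x.out i
  have hg : ∀ v i, g (toContracted (foundEdges G q) v) i = f v i := fun v i =>
    (hf.toContracted_eq_iff hc _ _).1 (Quot.out_eq _) i i.2
  refine ⟨g, ⟨?_, ?_, ?_⟩, hg⟩
  · intro x y hxy
    obtain ⟨hne, u, v, huv, rfl, rfl⟩ := contract_adj.1 hxy
    obtain ⟨j, hj⟩ := hf.adj huv
    refine ⟨⟨j, fun hjc => hne (toContracted_adj ((hf.mem_foundEdges_iff hc huv hj).2 hjc))⟩,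
      fun i => ?_⟩
    rw [hg, hg, hj, Subtype.ext_iff]
  · intro x y
    obtain ⟨u, rfl⟩ := toContracted_surjective _ x
    obtain ⟨v, rfl⟩ := toContracted_surjective _ y
    intro hne
    induction hk : hammingDist (f v) (f u) using Nat.strong_induction_on generalizing u with
    | _ k ih =>
      have huv : u ≠ v := by rintro rfl; exact hne rfl
      obtain ⟨w, j, hadj, hj, hw⟩ := hf.step huv
      have h1 := hammingDist_flip (a := f v) hw hj.symm
      have hmem := hf.mem_foundEdges_iff hc hadj hw
      by_cases hjc : j ∈ Set.range c
      · rw [toContracted_adj (hmem.2 hjc)] at hne ⊢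
        exact ih _ (by omega) w hne rfl
      · refine ⟨toContracted _ w, ⟨j, hjc⟩, contract_adj.2 ⟨?_, u, w, hadj, rfl, rfl⟩, ?_, ?_⟩
        · intro h
          exact (hw j).2 rfl ((hf.toContracted_eq_iff hc _ _).1 h j hjc)
        · rw [hg, hg]; exact hj
        · intro i
          rw [hg, hg, hw, Subtype.ext_iff]
  · intro i
    obtain ⟨u, v, huv⟩ := hf.nonconst i
    exact ⟨toContracted _ u, toContracted _ v, by rwa [hg, hg]⟩

theorem congr_equiv {κ : Type*} {g : V → κ → Bool} (φ : κ ≃ ι)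
    (h : ∀ u v k, g u k ≠ g v k ↔ f u (φ k) ≠ f v (φ k)) : IsCubical G g := by
  refine ⟨fun huv => ?_, fun huv => ?_, fun i => ?_⟩
  · obtain ⟨j, hj⟩ := hf.adj huv
    exact ⟨φ.symm j, fun i => by rw [h, hj, Equiv.eq_symm_apply]⟩
  · obtain ⟨w, j, h1, h2, h3⟩ := hf.step huv
    exact ⟨w, φ.symm j, h1, by rw [h]; simpa using h2,
      fun i => by rw [h, h3, Equiv.eq_symm_apply]⟩
  · obtain ⟨u, v, huv⟩ := hf.nonconst (φ i)
    exact ⟨u, v, (h u v i).2 huv⟩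

omit hf in
/-- In a partial cube the algorithm never rejects, and its bits are the coordinates of the given
embedding, up to their order and to complementation. -/
theorem run {V : Type u} {G : SimpleGraph V} {L : ℕ} {r : Option (Output V)} (hr : Run G L r) :
    ∀ (ι : Type) [Finite ι] [Finite V] [Nonempty V] (f : V → ι → Bool), IsCubical G f →
      Nat.card ι ≤ L → ∃ o, r = some o ∧ ∃ φ : Fin o.k ≃ ι,
        ∀ u v i, o.label u i ≠ o.label v i ↔ f u (φ i) ≠ f v (φ i) := by
  induction hr with
  | single hone =>
    intro ι _ _ _ f hf hL
    have := (Nat.card_eq_one_iff_unique.1 hone).1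
    have : IsEmpty ι := ⟨fun i => by
      obtain ⟨u, v, huv⟩ := hf.nonconst i
      exact huv (by rw [Subsingleton.elim u v])⟩
    exact ⟨_, rfl, Equiv.equivOfIsEmpty _ _, fun u v i => i.elim0⟩
  | reject_degree hone hdeg =>
    intro ι _ _ _ f hf hL
    have := Fintype.ofFinite ι
    rw [Nat.card_eq_fintype_card] at hL
    exact absurd (hf.ncard_neighborSet_le _) (not_le.2 (hL.trans_lt hdeg))
  | reject_disconnected hone hconn =>
    intro ι _ _ _ f hf hL
    exact absurd hf.connected hconn
  | reject_odd hone hbip =>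
    intro ι _ _ _ f hf hL
    exact absurd hf.isBipartite hbip
  | reject_edges hone hmany =>
    intro ι _ _ _ f hf hL
    exact absurd hf.ncard_edgeSet_le (not_le.2 hmany)
  | reject_clash hone q hmax hclash =>
    intro ι _ _ _ f hf hL
    exact absurd hclash (hf.not_hasClash q)
  | reject_loop hone q hmax hloop =>
    intro ι _ _ _ f hf hL
    exact absurd hloop (hf.not_hasBadLoop q)
  | @recurse V G L hone p d q hpass r hrec ih =>
    intro ι _ _ _ f hf hL
    classical
    obtain ⟨c, hinj, hc⟩ := hf.exists_coordinates q
    obtain ⟨g, hg, hgf⟩ := hf.contract hc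
    have hcard : Nat.card ↥(Set.range c)ᶜ ≤ L - d := by
      have h1 := Nat.card_congr (Equiv.Set.sumCompl (Set.range c))
      rw [Nat.card_sum, ← Nat.card_congr (Equiv.ofInjective c hinj), Nat.card_fin] at h1
      omega
    obtain ⟨o, rfl, φ, hφ⟩ := ih _ g hg hcard
    let ψ : Fin (o.k + d) ≃ ι :=
      finSumFinEquiv.symm.trans ((Equiv.sumCongr φ (Equiv.ofInjective c hinj)).trans
        ((Equiv.sumComm _ _).trans (Equiv.Set.sumCompl (Set.range c))))
    have hl : ∀ i, ψ (Fin.castAdd d i) = φ i := fun i => by simp [ψ]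
    have hr : ∀ i, ψ (Fin.natAdd o.k i) = c i := fun i => by simp [ψ]
    have key : ∀ u v (i : Fin (o.k + d)),
        (Fin.append (o.label (toContracted (foundEdges G q) u)) (bits G q u) : _ → Bool) i ≠
          (Fin.append (o.label (toContracted (foundEdges G q) v)) (bits G q v) : _ → Bool) i ↔
        f u (ψ i) ≠ f v (ψ i) := by
      intro u v i
      induction i using Fin.addCases with
      | left i => rw [hl, Fin.append_left, Fin.append_left, hφ, hgf, hgf]
      | right i => rw [hr, Fin.append_right, Fin.append_right, hf.bits_ne_iff hc]
    exact ⟨_, rfl, ψ, key⟩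

/-! ### Winkler's relation -/

/-- Two edges are related exactly if they flip the same coordinate: a coordinate flipped by only one
of them contributes equally to both sums of distances. -/
theorem winkler_iff [Finite ι] {p q r s : V} {i j : ι} (hi : ∀ k, f p k ≠ f q k ↔ k = i)
    (hj : ∀ k, f r k ≠ f s k ↔ k = j) :
    G.dist p r + G.dist q s ≠ G.dist p s + G.dist q r ↔ i = j := by
  have := Fintype.ofFinite ι
  have hi' : ∀ k, f q k ≠ f p k ↔ k = i := fun k => ne_comm.trans (hi k)
  simp only [hf.dist_eq]
  rw [hammingDist_comm (f p) (f r), hammingDist_comm (f p) (f s), hammingDist_comm (f q) (f s),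
    hammingDist_comm (f q) (f r)]
  have flip : ∀ x : V, (f x i = f q i ∧ hammingDist (f x) (f q) + 1 = hammingDist (f x) (f p)) ∨
      (f x i ≠ f q i ∧ hammingDist (f x) (f p) + 1 = hammingDist (f x) (f q)) := by
    intro x
    by_cases h : f x i = f q i
    · exact .inl ⟨h, hammingDist_flip hi (h ▸ (hi' i).2 rfl)⟩
    · exact .inr ⟨h, hammingDist_flip hi' h⟩
  have hrs := hj i
  rcases flip r with ⟨h1, h2⟩ | ⟨h1, h2⟩ <;> rcases flip s with ⟨h3, h4⟩ | ⟨h3, h4⟩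
  · rw [h1, h3] at hrs
    have : i ≠ j := by simpa using hrs
    simp only [this, iff_false, not_not]; omega
  · have : i = j := hrs.1 (by rw [h1]; exact h3.symm)
    simp only [this, iff_true]; omega
  · have : i = j := hrs.1 (by rw [h3]; exact h1)
    simp only [this, iff_true]; omega
  · have : ¬ i = j := by
      rw [← hrs]
      revert h1 h3
      cases f r i <;> cases f s i <;> cases f q i <;> decide
    simp only [this, iff_false, not_not]; omega

end IsCubical

theorem IsCubical.isCorrectLabeling {k : ℕ} {f : V → Fin k → Bool} (hf : IsCubical G f) :
    IsCorrectLabeling G f := by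
  intro u v
  rw [← (hf.reachable_dist u v).1.coe_dist_eq_edist, hf.dist_eq]

theorem isWinklerPartition {o : Output V} (hf : IsCubical G o.label)
    (hpart : IsEdgePartition G o.cls) (hcut : IsCutLabeling G o.cls o.label) :
    IsWinklerPartition G o.cls := by
  have hsub : ∀ i, o.cls i ⊆ G.edgeSet := fun i => hpart.2.2 ▸ Set.subset_iUnion o.cls i
  have hcls : ∀ e ∈ G.edgeSet, ∃ i, e ∈ o.cls i := fun e he => by
    rw [← hpart.2.2] at he; exact Set.mem_iUnion.1 he
  have huniq : ∀ {e i j}, e ∈ o.cls i → e ∈ o.cls j → i = j := fun {e i j} hi hj => by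
    by_contra hij
    exact Set.disjoint_left.1 (hpart.2.1 i j hij) hi hj
  have flip : ∀ {u v i}, s(u, v) ∈ o.cls i → ∀ k, o.label u k ≠ o.label v k ↔ k = i := by
    intro u v i h k
    obtain ⟨j, hj⟩ := hf.adj (hsub i h)
    obtain rfl : i = j := (hj i).1 ((hcut i u v).1 h).2
    exact hj k
  have key : ∀ {e f i j}, e ∈ o.cls i → f ∈ o.cls j → (Winkler G e f ↔ i = j) := by
    intro e f i j he hf'
    constructor
    · rintro ⟨p, q, r, s, rfl, rfl, h⟩
      exact (hf.winkler_iff (flip he) (flip hf')).1 h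
    · induction e with
      | _ p q =>
        induction f with
        | _ r s => exact fun h => ⟨p, q, r, s, rfl, rfl, (hf.winkler_iff (flip he) (flip hf')).2 h⟩
  have hclass : ∀ {e i}, e ∈ o.cls i → winklerClass G e = o.cls i := by
    intro e i he
    ext f
    constructor
    · rintro ⟨h1, h2⟩
      obtain ⟨j, hj⟩ := hcls f h1
      rwa [(key he hj).1 h2]
    · exact fun h => ⟨hsub i h, (key he h).2 rfl⟩
  refine ⟨⟨fun e => ?_, fun {e f} h => ?_, fun {e f g} h h' => ?_⟩, fun i j hij => ?_, ?_⟩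
  · obtain ⟨i, hi⟩ := hcls e e.2
    exact (key hi hi).2 rfl
  · obtain ⟨i, hi⟩ := hcls e e.2
    obtain ⟨j, hj⟩ := hcls f f.2
    exact (key hj hi).2 ((key hi hj).1 h).symm
  · obtain ⟨i, hi⟩ := hcls e e.2
    obtain ⟨j, hj⟩ := hcls f f.2
    obtain ⟨k, hk⟩ := hcls g g.2
    exact (key hi hk).2 (((key hi hj).1 h).trans ((key hj hk).1 h'))
  · obtain ⟨e, he⟩ := hpart.1 i
    exact huniq he (hij ▸ he)
  · ext C
    constructor
    · rintro ⟨i, rfl⟩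
      obtain ⟨e, he⟩ := hpart.1 i
      exact ⟨e, hsub i he, (hclass he).symm⟩
    · rintro ⟨e, he, rfl⟩
      obtain ⟨i, hi⟩ := hcls e he
      exact ⟨i, (hclass hi).symm⟩

theorem IsCorrectLabeling.isCubical {k : ℕ} {label : V → Fin k → Bool}
    (h : IsCorrectLabeling G label) :
    IsCubical G fun v (i : {i // ∃ u v, label u i ≠ label v i}) => label v i := by
  have hreach : ∀ u v, G.Reachable u v := fun u v => by
    rw [← SimpleGraph.edist_ne_top_iff_reachable, h]
    exact ENat.natCast_ne_top _
  have hdist : ∀ u v, G.dist u v = hammingDist (label u) (label v) := fun u v => by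
    have := (hreach u v).coe_dist_eq_edist
    rw [h] at this
    exact_mod_cast this
  have hadj : ∀ {u v}, G.Adj u v → ∃ j, ∀ i, label u i ≠ label v i ↔ i = j := by
    intro u v huv
    have h1 := SimpleGraph.dist_eq_one_iff_adj.2 huv
    rw [hdist, hammingDist, Finset.card_eq_one] at h1
    obtain ⟨j, hj⟩ := h1
    exact ⟨j, fun i => by simpa using Finset.ext_iff.1 hj i⟩
  refine ⟨fun {u v} huv => ?_, fun {u v} huv => ?_, fun i => i.2⟩
  · obtain ⟨j, hj⟩ := hadj huv
    exact ⟨⟨j, u, v, (hj j).2 rfl⟩, fun i => by rw [hj, Subtype.ext_iff]⟩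
  · obtain ⟨w, hw⟩ := (hreach u v).exists_walk_length_eq_dist
    cases w with
    | nil => exact (huv rfl).elim
    | @cons _ w _ huw t =>
      obtain ⟨j, hj⟩ := hadj huw
      refine ⟨w, ⟨j, u, w, (hj j).2 rfl⟩, huw, fun hcon => ?_,
        fun i => by rw [hj, Subtype.ext_iff]⟩
      have h1 := hammingDist_flip (a := label v) (x := label w) (y := label u)
        (fun i => ne_comm.trans (hj i)) (by simpa [← hcon] using (hj j).2 rfl)
      have h2 := SimpleGraph.dist_le t
      rw [SimpleGraph.Walk.length_cons, hdist, hammingDist_comm] at hw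
      rw [hdist, hammingDist_comm] at h2
      omega

theorem partialCube_run [Finite V] [Nonempty V] {r : Option (Output V)} (hG : IsPartialCube G)
    (hr : Run G (Nat.card V - 1) r) :
    ∃ o, r = some o ∧ IsWinklerPartition G o.cls ∧ IsCorrectLabeling G o.label := by
  obtain ⟨k, label, hl⟩ := hG
  have hf := hl.isCubical
  classical
  obtain ⟨o, rfl, φ, hφ⟩ := IsCubical.run hr _ _ hf (by
    rw [Nat.card_eq_fintype_card]; exact hf.card_le)
  have ho := hf.congr_equiv φ hφ
  obtain ⟨h1, h2⟩ := hr.isEdgePartition_isCutLabeling o rfl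
  exact ⟨o, rfl, isWinklerPartition ho h1 h2, ho.isCorrectLabeling⟩

end PartialCube

namespace WordRAM

/-! ### Reasoning about programs of the word RAM -/

/-- Whether a program contains an assignment to the register `y`. -/
def Prog.modR : Prog → ℕ → Bool
  | .skip, _ => false
  | .assign x _, y => y == x
  | .store _ _ _, _ => false
  | .seq P Q, y => P.modR y || Q.modR y
  | .ite _ P Q, y => P.modR y || Q.modR y
  | .loop _ P, y => P.modR y

/-- Whether a program contains an assignment to a cell of the array `b`. -/
def Prog.modA : Prog → ℕ → Bool
  | .skip, _ => false
  | .assign _ _, _ => false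
  | .store a _ _, b => b == a
  | .seq P Q, b => P.modA b || Q.modA b
  | .ite _ P Q, b => P.modA b || Q.modA b
  | .loop _ P, b => P.modA b

/-- `σ` and `τ` agree on all registers and arrays that `P` does not assign to. -/
structure SameOn (P : Prog) (σ τ : Mem) : Prop where
  reg : ∀ {x}, P.modR x = false → τ.reg x = σ.reg x
  arr : ∀ {a}, P.modA a = false → τ.arr a = σ.arr a

theorem Exec.sameOn {w : ℕ} {P : Prog} {σ τ : Mem} {k : ℕ} (h : Exec w P σ k τ) :
    SameOn P σ τ := by
  induction h with
  | skip => exact ⟨fun _ => rfl, fun _ => rfl⟩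
  | assign σ x t =>
    exact ⟨fun h => Function.update_of_ne (by simpa [Prog.modR] using h) _ _, fun _ => rfl⟩
  | store σ a i t =>
    exact ⟨fun _ => rfl, fun h => Function.update_of_ne (by simpa [Prog.modA] using h) _ _⟩
  | seq _ _ ih1 ih2 =>
    refine ⟨fun h => ?_, fun h => ?_⟩
    · simp only [Prog.modR, Bool.or_eq_false_iff] at h
      exact (ih2.reg h.2).trans (ih1.reg h.1)
    · simp only [Prog.modA, Bool.or_eq_false_iff] at h
      exact (ih2.arr h.2).trans (ih1.arr h.1)
  | ite_true _ _ ih =>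
    refine ⟨fun h => ?_, fun h => ?_⟩
    · simp only [Prog.modR, Bool.or_eq_false_iff] at h
      exact ih.reg h.1
    · simp only [Prog.modA, Bool.or_eq_false_iff] at h
      exact ih.arr h.1
  | ite_false _ _ ih =>
    refine ⟨fun h => ?_, fun h => ?_⟩
    · simp only [Prog.modR, Bool.or_eq_false_iff] at h
      exact ih.reg h.2
    · simp only [Prog.modA, Bool.or_eq_false_iff] at h
      exact ih.arr h.2
  | loop_done => exact ⟨fun _ => rfl, fun _ => rfl⟩
  | loop_step _ _ _ ih1 ih2 =>
    exact ⟨fun h => (ih2.reg h).trans (ih1.reg h), fun h => (ih2.arr h).trans (ih1.arr h)⟩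

theorem SameOn.trans {P : Prog} {σ τ ρ : Mem} (h1 : SameOn P σ τ) (h2 : SameOn P τ ρ) :
    SameOn P σ ρ :=
  ⟨fun h => (h2.reg h).trans (h1.reg h), fun h => (h2.arr h).trans (h1.arr h)⟩

/-- The memory `σ` with the value `v` in register `x`. -/
def Mem.setReg (σ : Mem) (x v : ℕ) : Mem := { σ with reg := Function.update σ.reg x v }

/-- The memory `σ` with the value `v` in cell `i` of the array `a`. -/
def Mem.setArr (σ : Mem) (a i v : ℕ) : Mem :=
  { σ with arr := Function.update σ.arr a (Function.update (σ.arr a) i v) }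

@[simp] theorem setReg_reg (σ : Mem) (x v y : ℕ) :
    (σ.setReg x v).reg y = if y = x then v else σ.reg y := by
  simp [Mem.setReg, Function.update_apply]

@[simp] theorem setReg_arr (σ : Mem) (x v : ℕ) : (σ.setReg x v).arr = σ.arr := rfl

@[simp] theorem setArr_reg (σ : Mem) (a i v : ℕ) : (σ.setArr a i v).reg = σ.reg := rfl

@[simp] theorem setArr_arr (σ : Mem) (a i v b : ℕ) :
    (σ.setArr a i v).arr b = if b = a then Function.update (σ.arr a) i v else σ.arr b := by
  simp [Mem.setArr, Function.update_apply]

/-- `P`, started in `σ`, halts after at most `T` steps in a state that satisfies `Q`. -/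
def Runs (w : ℕ) (P : Prog) (σ : Mem) (T : ℕ) (Q : Mem → Prop) : Prop :=
  ∃ t τ, Exec w P σ t τ ∧ t ≤ T ∧ Q τ

variable {w : ℕ} {P P' : Prog} {σ : Mem} {T T' : ℕ} {Q R : Mem → Prop}

theorem Runs.mono (h : Runs w P σ T Q) (hT : T ≤ T')
    (hQ : ∀ τ, SameOn P σ τ → Q τ → R τ) : Runs w P σ T' R := by
  obtain ⟨t, τ, h1, h2, h3⟩ := h
  exact ⟨t, τ, h1, h2.trans hT, hQ τ h1.sameOn h3⟩

theorem Runs.seq (h : Runs w P σ T Q)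
    (h' : ∀ τ, SameOn P σ τ → Q τ → Runs w P' τ T' R) : Runs w (.seq P P') σ (T + T' + 1) R := by
  obtain ⟨t, τ, h1, h2, h3⟩ := h
  obtain ⟨t', τ', h1', h2', h3'⟩ := h' τ h1.sameOn h3
  exact ⟨_, τ', .seq h1 h1', by omega, h3'⟩

theorem Runs.ite {c : Term} (h : c.val w σ ≠ 0 → Runs w P σ T Q)
    (h' : c.val w σ = 0 → Runs w P' σ T Q) : Runs w (.ite c P P') σ (c.cost + T + 1) Q := by
  by_cases hc : c.val w σ = 0
  · obtain ⟨t, τ, h1, h2, h3⟩ := h' hc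
    exact ⟨_, τ, .ite_false hc h1, by omega, h3⟩
  · obtain ⟨t, τ, h1, h2, h3⟩ := h hc
    exact ⟨_, τ, .ite_true hc h1, by omega, h3⟩

/-- Whether a program has no loops. -/
def Prog.isStraight : Prog → Bool
  | .seq P Q => P.isStraight && Q.isStraight
  | .ite _ P Q => P.isStraight && Q.isStraight
  | .loop _ _ => false
  | _ => true

/-- A bound for the number of steps of a program without loops. -/
def Prog.steps : Prog → ℕ
  | .skip => 1
  | .assign _ t => t.cost + 1
  | .store _ i t => i.cost + t.cost + 1
  | .seq P Q => P.steps + Q.steps + 1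
  | .ite t P Q => t.cost + max P.steps Q.steps + 1
  | .loop _ _ => 0

/-- The effect of a program without loops. -/
def Prog.eval (w : ℕ) : Prog → Mem → Mem
  | .skip, σ => σ
  | .assign x t, σ => σ.setReg x (t.val w σ)
  | .store a i t, σ => σ.setArr a (i.val w σ) (t.val w σ)
  | .seq P Q, σ => Q.eval w (P.eval w σ)
  | .ite t P Q, σ => if t.val w σ = 0 then Q.eval w σ else P.eval w σ
  | .loop _ _, σ => σ

theorem exec_eval (h : P.isStraight = true) :
    ∃ t, Exec w P σ t (P.eval w σ) ∧ t ≤ P.steps := by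
  induction P generalizing σ with
  | skip => exact ⟨_, .skip σ, le_rfl⟩
  | assign x t => exact ⟨_, .assign σ x t, le_rfl⟩
  | store a i t => exact ⟨_, .store σ a i t, le_rfl⟩
  | seq P Q ih1 ih2 =>
    simp only [Prog.isStraight, Bool.and_eq_true] at h
    obtain ⟨t1, h1, h1'⟩ := ih1 h.1 (σ := σ)
    obtain ⟨t2, h2, h2'⟩ := ih2 h.2 (σ := P.eval w σ)
    exact ⟨_, .seq h1 h2, by simp only [Prog.steps]; omega⟩
  | ite t P Q ih1 ih2 =>
    simp only [Prog.isStraight, Bool.and_eq_true] at h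
    obtain ⟨t1, h1, h1'⟩ := ih1 h.1 (σ := σ)
    obtain ⟨t2, h2, h2'⟩ := ih2 h.2 (σ := σ)
    by_cases ht : t.val w σ = 0
    · exact ⟨_, by rw [Prog.eval, if_pos ht]; exact .ite_false ht h2,
        by simp only [Prog.steps]; omega⟩
    · exact ⟨_, by rw [Prog.eval, if_neg ht]; exact .ite_true ht h1,
        by simp only [Prog.steps]; omega⟩
  | loop => simp [Prog.isStraight] at h

theorem Runs.straight (h : P.isStraight = true) (hT : P.steps ≤ T) (hQ : Q (P.eval w σ)) :
    Runs w P σ T Q := by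
  obtain ⟨t, h1, h2⟩ := exec_eval (w := w) (σ := σ) h
  exact ⟨t, _, h1, h2.trans hT, hQ⟩

/-! ### Notation for programs -/

instance : Add Term := ⟨.op .add⟩
instance : Sub Term := ⟨.op .sub⟩
instance : Mul Term := ⟨.op .mul⟩
instance (c : ℕ) : OfNat Term c := ⟨.const c⟩

theorem val_add (s t : Term) : (s + t).val w σ = (s.val w σ + t.val w σ) % 2 ^ w := rfl
theorem val_sub (s t : Term) : (s - t).val w σ = (s.val w σ + 2 ^ w - t.val w σ) % 2 ^ w := rfl
theorem val_zero : (0 : Term).val w σ = 0 := Nat.zero_mod _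
theorem val_one : (1 : Term).val w σ = 1 % 2 ^ w := rfl

/-- The subtraction modulo the word range is exact if the result is not negative. -/
theorem sub_mod_eq {a b W : ℕ} (hb : b ≤ a) (ha : a < W) : (a + W - b) % W = a - b := by
  rw [show a + W - b = a - b + W by omega, Nat.add_mod_right, Nat.mod_eq_of_lt (by omega)]

infix:62 " ≔ " => Prog.assign
infixr:61 " ;; " => Prog.seq

/-- `for x := 0 to b - 1 do P`, where the bound `b` is evaluated before every iteration. -/
def forLoop (x : ℕ) (b : Term) (P : Prog) : Prog :=
  x ≔ 0 ;; .loop (.op .lt (.reg x) b) (P ;; x ≔ .reg x + 1)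

/-- The rule for loops, with an invariant `I` and a potential `φ` that pays for iterations that
take more than `B` steps. -/
theorem exec_for {x : ℕ} {b : Term} {N B : ℕ} (I : ℕ → Mem → Prop) (φ : Mem → ℕ)
    (hN : N < 2 ^ w) (hx : P.modR x = false) (hb : b.cost ≤ 2)
    (hval : ∀ τ, SameOn (forLoop x b P) σ τ → b.val w τ = N)
    (h0 : I 0 (σ.setReg x 0))
    (hs : ∀ i τ, i < N → SameOn (forLoop x b P) σ τ → τ.reg x = i → I i τ →
      ∃ t τ', Exec w P τ t τ' ∧ t + φ (τ'.setReg x (i + 1)) ≤ B + φ τ ∧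
        I (i + 1) (τ'.setReg x (i + 1))) :
    ∃ t τ, Exec w (forLoop x b P) σ t τ ∧ t + φ τ ≤ N * (B + 10) + 8 + φ (σ.setReg x 0) ∧
      I N τ := by
  have hW : 0 < 2 ^ w := by positivity
  have key : ∀ k i τ, i + k = N → SameOn (forLoop x b P) σ τ → τ.reg x = i → I i τ →
      ∃ t τ', Exec w (.loop (.op .lt (.reg x) b) (P ;; x ≔ .reg x + 1)) τ t τ' ∧
        t + φ τ' ≤ k * (B + 10) + 5 + φ τ ∧ I N τ' := by
    intro k
    induction k with
    | zero =>
      intro i τ hi hS hr hI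
      obtain rfl : i = N := hi
      refine ⟨_, τ, .loop_done ?_, ?_, hI⟩
      · simp [Term.val, Op.apply, hr, hval τ hS]
      · simp only [Term.cost]; omega
    | succ k ih =>
      intro i τ hi hS hr hI
      obtain ⟨t, τ1, h1, h2, h3⟩ := hs i τ (by omega) hS hr hI
      have hr1 : τ1.reg x = i := (h1.sameOn.reg hx).trans hr
      have hv : (Term.reg x + 1).val w τ1 = i + 1 := by
        rw [val_add, Term.val, hr1, val_one, Nat.add_mod_mod, Nat.mod_eq_of_lt (by omega)]
      have he : Exec w (P ;; x ≔ .reg x + 1) τ (t + 4 + 1) (τ1.setReg x (i + 1)) := by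
        refine .seq h1 ?_
        have := Exec.assign (w := w) τ1 x (.reg x + 1)
        rw [hv] at this
        exact this
      have hS1 : SameOn (forLoop x b P) σ (τ1.setReg x (i + 1)) := by
        refine hS.trans ⟨fun h => ?_, fun h => ?_⟩
        · refine he.sameOn.reg ?_
          simp only [forLoop, Prog.modR, Bool.or_eq_false_iff] at h ⊢
          exact h.2
        · refine he.sameOn.arr ?_
          simp only [forLoop, Prog.modA, Bool.or_eq_false_iff] at h ⊢
          exact h.2
      obtain ⟨t', τ', h1', h2', h3'⟩ := ih (i + 1) _ (by omega) hS1 (by simp) h3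
      refine ⟨_, τ', .loop_step ?_ he h1', ?_, h3'⟩
      · simp only [Term.val, Op.apply, hr, hval τ hS]
        rw [if_pos (by omega)]
        exact one_ne_zero
      · simp only [Term.cost]
        rw [Nat.succ_mul]
        omega
  have h1 : Exec w (x ≔ 0) σ 2 (σ.setReg x 0) := by
    have := Exec.assign (w := w) σ x 0
    rw [val_zero] at this
    exact this
  have hS : SameOn (forLoop x b P) σ (σ.setReg x 0) := by
    refine ⟨fun h => h1.sameOn.reg ?_, fun h => h1.sameOn.arr ?_⟩
    · simp only [forLoop, Prog.modR, Bool.or_eq_false_iff] at h ⊢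
      exact h.1
    · rfl
  obtain ⟨t, τ, h2, h3, h4⟩ := key N 0 _ (by omega) hS (by simp) h0
  exact ⟨_, τ, .seq h1 h2, by omega, h4⟩

theorem Runs.for {x : ℕ} {b : Term} {N B : ℕ} (I : ℕ → Mem → Prop)
    (hN : N < 2 ^ w) (hx : P.modR x = false) (hb : b.cost ≤ 2)
    (hval : ∀ τ, SameOn (forLoop x b P) σ τ → b.val w τ = N)
    (h0 : I 0 (σ.setReg x 0))
    (hs : ∀ i τ, i < N → SameOn (forLoop x b P) σ τ → τ.reg x = i → I i τ →
      Runs w P τ B (fun τ' => I (i + 1) (τ'.setReg x (i + 1)))) :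
    Runs w (forLoop x b P) σ (N * (B + 10) + 8) (I N) := by
  obtain ⟨t, τ, h1, h2, h3⟩ := exec_for I (fun _ => 0) hN hx hb hval h0
    (fun i τ hi hS hr hI => by
      obtain ⟨t, τ', h1, h2, h3⟩ := hs i τ hi hS hr hI
      exact ⟨t, τ', h1, by omega, h3⟩)
  exact ⟨t, τ, h1, by omega, h3⟩

end WordRAM

namespace PartialCube

open WordRAM

/-! ### The program -/

-- Registers and arrays are named by notations rather than definitions, so that their numbers are
-- literals. The registers `rN` and `rM` hold the numbers of vertices and edges of the input, `rL`
-- and `rV` the limit and the number of vertices of the current call, and `rOk` is `0` after a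
-- rejection. A vertex of the current graph is represented by one of the vertices of the input that
-- have been contracted to it; the array `aRep` maps each vertex of the input to its representative.
-- The neighbors of the current graph are listed in the rows of the square array `aAdj`, whose
-- lengths are in `aDeg`, and a pair is adjacent if its cell in `aMat` contains the current value of
-- `rV`. As `rV` decreases from call to call, old entries of `aMat` need not be cleared. The arrays
-- `aDst` and `aQue` serve the breadth-first search; `aDst` holds the distance plus one, and `0` for
-- vertices that have not been found. The search lists its edges in `aUp` and `aDn`. The array
-- `aVec` holds one block of the bitvectors, `aCnt` the numbers of their bits that are set, and
-- `aLab` the labels. The classes and labels that are returned are written to `aCls` and `aOut`.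
notation "rN" => (0 : ℕ)
notation "rM" => (1 : ℕ)
notation "rL" => (2 : ℕ)
notation "rV" => (3 : ℕ)
notation "rOk" => (4 : ℕ)
notation "rP" => (5 : ℕ)
notation "rD" => (6 : ℕ)
notation "rS" => (7 : ℕ)
notation "rB" => (8 : ℕ)
notation "rT" => (9 : ℕ)
notation "rU" => (10 : ℕ)
notation "rI" => (11 : ℕ)
notation "rJ" => (12 : ℕ)
notation "rK" => (13 : ℕ)
notation "rX" => (14 : ℕ)
notation "rY" => (15 : ℕ)
notation "rC" => (16 : ℕ)
notation "rW" => (17 : ℕ)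
notation "aCls" => (2 : ℕ)
notation "aOut" => (3 : ℕ)
notation "aRep" => (4 : ℕ)
notation "aDeg" => (5 : ℕ)
notation "aAdj" => (6 : ℕ)
notation "aMat" => (7 : ℕ)
notation "aDst" => (8 : ℕ)
notation "aQue" => (9 : ℕ)
notation "aUp" => (10 : ℕ)
notation "aDn" => (11 : ℕ)
notation "aVec" => (12 : ℕ)
notation "aCnt" => (13 : ℕ)
notation "aLab" => (14 : ℕ)
notation "aSum" => (15 : ℕ)
notation "rg" => Term.reg
notation "ag" => Term.get

/-- The address of row `s`, column `t` in a square array. -/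
def cell (s t : Term) : Term := s * rg rN + t

/-- Sets the first `n` cells of the array `a` to `0`. -/
def clear (a : ℕ) : Prog := forLoop rI (rg rN) (.store a (rg rI) 0)

/-- Adds the edge between the vertices in the registers `rX` and `rY` to the graph, unless the
matrix shows that it is there already. -/
def insert : Prog :=
  .ite (.op .eq (ag aMat (cell (rg rX) (rg rY))) (rg rV)) .skip
    (.store aMat (cell (rg rX) (rg rY)) (rg rV) ;;
     .store aMat (cell (rg rY) (rg rX)) (rg rV) ;;
     .store aAdj (cell (rg rX) (ag aDeg (rg rX))) (rg rY) ;;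
     .store aAdj (cell (rg rY) (ag aDeg (rg rY))) (rg rX) ;;
     .store aDeg (rg rX) (ag aDeg (rg rX) + 1) ;;
     .store aDeg (rg rY) (ag aDeg (rg rY) + 1))

/-- Sets up the data for the input graph. -/
def setup : Prog :=
  rL ≔ rg rN - 1 ;; rV ≔ rg rN ;; rOk ≔ 1 ;;
  forLoop rI (rg rN) (.store aRep (rg rI) (rg rI)) ;;
  forLoop rI (rg rM) (rX ≔ ag 0 (rg rI) ;; rY ≔ ag 1 (rg rI) ;; insert)

/-- Finds a vertex `rP` of maximum degree `rD` and the sum `rS` of all degrees. -/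
def scan : Prog :=
  (rP ≔ ag aRep 0 ;; rD ≔ ag aDeg (rg rP) ;; rS ≔ 0) ;;
  forLoop rI (rg rN)
    (rS ≔ rg rS + ag aDeg (rg rI) ;;
     .ite (.op .lt (rg rD) (ag aDeg (rg rI))) (rP ≔ rg rI ;; rD ≔ ag aDeg (rg rI)) .skip)

/-- Computes the logarithm `rB` of the number of vertices, rounded up. -/
def logarithm : Prog :=
  (rB ≔ 0 ;; rW ≔ 1) ;;
  forLoop rI (rg rN)
    (.ite (.op .lt (rg rW) (rg rV)) (rW ≔ rg rW + rg rW ;; rB ≔ rg rB + 1) .skip)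

/-- Puts the neighbor `rY` of `rX` into the queue if it is new. -/
def visit : Prog :=
  .ite (.op .eq (ag aDst (rg rY)) 0)
    (.store aDst (rg rY) (ag aDst (rg rX) + 1) ;; .store aQue (rg rT) (rg rY) ;; rT ≔ rg rT + 1)
    .skip

/-- Lists the edge from `rX` to `rY` if `rY` is farther from the start of the search, and clears
the flag `rOk` if the distances of both ends are equal. -/
def record : Prog :=
  .ite (.op .eq (ag aDst (rg rY)) (ag aDst (rg rX))) (rOk ≔ 0)
    (.ite (.op .eq (ag aDst (rg rY)) (ag aDst (rg rX) + 1))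
      (.store aUp (rg rU) (rg rX) ;; .store aDn (rg rU) (rg rY) ;; rU ≔ rg rU + 1) .skip)

/-- The breadth-first search from `rP`. It lists the edges that lead away from `rP`, in the order
of their distance, and clears the flag `rOk` if an edge joins vertices at the same distance. -/
def bfs : Prog :=
  clear aDst ;;
  (.store aDst (rg rP) 1 ;; .store aQue 0 (rg rP) ;; rT ≔ 1 ;; rU ≔ 0) ;;
  forLoop rI (rg rN)
    (.ite (.op .lt (rg rI) (rg rT))
      (rX ≔ ag aQue (rg rI) ;; forLoop rK (ag aDeg (rg rX))
        (rY ≔ ag aAdj (cell (rg rX) (rg rK)) ;; visit ;; record)) .skip)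

/-- Computes `rB` bits of all bitvectors, those that belong to the neighbors of `rP` with the
numbers `rI`, `rI + 1`, …, in one word per vertex. -/
def block : Prog :=
  rX ≔ rg rI ;; forLoop rK (rg rN) (.store aVec (rg rK) 0) ;; rW ≔ 1 ;;
  forLoop rK (rg rB)
    (.ite (.op .lt (rg rX + rg rK) (rg rD))
      (.store aVec (ag aAdj (cell (rg rP) (rg rX + rg rK))) (rg rW)) .skip ;;
     rW ≔ rg rW + rg rW) ;;
  forLoop rK (rg rU)
    (.store aVec (ag aDn (rg rK)) (.op .lor (ag aVec (ag aDn (rg rK))) (ag aVec (ag aUp (rg rK)))))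

/-- Copies the current bit of one bitvector to the label and counts it if it is set. -/
def extractBit : Prog :=
  .ite (.op .land (ag aVec (ag aRep (rg rK))) (rg rC))
    (.store aLab (cell (rg rK) (rg rL + rg rI)) 1 ;; .store aCnt (rg rK) (ag aCnt (rg rK) + 1))
    (.store aLab (cell (rg rK) (rg rL + rg rI)) 0)

/-- Copies the current bit of all bitvectors to the labels. -/
def extract : Prog := forLoop rK (rg rN) extractBit

/-- Computes the bitvectors and the number of their bits that are set. The bits of a call go to
the columns of `aLab` from the new value of `rL` on, so that later calls fill the columns before
them. -/
def bitvectors : Prog :=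
  rL ≔ rg rL - rg rD ;; clear aCnt ;; rJ ≔ 0 ;;
  forLoop rI (rg rD)
    (.ite (.op .eq (rg rJ) 0) (block ;; rC ≔ 1) .skip ;;
     extract ;;
     rC ≔ rg rC + rg rC ;; rJ ≔ rg rJ + 1 ;;
     .ite (.op .eq (rg rJ) (rg rB)) (rJ ≔ 0) .skip)

/-- Clears the flag `rOk` if the bitvectors of adjacent vertices differ in two bits. -/
def clash : Prog :=
  forLoop rI (rg rU)
    (.ite (.op .lt (ag aCnt (ag aUp (rg rI)) + 1) (ag aCnt (ag aDn (rg rI)))) (rOk ≔ 0) .skip)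

/-- Contracts the edges whose bitvectors differ. -/
def merge : Prog :=
  forLoop rI (rg rU)
    (.ite (.op .lt (ag aCnt (ag aUp (rg rI))) (ag aCnt (ag aDn (rg rI))))
      (rX ≔ ag aRep (ag aUp (rg rI)) ;; rY ≔ ag aRep (ag aDn (rg rI)) ;;
       .ite (.op .eq (rg rX) (rg rY)) .skip
        (rV ≔ rg rV - 1 ;;
         forLoop rK (rg rN)
          (.ite (.op .eq (ag aRep (rg rK)) (rg rY)) (.store aRep (rg rK) (rg rX)) .skip)))
      .skip)

/-- Lists the edges of the contracted graph, and clears the flag `rOk` if there is a self-loop. -/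
def rebuild : Prog :=
  clear aDeg ;;
  forLoop rI (rg rU)
    (.ite (.op .lt (ag aCnt (ag aUp (rg rI))) (ag aCnt (ag aDn (rg rI)))) .skip
      (rX ≔ ag aRep (ag aUp (rg rI)) ;; rY ≔ ag aRep (ag aDn (rg rI)) ;;
       .ite (.op .eq (rg rX) (rg rY)) (rOk ≔ 0) insert))

/-- One recursive call of the algorithm. -/
def phase : Prog :=
  scan ;; logarithm ;;
  .ite (.op .lt (rg rL) (rg rD)) (rOk ≔ 0)
    (.ite (.op .lt (2 * (rg rV * rg rB)) (rg rS)) (rOk ≔ 0)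
      (bfs ;;
       .ite (.op .lt (rg rT) (rg rV)) (rOk ≔ 0)
        (.ite (.op .eq (rg rOk) 0) .skip
          (bitvectors ;; clash ;;
           .ite (.op .eq (rg rOk) 0) .skip (merge ;; rebuild)))))

/-- Writes the label of the vertex `rI`, and computes the sum of the numbers of its bits that are
set. -/
def writeLabel : Prog :=
  .store aSum (rg rI) 0 ;;
  forLoop rK (rg rD)
    (rX ≔ ag aLab (cell (rg rI) (rg rL + rg rK)) ;;
     .store aOut (cell (rg rI) (rg rK)) (rg rX) ;;
     .store aSum (rg rI) (ag aSum (rg rI) + (rg rK + 1) * rg rX))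

/-- Writes the number of the class of the edge `rI`. Exactly one bit differs in the labels of its
two ends, so the number of this bit is the difference of the sums. -/
def writeClass : Prog :=
  rX ≔ ag aSum (ag 0 (rg rI)) ;; rY ≔ ag aSum (ag 1 (rg rI)) ;;
  .ite (.op .lt (rg rX) (rg rY)) (.store aCls (rg rI) (rg rY - rg rX - 1))
    (.store aCls (rg rI) (rg rX - rg rY - 1))

/-- Writes the result. -/
def output : Prog :=
  .ite (.op .eq (rg rOk) 0) (rN ≔ 0)
    (rD ≔ rg rN - 1 - rg rL ;; forLoop rI (rg rN) writeLabel ;; forLoop rI (rg rM) writeClass ;;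
     rM ≔ rg rD ;; rN ≔ 1)

/-- The implementation of the algorithm. -/
def program : Prog :=
  setup ;; .loop (.op .lt 1 (rg rV * rg rOk)) phase ;; output

/-! ### Rows of neighbors -/

/-- The words have enough bits for all numbers that occur in the computation. -/
def Fits (n w : ℕ) : Prop := 16 * (n * n) + 32 * n + 16 ≤ 2 ^ w

theorem Fits.lt {n w : ℕ} (h : Fits n w) {a : ℕ} (ha : a < 16 * (n * n) + 32 * n + 16) :
    a % 2 ^ w = a := Nat.mod_eq_of_lt (ha.trans_le h)

theorem cell_lt {n a b : ℕ} (ha : a < n) (hb : b < n) : a * n + b < n * n := by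
  have : (a + 1) * n ≤ n * n := Nat.mul_le_mul_right n ha
  rw [Nat.succ_mul] at this
  omega

theorem cell_inj {n a b a' b' : ℕ} (hb : b < n) (hb' : b' < n) :
    a * n + b = a' * n + b' ↔ a = a' ∧ b = b' := by
  refine ⟨fun h => ?_, fun ⟨h1, h2⟩ => by rw [h1, h2]⟩
  have h1 : (a * n + b) / n = a := by
    rw [mul_comm, Nat.mul_add_div (by omega), Nat.div_eq_of_lt hb, add_zero]
  have h2 : (a' * n + b') / n = a' := by
    rw [mul_comm, Nat.mul_add_div (by omega), Nat.div_eq_of_lt hb', add_zero]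
  have h3 : a = a' := by rw [← h1, ← h2, h]
  subst h3
  exact ⟨rfl, by omega⟩

theorem Fits.cell {n w a b : ℕ} (h : Fits n w) (ha : a < n) (hb : b < n) :
    (a * n + b) % 2 ^ w = a * n + b := by
  refine h.lt ((cell_lt ha hb).trans ?_)
  nlinarith

/-- The contents of row `x` of the square array `J`, whose length is in cell `x` of `D`. -/
def row (n : ℕ) (D J : ℕ → ℕ) (x : ℕ) : List ℕ := (List.range (D x)).map fun k => J (x * n + k)

@[simp] theorem length_row (n : ℕ) (D J : ℕ → ℕ) (x : ℕ) : (row n D J x).length = D x := by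
  simp [row]

theorem row_push {n x : ℕ} {D J : ℕ → ℕ} (hD : ∀ x < n, D x ≤ n) (hx : D x < n) (y : ℕ)
    {x' : ℕ} (hx' : x' < n) :
    row n (Function.update D x (D x + 1)) (Function.update J (x * n + D x) y) x' =
      if x' = x then row n D J x ++ [y] else row n D J x' := by
  split_ifs with h
  · subst h
    rw [row, Function.update_self, List.range_succ, List.map_append, row]
    refine congrArg₂ _ (List.map_congr_left fun k hk => ?_) (by simp)
    rw [List.mem_range] at hk
    rw [Function.update_of_ne]
    omega
  · rw [row, Function.update_of_ne h, row]
    refine List.map_congr_left fun k hk => ?_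
    rw [List.mem_range] at hk
    have := hD x' hx'
    rw [Function.update_of_ne]
    rw [Ne, cell_inj (by omega) hx]
    tauto

theorem length_le_of_nodup {n : ℕ} {l : List ℕ} (h : l.Nodup) (hl : ∀ a ∈ l, a < n) :
    l.length ≤ n := by
  rw [← List.toFinset_card_of_nodup h, ← Finset.card_range n]
  exact Finset.card_le_card fun a ha => by simpa using hl a (by simpa using ha)

/-- The memory holds the rows of neighbors of the graph with adjacency relation `E`, and the cells
of the matrix that contain `z` are those of adjacent pairs. The other nonzero cells are left over
from earlier graphs, which had more than `z` vertices. -/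
structure GraphMem (n z : ℕ) (E : ℕ → ℕ → Prop) (σ : Mem) : Prop where
  mat : ∀ {x}, x < n → ∀ {y}, y < n → (σ.arr aMat (x * n + y) = z ↔ E x y)
  fresh : ∀ i, σ.arr aMat i = 0 ∨ z ≤ σ.arr aMat i
  nodup : ∀ {x}, x < n → (row n (σ.arr aDeg) (σ.arr aAdj) x).Nodup
  mem : ∀ {x}, x < n → ∀ {y}, y ∈ row n (σ.arr aDeg) (σ.arr aAdj) x ↔ E x y
  lt : ∀ {x y}, E x y → x < n ∧ y < n ∧ x ≠ y
  symm : ∀ {x y}, E x y → E y x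

theorem GraphMem.congr {n z : ℕ} {E E' : ℕ → ℕ → Prop} {σ : Mem} (h : GraphMem n z E σ)
    (hE : ∀ x y, E x y ↔ E' x y) : GraphMem n z E' σ := by
  obtain rfl : E = E' := by ext x y; exact hE x y
  exact h

theorem GraphMem.deg_le {n z : ℕ} {E : ℕ → ℕ → Prop} {σ : Mem} (h : GraphMem n z E σ) {x : ℕ}
    (hx : x < n) : σ.arr aDeg x ≤ n := by
  rw [← length_row n (σ.arr aDeg) (σ.arr aAdj) x]
  exact length_le_of_nodup (h.nodup hx) fun a ha => (h.lt ((h.mem hx).1 ha)).2.1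

theorem GraphMem.deg_lt {n z : ℕ} {E : ℕ → ℕ → Prop} {σ : Mem} (h : GraphMem n z E σ) {x y : ℕ}
    (hx : x < n) (hy : y < n) (hxy : ¬ E x y) : σ.arr aDeg x < n := by
  have h1 : (row n (σ.arr aDeg) (σ.arr aAdj) x ++ [y]).Nodup := by
    rw [List.nodup_append]
    refine ⟨h.nodup hx, List.nodup_singleton y, fun a ha b hb hab => hxy ?_⟩
    rw [List.mem_singleton] at hb
    exact (h.mem hx).1 (hb ▸ hab ▸ ha)
  have h2 := length_le_of_nodup h1 (n := n) fun a ha => by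
    rcases List.mem_append.1 ha with ha | ha
    · exact (h.lt ((h.mem hx).1 ha)).2.1
    · rw [List.mem_singleton] at ha; omega
  simpa using h2

/-- An entry of the matrix is set for both orders of the two vertices, so the edge is not listed twice. -/
theorem insert_spec {n z w x y : ℕ} {E : ℕ → ℕ → Prop} {σ : Mem} (hW : Fits n w)
    (h : GraphMem n z E σ) (hn : σ.reg rN = n) (hz : σ.reg rV = z) (hX : σ.reg rX = x)
    (hY : σ.reg rY = y) (hx : x < n) (hy : y < n) (hxy : x ≠ y) :
    GraphMem n z (fun a b => E a b ∨ (a = x ∧ b = y) ∨ (a = y ∧ b = x)) (insert.eval w σ) := by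
  have m1 := hW.cell hx hy
  have m2 := hW.cell hy hx
  by_cases hE : E x y
  · have e : insert.eval w σ = σ := by
      simp [insert, Prog.eval, Term.val, cell, Op.apply, hn, hX, hY, hz, m1,
        (h.mat hx hy).2 hE]
    rw [e]
    refine h.congr fun a b => ⟨Or.inl, ?_⟩
    rintro (h' | ⟨rfl, rfl⟩ | ⟨rfl, rfl⟩)
    exacts [h', hE, h.symm hE]
  have hE' : ¬ E y x := fun h' => hE (h.symm h')
  have d1 := h.deg_lt hx hy hE
  have d2 := h.deg_lt hy hx hE'
  have m3 := hW.cell hx d1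
  have m4 := hW.cell hy d2
  have m5 : (σ.arr aDeg x + 1) % 2 ^ w = σ.arr aDeg x + 1 := hW.lt (by omega)
  have m6 : (σ.arr aDeg y + 1) % 2 ^ w = σ.arr aDeg y + 1 := hW.lt (by omega)
  have hne : ¬ σ.arr aMat (x * n + y) = z := fun h' => hE ((h.mat hx hy).1 h')
  have e : insert.eval w σ = ((((((σ.setArr aMat (x * n + y) z).setArr aMat (y * n + x) z).setArr
      aAdj (x * n + σ.arr aDeg x) y).setArr aAdj (y * n + σ.arr aDeg y) x).setArr
      aDeg x (σ.arr aDeg x + 1)).setArr aDeg y (σ.arr aDeg y + 1)) := by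
    simp [insert, Prog.eval, Term.val, cell, Op.apply, hn, hX, hY, hz,
      m1, m2, m3, m4, m5, m6, hne, hxy.symm]
  have hrow : ∀ {a}, a < n → row n ((insert.eval w σ).arr aDeg) ((insert.eval w σ).arr aAdj) a =
      if a = y then row n (σ.arr aDeg) (σ.arr aAdj) y ++ [x] else
      if a = x then row n (σ.arr aDeg) (σ.arr aAdj) x ++ [y] else
        row n (σ.arr aDeg) (σ.arr aAdj) a := by
    intro a ha
    have p1 := fun {a} (ha : a < n) =>
      row_push (J := σ.arr aAdj) (fun x hx => h.deg_le hx) d1 y ha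
    have p2 := row_push (n := n) (x := y) (D := Function.update (σ.arr aDeg) x (σ.arr aDeg x + 1))
      (J := Function.update (σ.arr aAdj) (x * n + σ.arr aDeg x) y) (fun a ha => by
        rw [Function.update_apply]
        split_ifs
        · omega
        · exact h.deg_le ha) (by rw [Function.update_of_ne hxy.symm]; exact d2) x ha
    rw [p1 ha, p1 hy, if_neg hxy.symm, Function.update_of_ne hxy.symm] at p2
    rw [← p2, e]
    simp
  refine ⟨fun {a} ha {b} hb => ?_, fun i => ?_, fun {a} ha => ?_, fun {a} ha {b} => ?_,
    fun {a b} hab => ?_, fun {a b} hab => ?_⟩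
  · rw [e]
    have := h.mat ha hb
    simp only [setArr_arr, Nat.reduceEqDiff, if_false, if_true,
      Function.update_apply, cell_inj hb hx, cell_inj hb hy]
    split_ifs with h1 h2
    · simp [h1]
    · simp [h2]
    · rw [this]; tauto
  · rw [e]
    have := h.fresh i
    simp only [setArr_arr, Nat.reduceEqDiff, if_false, if_true, Function.update_apply]
    split_ifs
    · exact .inr le_rfl
    · exact .inr le_rfl
    · exact this
  · rw [hrow ha]
    split_ifs with h1 h2
    · rw [List.nodup_append]
      refine ⟨h.nodup hy, List.nodup_singleton x, fun a ha b hb hab => hE' ?_⟩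
      rw [List.mem_singleton] at hb
      exact (h.mem hy).1 (hb ▸ hab ▸ ha)
    · rw [List.nodup_append]
      refine ⟨h.nodup hx, List.nodup_singleton y, fun a ha b hb hab => hE ?_⟩
      rw [List.mem_singleton] at hb
      exact (h.mem hx).1 (hb ▸ hab ▸ ha)
    · exact h.nodup ha
  · rw [hrow ha]
    split_ifs with h1 h2
    · subst h1
      rw [List.mem_append, h.mem hy, List.mem_singleton]
      have := hxy.symm
      tauto
    · subst h2
      rw [List.mem_append, h.mem hx, List.mem_singleton]
      tauto
    · rw [h.mem ha]; tauto
  · rcases hab with hab | ⟨rfl, rfl⟩ | ⟨rfl, rfl⟩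
    · exact h.lt hab
    · exact ⟨hx, hy, hxy⟩
    · exact ⟨hy, hx, hxy.symm⟩
  · rcases hab with hab | hab | hab
    · exact .inl (h.symm hab)
    · exact .inr (.inr hab.symm)
    · exact .inr (.inl hab.symm)

theorem insert_sameOn (w : ℕ) (σ : Mem) : SameOn insert σ (insert.eval w σ) := by
  obtain ⟨t, h, -⟩ := exec_eval (w := w) (σ := σ) (P := insert) rfl
  exact h.sameOn

theorem clear_spec {n w : ℕ} {σ : Mem} (hW : Fits n w) (hn : σ.reg rN = n) (a : ℕ) :
    Runs w (clear a) σ (20 * n + 10) (fun τ => ∀ i < n, τ.arr a i = 0) := by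
  refine Runs.mono (Runs.for (N := n) (B := 3) (fun i τ => ∀ j < i, τ.arr a j = 0)
    (lt_of_lt_of_le (by omega) hW) rfl (by decide) ?_ (fun j hj => by omega) ?_) (by omega)
    (fun τ _ h => h)
  · intro τ hS
    exact (hS.reg (x := rN) rfl).trans hn
  · intro i τ hi hS hr hI
    refine Runs.straight rfl (le_of_eq rfl) fun j hj => ?_
    simp only [Prog.eval, Term.val, hr, setReg_arr, setArr_arr, if_true,
      Function.update_apply]
    split_ifs with h
    · rfl
    · exact hI j (by omega)

theorem setup_spec {n m w : ℕ} {σ : Mem} {G : SimpleGraph (Fin n)} {e : Fin m → Fin n × Fin n}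
    (he : IsEdgeList G e) (hn : 1 ≤ n) (hm : m ≤ n * n) (hW : Fits n w) (hσ : σ = inputMem e) :
    Runs w setup σ (300 * (n * n)) (fun τ => τ.reg rL = n - 1 ∧ τ.reg rV = n ∧ τ.reg rOk = 1 ∧
      (∀ v < n, τ.arr aRep v = v) ∧
      GraphMem n n (fun x y => ∃ u v : Fin n, ↑u = x ∧ ↑v = y ∧ G.Adj u v) τ) := by
  have hN : σ.reg rN = n := by simp [hσ, inputMem]
  have hM : σ.reg rM = m := by simp [hσ, inputMem]
  have h0 : ∀ (a j : ℕ), 2 ≤ a → σ.arr a j = 0 := by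
    intro a j ha
    simp only [hσ, inputMem]
    split_ifs <;> first | rfl | omega
  have hA : ∀ j : Fin m, σ.arr 0 j = (e j).1 := fun j => by simp [hσ, inputMem]
  have hB : ∀ j : Fin m, σ.arr 1 j = (e j).2 := fun j => by simp [hσ, inputMem]
  have hnn : n ≤ n * n := Nat.le_mul_self n
  have hn' : n < 2 ^ w := lt_of_lt_of_le (by omega) hW
  have hm' : m < 2 ^ w := lt_of_lt_of_le (by omega) hW
  have m1 : 1 % 2 ^ w = 1 := hW.lt (by omega)
  let E : ℕ → ℕ → ℕ → Prop := fun i x y => ∃ j : Fin m, (j : ℕ) < i ∧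
    (((e j).1 : ℕ) = x ∧ ((e j).2 : ℕ) = y ∨ ((e j).1 : ℕ) = y ∧ ((e j).2 : ℕ) = x)
  have hne : ∀ j, (e j).1 ≠ (e j).2 := by
    intro j h
    have h1 : s((e j).1, (e j).2) ∈ G.edgeSet := he.2 ▸ Set.mem_range_self j
    exact G.ne_of_adj h1 h
  have hE : ∀ x y, E m x y ↔ ∃ u v : Fin n, ↑u = x ∧ ↑v = y ∧ G.Adj u v := by
    intro x y
    constructor
    · rintro ⟨j, -, ⟨rfl, rfl⟩ | ⟨rfl, rfl⟩⟩
      · exact ⟨_, _, rfl, rfl, by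
          rw [← SimpleGraph.mem_edgeSet, ← he.2]; exact Set.mem_range_self j⟩
      · exact ⟨_, _, rfl, rfl, by
          rw [← SimpleGraph.mem_edgeSet, Sym2.eq_swap, ← he.2]; exact Set.mem_range_self j⟩
    · rintro ⟨u, v, rfl, rfl, huv⟩
      rw [← SimpleGraph.mem_edgeSet, ← he.2] at huv
      obtain ⟨j, hj⟩ := huv
      refine ⟨j, j.2, ?_⟩
      rcases Sym2.eq_iff.1 hj with ⟨h1, h2⟩ | ⟨h1, h2⟩
      · exact .inl ⟨congrArg _ h1, congrArg _ h2⟩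
      · exact .inr ⟨congrArg _ h1, congrArg _ h2⟩
  refine Runs.mono (T := 4 + (2 + (2 + (n * (3 + 10) + 8 + (m * (80 + 10) + 8) + 1) + 1) + 1) + 1)
    ?_ (by nlinarith) fun _ _ h => h
  refine Runs.seq (Q := fun τ => τ.reg rL = n - 1)
    (Runs.straight rfl (by decide) ?_) fun τ1 hS1 hQ1 => ?_
  · simp only [Prog.eval, setReg_reg, val_sub, Term.val, hN, m1]
    simpa using sub_mod_eq hn hn'
  refine Runs.seq (Q := fun τ => τ.reg rV = n)
    (Runs.straight rfl (by decide) ?_) fun τ2 hS2 hQ2 => ?_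
  · simp only [Prog.eval, setReg_reg, Term.val, if_true]
    exact (hS1.reg rfl).trans hN
  refine Runs.seq (Q := fun τ => τ.reg rOk = 1)
    (Runs.straight rfl (by decide) ?_) fun τ3 hS3 hQ3 => ?_
  · simp [Prog.eval, val_one, m1]
  have hN3 : τ3.reg rN = n :=
    (hS3.reg rfl).trans ((hS2.reg rfl).trans ((hS1.reg rfl).trans hN))
  have hM3 : τ3.reg rM = m :=
    (hS3.reg rfl).trans ((hS2.reg rfl).trans ((hS1.reg rfl).trans hM))
  have hL3 : τ3.reg rL = n - 1 := (hS3.reg rfl).trans ((hS2.reg rfl).trans hQ1)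
  have hV3 : τ3.reg rV = n := (hS3.reg rfl).trans hQ2
  have hA3 : ∀ a, τ3.arr a = σ.arr a := fun a =>
    (hS3.arr rfl).trans ((hS2.arr rfl).trans (hS1.arr rfl))
  refine Runs.seq (Runs.for (N := n) (B := 3) (fun i τ => ∀ j < i, τ.arr aRep j = j) hn' rfl
    (by decide) (fun τ hS => (hS.reg (x := rN) rfl).trans hN3) (fun j hj => by omega) ?_)
    fun τ4 hS4 hQ4 => ?_
  · intro i τ hi hS hr hI
    refine Runs.straight rfl (by decide) fun j hj => ?_
    simp only [Prog.eval, Term.val, hr, setReg_arr, setArr_arr, if_true, Function.update_apply]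
    split_ifs with h
    · exact h.symm
    · exact hI j (by omega)
  have hrow : ∀ x, row n (τ4.arr aDeg) (τ4.arr aAdj) x = [] := by
    intro x
    rw [row, hS4.arr (a := aDeg) rfl, hA3, h0 _ _ (by omega)]
    rfl
  refine Runs.mono (Runs.for (N := m) (B := 80)
    (fun i τ => GraphMem n n (E i) τ) hm' rfl
    (by decide) (fun τ hS => (hS.reg (x := rM) rfl).trans ((hS4.reg rfl).trans hM3)) ?_ ?_)
    le_rfl fun τ5 hS5 hQ5 => ?_
  · have hmat : ∀ i, τ4.arr aMat i = 0 := fun i => by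
      rw [hS4.arr rfl, hA3, h0 _ _ (by omega)]
    refine ⟨fun {x} _ {y} _ => ?_, fun i => .inl (hmat i), fun {x} _ => ?_, fun {x} _ {y} => ?_,
      fun ⟨j, hj, _⟩ => by omega, fun ⟨j, hj, _⟩ => by omega⟩
    · rw [setReg_arr, hmat]
      exact ⟨fun h => by omega, fun ⟨j, hj, _⟩ => by omega⟩
    · rw [setReg_arr, hrow]; exact List.nodup_nil
    · rw [setReg_arr, hrow]
      exact ⟨fun h => by simp at h, fun ⟨j, hj, _⟩ => by omega⟩
  · intro i τ hi hS hr hI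
    have hN5 : τ.reg rN = n := (hS.reg rfl).trans ((hS4.reg rfl).trans hN3)
    have hV5 : τ.reg rV = n := (hS.reg rfl).trans ((hS4.reg rfl).trans hV3)
    have hA5 : τ.arr 0 i = (e ⟨i, hi⟩).1 := by
      rw [hS.arr rfl, hS4.arr rfl, hA3]; exact hA ⟨i, hi⟩
    have hB5 : τ.arr 1 i = (e ⟨i, hi⟩).2 := by
      rw [hS.arr rfl, hS4.arr rfl, hA3]; exact hB ⟨i, hi⟩
    refine Runs.straight rfl (by decide) ?_
    have h1 : GraphMem n n (E i) ((τ.setReg rX (e ⟨i, hi⟩).1).setReg rY (e ⟨i, hi⟩).2) :=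
      ⟨hI.mat, hI.fresh, hI.nodup, hI.mem, hI.lt, hI.symm⟩
    have h2 := insert_spec hW h1 (x := (e ⟨i, hi⟩).1) (y := (e ⟨i, hi⟩).2) (by simpa using hN5)
      (by simpa using hV5) (by simp) (by simp) (Fin.is_lt _) (Fin.is_lt _)
      (fun h => hne _ (Fin.ext h))
    have h3 : ((rX ≔ ag 0 (rg rI) ;; rY ≔ ag 1 (rg rI) ;; insert).eval w τ) =
        insert.eval w ((τ.setReg rX (e ⟨i, hi⟩).1).setReg rY (e ⟨i, hi⟩).2) := by
      simp [Prog.eval, Term.val, hr, hA5, hB5]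
    rw [h3]
    refine GraphMem.congr (E := _) (E' := _) ⟨h2.mat, h2.fresh, h2.nodup, h2.mem, h2.lt, h2.symm⟩
      fun x y => ?_
    constructor
    · rintro (⟨j, h1, h2⟩ | ⟨rfl, rfl⟩ | ⟨rfl, rfl⟩)
      · exact ⟨j, by omega, h2⟩
      · exact ⟨⟨i, hi⟩, by simp, .inl ⟨rfl, rfl⟩⟩
      · exact ⟨⟨i, hi⟩, by simp, .inr ⟨rfl, rfl⟩⟩
    · rintro ⟨j, h1, h2⟩
      by_cases hji : (j : ℕ) = i
      · obtain rfl : j = ⟨i, hi⟩ := Fin.ext hji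
        rcases h2 with ⟨rfl, rfl⟩ | ⟨rfl, rfl⟩
        · exact .inr (.inl ⟨rfl, rfl⟩)
        · exact .inr (.inr ⟨rfl, rfl⟩)
      · exact .inl ⟨j, by omega, h2⟩
  · refine ⟨(hS5.reg rfl).trans ((hS4.reg rfl).trans hL3),
      (hS5.reg rfl).trans ((hS4.reg rfl).trans hV3),
      (hS5.reg rfl).trans ((hS4.reg rfl).trans hQ3), fun v hv => ?_, hQ5.congr hE⟩
    rw [hS5.arr rfl, hQ4 v hv]

/-! ### The memory at the beginning of a recursive call -/

/-- The memory holds the graph `H` of a recursive call with limit `L`. The vertex `ρ v` of `H` is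
the image of the vertex `v` of the input, and `enc x` is the vertex of the input that represents
the vertex `x` of `H`. -/
structure LoopMem {V : Type} (n : ℕ) (H : SimpleGraph V) (ρ : ℕ → V) (enc : V → ℕ) (L : ℕ)
    (σ : Mem) : Prop where
  num : σ.reg rN = n
  lim : σ.reg rL = L
  card : σ.reg rV = Nat.card V
  ok : σ.reg rOk = 1
  lim_lt : L < n
  enc_lt : ∀ x, enc x < n
  rho_enc : ∀ x, ρ (enc x) = x
  rep : ∀ v < n, σ.arr aRep v = enc (ρ v)
  graph : GraphMem n (Nat.card V) (fun x y => ∃ u v, enc u = x ∧ enc v = y ∧ H.Adj u v) σ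

/-- The arrays `D` and `J` hold, for every vertex `x`, the number of its neighbors and the list
`nb x` of its neighbors. -/
structure NbrMem {V : Type} (n : ℕ) (H : SimpleGraph V) (enc : V → ℕ) (nb : V → List V)
    (D J : ℕ → ℕ) : Prop where
  nodup : ∀ x, (nb x).Nodup
  mem : ∀ {x y}, y ∈ nb x ↔ H.Adj x y
  deg : ∀ x, D (enc x) = (nb x).length
  get : ∀ x k (h : k < (nb x).length), J (enc x * n + k) = enc (nb x)[k]
  length_lt : ∀ x, (nb x).length ≤ n

section

variable {V : Type} {n L w : ℕ} {H : SimpleGraph V} {ρ : ℕ → V} {enc : V → ℕ} {σ : Mem}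
  {nb : V → List V}

theorem LoopMem.enc_injective (h : LoopMem n H ρ enc L σ) : Function.Injective enc :=
  Function.LeftInverse.injective h.rho_enc

theorem LoopMem.finite (h : LoopMem n H ρ enc L σ) : Finite V :=
  Finite.of_injective (fun x => (⟨enc x, h.enc_lt x⟩ : Fin n))
    fun _ _ hxy => h.enc_injective (Fin.mk.inj_iff.1 hxy)

theorem LoopMem.card_le (h : LoopMem n H ρ enc L σ) : Nat.card V ≤ n := by
  have := Nat.card_le_card_of_injective (fun x => (⟨enc x, h.enc_lt x⟩ : Fin n))
    fun _ _ hxy => h.enc_injective (Fin.mk.inj_iff.1 hxy)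
  rwa [Nat.card_fin] at this

/-- The rows of neighbors, read as lists of vertices of `H`. -/
theorem LoopMem.exists_nbrMem (h : LoopMem n H ρ enc L σ) :
    ∃ nb, NbrMem n H enc nb (σ.arr aDeg) (σ.arr aAdj) := by
  have hval : ∀ {x a}, a ∈ row n (σ.arr aDeg) (σ.arr aAdj) (enc x) → enc (ρ a) = a := by
    intro x a ha
    obtain ⟨u, v, -, rfl, -⟩ := (h.graph.mem (h.enc_lt x)).1 ha
    rw [h.rho_enc]
  refine ⟨fun x => (row n (σ.arr aDeg) (σ.arr aAdj) (enc x)).map ρ, fun x => ?_, fun {x y} => ?_,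
    fun x => ?_, fun x k hk => ?_, fun x => ?_⟩
  · refine (List.nodup_map_iff_inj_on (h.graph.nodup (h.enc_lt x))).2 fun a ha b hb hab => ?_
    rw [← hval ha, ← hval hb, hab]
  · rw [List.mem_map]
    constructor
    · rintro ⟨a, ha, rfl⟩
      obtain ⟨u, v, hu, rfl, huv⟩ := (h.graph.mem (h.enc_lt x)).1 ha
      rwa [h.rho_enc, ← h.enc_injective hu]
    · exact fun hxy => ⟨enc y, (h.graph.mem (h.enc_lt x)).2 ⟨x, y, rfl, rfl, hxy⟩, h.rho_enc y⟩
  · simp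
  · rw [List.getElem_map, hval (List.getElem_mem _)]
    simp [row]
  · simpa using h.graph.deg_le (h.enc_lt x)

theorem NbrMem.ncard_neighborSet {D J : ℕ → ℕ} (h : NbrMem n H enc nb D J) (x : V) :
    (H.neighborSet x).ncard = (nb x).length := by
  classical
  have : H.neighborSet x = ((nb x).toFinset : Set V) := by
    ext y
    simp [h.mem]
  rw [this, Set.ncard_coe_finset, List.toFinset_card_of_nodup (h.nodup x)]

theorem NbrMem.sum_length [Fintype V] {D J : ℕ → ℕ} (h : NbrMem n H enc nb D J) :
    ∑ x, (nb x).length = 2 * H.edgeSet.ncard := by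
  classical
  have h1 := H.sum_degrees_eq_twice_card_edges
  rw [← Set.ncard_coe_finset, SimpleGraph.coe_edgeFinset] at h1
  rw [← h1]
  refine Finset.sum_congr rfl fun x _ => ?_
  rw [← h.ncard_neighborSet, ← SimpleGraph.card_neighborFinset_eq_degree, ← Set.ncard_coe_finset,
    SimpleGraph.coe_neighborFinset]

theorem LoopMem.deg_eq_zero (h : LoopMem n H ρ enc L σ) {a : ℕ} (ha : a < n)
    (hne : ∀ x, enc x ≠ a) : σ.arr aDeg a = 0 := by
  rw [← length_row n (σ.arr aDeg) (σ.arr aAdj) a, List.length_eq_zero_iff,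
    List.eq_nil_iff_forall_not_mem]
  intro y hy
  obtain ⟨u, v, hu, -⟩ := (h.graph.mem ha).1 hy
  exact hne u hu

theorem LoopMem.sum_deg (h : LoopMem n H ρ enc L σ)
    (hnb : NbrMem n H enc nb (σ.arr aDeg) (σ.arr aAdj)) :
    ∑ a ∈ Finset.range n, σ.arr aDeg a = 2 * H.edgeSet.ncard := by
  classical
  have := h.finite
  have := Fintype.ofFinite V
  rw [← hnb.sum_length]
  have h1 : ∑ a ∈ Finset.univ.image enc, σ.arr aDeg a = ∑ x, (nb x).length := by
    rw [Finset.sum_image fun x _ y _ hxy => h.enc_injective hxy]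
    exact Finset.sum_congr rfl fun x _ => hnb.deg x
  rw [← h1]
  symm
  refine Finset.sum_subset (fun a ha => ?_) fun a ha hna => ?_
  · obtain ⟨x, -, rfl⟩ := Finset.mem_image.1 ha
    exact Finset.mem_range.2 (h.enc_lt x)
  · exact h.deg_eq_zero (Finset.mem_range.1 ha) fun x hx => hna (hx ▸ Finset.mem_image_of_mem _
      (Finset.mem_univ x))

theorem scan_spec (hW : Fits n w) (h : LoopMem n H ρ enc L σ)
    (hnb : NbrMem n H enc nb (σ.arr aDeg) (σ.arr aAdj)) :
    Runs w scan σ (60 * n) (fun τ => ∃ p, τ.reg rP = enc p ∧ τ.reg rD = (nb p).length ∧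
      (∀ x, (nb x).length ≤ (nb p).length) ∧ τ.reg rS = 2 * H.edgeSet.ncard) := by
  have hn : 0 < n := by have := h.lim_lt; omega
  have hn' : n < 2 ^ w := lt_of_lt_of_le (by omega) hW
  refine Runs.mono (T := 20 + (n * (20 + 10) + 8) + 1) ?_ (by omega) fun _ _ h => h
  refine Runs.seq (Q := fun τ => τ.reg rP = enc (ρ 0) ∧ τ.reg rD = σ.arr aDeg (enc (ρ 0)) ∧
    τ.reg rS = 0) (Runs.straight rfl (by decide) ?_) fun τ1 hS1 hQ1 => ?_
  · simp [Prog.eval, Term.val, h.rep 0 hn]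
  refine Runs.mono (Runs.for (N := n) (B := 20) (fun i τ => τ.reg rS = ∑ a ∈ Finset.range i,
    σ.arr aDeg a ∧ ∃ p, τ.reg rP = enc p ∧ τ.reg rD = σ.arr aDeg (enc p) ∧
      ∀ a < i, σ.arr aDeg a ≤ τ.reg rD) hn' rfl (by decide)
      (fun τ hS => (hS.reg (x := rN) rfl).trans ((hS1.reg rfl).trans h.num)) ?_ ?_) le_rfl ?_
  · simp only [setReg_reg, Nat.reduceEqDiff, if_false, Finset.range_zero, Finset.sum_empty]
    exact ⟨hQ1.2.2, _, hQ1.1, hQ1.2.1, fun a ha => by omega⟩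
  · rintro i τ hi hS hr ⟨hs, p, hp, hd, hmax⟩
    have hdeg : τ.arr aDeg = σ.arr aDeg := (hS.arr rfl).trans (hS1.arr rfl)
    have hle : ∑ a ∈ Finset.range (i + 1), σ.arr aDeg a ≤ (i + 1) * n := by
      refine (Finset.sum_le_card_nsmul _ _ n fun a ha => ?_).trans_eq (by simp)
      rw [Finset.mem_range] at ha
      exact h.graph.deg_le (by omega)
    have hin : (i + 1) * n ≤ n * n := Nat.mul_le_mul_right n hi
    rw [Finset.sum_range_succ] at hle
    have m1 : (∑ a ∈ Finset.range i, σ.arr aDeg a + σ.arr aDeg i) % 2 ^ w = _ :=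
      hW.lt (by omega)
    refine Runs.straight rfl (by decide) ?_
    by_cases hlt : σ.arr aDeg (enc p) < σ.arr aDeg i
    · obtain ⟨x, rfl⟩ : ∃ x, enc x = i := by
        by_contra! hne
        rw [h.deg_eq_zero hi hne] at hlt
        omega
      simp [Prog.eval, Term.val, Op.apply, hr, hs, hd, hdeg, hlt, m1, Finset.sum_range_succ]
      refine ⟨x, rfl, rfl, fun a ha => ?_⟩
      rcases Nat.lt_or_eq_of_le ha with ha | rfl
      · exact (hmax a ha).trans (hd ▸ hlt.le)
      · exact le_rfl
    · simp [Prog.eval, Term.val, Op.apply, hr, hs, hp, hd, hdeg, hlt, m1, Finset.sum_range_succ]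
      refine ⟨p, rfl, rfl, fun a ha => ?_⟩
      rcases Nat.lt_or_eq_of_le ha with ha | rfl
      · exact (hmax a ha).trans hd.le
      · omega
  · rintro τ hS ⟨hs, p, hp, hd, hmax⟩
    refine ⟨p, hp, hd.trans (hnb.deg p), fun x => ?_, hs.trans (h.sum_deg hnb)⟩
    rw [← hnb.deg, ← hnb.deg, ← hd]
    exact hmax _ (h.enc_lt x)

theorem logarithm_spec {c : ℕ} (hW : Fits n w) (hn : σ.reg rN = n) (hc : σ.reg rV = c)
    (hcn : c ≤ n) : Runs w logarithm σ (50 * n + 50) (fun τ => τ.reg rB = Nat.clog 2 c) := by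
  have hn' : n < 2 ^ w := lt_of_lt_of_le (by omega) hW
  refine Runs.mono (T := 20 + (n * (20 + 10) + 8) + 1) ?_ (by omega) fun _ _ h => h
  refine Runs.seq (Q := fun τ => τ.reg rB = 0 ∧ τ.reg rW = 1)
    (Runs.straight rfl (by decide) ?_) fun τ1 hS1 hQ1 => ?_
  · have m1 : 1 % 2 ^ w = 1 := hW.lt (by omega)
    simp [Prog.eval, Term.val, m1]
  refine Runs.mono (Runs.for (N := n) (B := 20) (fun i τ => ∃ b, τ.reg rB = b ∧
    τ.reg rW = 2 ^ b ∧ b ≤ Nat.clog 2 c ∧ (c ≤ 2 ^ b ∨ b = i)) hn' rfl (by decide)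
      (fun τ hS => (hS.reg (x := rN) rfl).trans ((hS1.reg rfl).trans hn)) ?_ ?_) le_rfl ?_
  · exact ⟨0, by simpa using hQ1.1, by simpa using hQ1.2, by omega, .inr rfl⟩
  · rintro i τ hi hS hr ⟨b, hb, hw, hle, hor⟩
    have hV : τ.reg rV = c := (hS.reg rfl).trans ((hS1.reg rfl).trans hc)
    refine Runs.straight rfl (by decide) ?_
    by_cases hlt : 2 ^ b < c
    · have hbn : b < n := Nat.lt_two_pow_self.trans (hlt.trans_le hcn)
      have m1 : (2 ^ b + 2 ^ b) % 2 ^ w = _ := hW.lt (by omega)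
      have m2 : (b + 1) % 2 ^ w = _ := hW.lt (by omega)
      refine ⟨b + 1, ?_, ?_, (Nat.lt_clog_iff_pow_lt one_lt_two).2 hlt, ?_⟩
      · simp [Prog.eval, Term.val, Op.apply, hb, hw, hV, hlt, m2]
      · simp [Prog.eval, Term.val, Op.apply, hw, hV, hlt, m1, pow_succ, mul_two]
      · omega
    · refine ⟨b, ?_, ?_, hle, .inl (by omega)⟩
      · simp [Prog.eval, Term.val, Op.apply, hb, hw, hV, hlt]
      · simp [Prog.eval, Term.val, Op.apply, hw, hV, hlt]
  · rintro τ hS ⟨b, hb, hw, hle, hor⟩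
    rw [hb]
    refine le_antisymm hle (Nat.clog_le_of_le_pow ?_)
    rcases hor with h | rfl
    · exact h
    · exact hcn.trans Nat.lt_two_pow_self.le

end

/-! ### Breadth-first search -/

section

variable {V : Type*} {H : SimpleGraph V} {p : V}

theorem exists_predecessor {x : V} {k : ℕ} (hx : H.Reachable p x) (hk : H.dist p x = k + 1) :
    ∃ w, H.Reachable p w ∧ H.Adj w x ∧ H.dist p w = k := by
  obtain ⟨W, hW⟩ := hx.symm.exists_walk_length_eq_dist
  rw [SimpleGraph.dist_comm, hk] at hW
  cases W with
  | nil => simp at hW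
  | @cons _ w _ h t =>
    rw [SimpleGraph.Walk.length_cons] at hW
    refine ⟨w, t.reachable.symm, h.symm, le_antisymm ?_ ?_⟩
    · rw [SimpleGraph.dist_comm]
      exact (SimpleGraph.dist_le t).trans (by omega)
    · obtain ⟨W', hW'⟩ := t.reachable.symm.exists_walk_length_eq_dist
      have := SimpleGraph.dist_le (W'.concat h.symm)
      rw [SimpleGraph.Walk.length_concat] at this
      omega

theorem dist_le_succ {x y : V} (hx : H.Reachable p x) (hxy : H.Adj x y) :
    H.dist p y ≤ H.dist p x + 1 := by
  obtain ⟨W, hW⟩ := hx.exists_walk_length_eq_dist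
  have := SimpleGraph.dist_le (W.concat hxy)
  rw [SimpleGraph.Walk.length_concat] at this
  omega

theorem dist_lt_card [Finite V] (x : V) : H.dist p x < Nat.card V := by
  have := Fintype.ofFinite V
  by_cases h : H.Reachable p x
  · obtain ⟨W, hW⟩ := h.exists_walk_length_eq_dist
    rw [← hW, Nat.card_eq_fintype_card]
    exact (W.isPath_of_length_eq_dist hW).length_lt
  · rw [SimpleGraph.dist_eq_zero_of_not_reachable h]
    have : Nonempty V := ⟨p⟩
    exact Nat.card_pos

/-- The state of a breadth-first search from `p`: the vertices of `l₁` have been processed, and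
those of `l₂` are waiting in the queue. -/
structure BfsInv (H : SimpleGraph V) (p : V) (l₁ l₂ : List V) : Prop where
  start : p ∈ l₁ ++ l₂
  nodup : (l₁ ++ l₂).Nodup
  reach : ∀ x ∈ l₁ ++ l₂, H.Reachable p x
  sorted : (l₁ ++ l₂).Pairwise fun x y => H.dist p x ≤ H.dist p y
  near : ∀ v ∈ l₂.head?, ∀ x ∈ l₁ ++ l₂, H.dist p x ≤ H.dist p v + 1
  closed : ∀ x ∈ l₁, ∀ y, H.Adj x y → y ∈ l₁ ++ l₂

theorem BfsInv.init : BfsInv H p [] [p] := by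
  refine ⟨by simp, by simp, by simp, by simp, by simp, by simp⟩

variable {l₁ l₂ : List V} {u v : V}

/-- A vertex is discovered by a neighbor that precedes it on a shortest path. -/
theorem BfsInv.dist_eq (h : BfsInv H p l₁ (v :: l₂)) (hvu : H.Adj v u) (hu : u ∉ l₁ ++ v :: l₂) :
    H.dist p u = H.dist p v + 1 := by
  have hv : H.Reachable p v := h.reach v (by simp)
  refine le_antisymm (dist_le_succ hv hvu) ?_
  by_contra hlt
  have key : ∀ k, ∀ x, H.Reachable p x → H.dist p x = k → k ≤ H.dist p v →
      x ∈ l₁ ++ v :: l₂ := by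
    intro k
    induction k with
    | zero =>
      intro x hx hk _
      rw [hx.dist_eq_zero_iff] at hk
      exact hk ▸ h.start
    | succ k ih =>
      intro x hx hk hle
      obtain ⟨w, hw, hwx, hwk⟩ := exists_predecessor hx hk
      rcases List.mem_append.1 (ih w hw hwk (by omega)) with hmem | hmem
      · exact h.closed w hmem x hwx
      · exfalso
        have h2 := (List.pairwise_cons.1 (List.pairwise_append.1 h.sorted).2.1).1
        rcases List.mem_cons.1 hmem with rfl | hmem
        · omega
        · have := h2 w hmem
          omega
  exact hu (key _ u (hv.trans hvu.reachable) rfl (by omega))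

theorem BfsInv.push (h : BfsInv H p l₁ (v :: l₂)) (hvu : H.Adj v u) (hu : u ∉ l₁ ++ v :: l₂) :
    BfsInv H p l₁ (v :: (l₂ ++ [u])) := by
  have he : l₁ ++ v :: (l₂ ++ [u]) = (l₁ ++ v :: l₂) ++ [u] := by simp
  have hd := h.dist_eq hvu hu
  refine ⟨?_, ?_, ?_, ?_, ?_, ?_⟩
  · rw [he]; exact List.mem_append_left _ h.start
  · rw [he, List.nodup_append]
    refine ⟨h.nodup, by simp, fun a ha b hb hab => hu ?_⟩
    rw [List.mem_singleton] at hb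
    exact hb ▸ hab ▸ ha
  · rw [he]
    intro x hx
    rcases List.mem_append.1 hx with hx | hx
    · exact h.reach x hx
    · rw [List.mem_singleton.1 hx]
      exact (h.reach v (by simp)).trans hvu.reachable
  · rw [he, List.pairwise_append]
    refine ⟨h.sorted, by simp, fun a ha b hb => ?_⟩
    rw [List.mem_singleton.1 hb, hd]
    exact h.near v (by simp) a ha
  · rw [he]
    intro v' hv' x hx
    simp only [List.head?_cons, Option.mem_def, Option.some.injEq] at hv'
    subst hv'
    rcases List.mem_append.1 hx with hx | hx
    · exact h.near v (by simp) x hx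
    · rw [List.mem_singleton.1 hx, hd]
  · rw [he]
    exact fun x hx y hxy => List.mem_append_left _ (h.closed x hx y hxy)

theorem BfsInv.advance (h : BfsInv H p l₁ (v :: l₂))
    (hv : ∀ u, H.Adj v u → u ∈ l₁ ++ v :: l₂) : BfsInv H p (l₁ ++ [v]) l₂ := by
  have he : l₁ ++ [v] ++ l₂ = l₁ ++ v :: l₂ := by simp
  refine ⟨he ▸ h.start, he ▸ h.nodup, he ▸ h.reach, he ▸ h.sorted, ?_, ?_⟩
  · rw [he]
    intro v' hv' x hx
    refine (h.near v (by simp) x hx).trans ?_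
    have h2 := (List.pairwise_cons.1 (List.pairwise_append.1 h.sorted).2.1).1
    have := h2 v' (List.mem_of_mem_head? hv')
    omega
  · rw [he]
    intro x hx y hxy
    rcases List.mem_append.1 hx with hx | hx
    · exact h.closed x hx y hxy
    · rw [List.mem_singleton.1 hx] at hxy
      exact hv y hxy

theorem BfsInv.mem_iff (h : BfsInv H p l₁ []) (x : V) : x ∈ l₁ ↔ H.Reachable p x := by
  constructor
  · exact fun hx => h.reach x (by simpa using hx)
  · rintro ⟨W⟩
    have : ∀ a b (W : H.Walk a b), a ∈ l₁ → b ∈ l₁ := by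
      intro a b W
      induction W with
      | nil => exact id
      | cons hab _ ih => exact fun ha => ih (by simpa using h.closed _ ha _ hab)
    exact this _ _ W (by simpa using h.start)

theorem BfsInv.connected_iff [Finite V] (h : BfsInv H p l₁ []) :
    H.Connected ↔ Nat.card V ≤ l₁.length := by
  classical
  have := Fintype.ofFinite V
  have h1 : l₁.toFinset.card = l₁.length :=
    List.toFinset_card_of_nodup (by simpa using h.nodup)
  rw [Nat.card_eq_fintype_card, ← h1]
  constructor
  · intro hc
    rw [← Finset.card_univ]
    exact Finset.card_le_card fun x _ => List.mem_toFinset.2 ((h.mem_iff x).2 (hc.preconnected p x))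
  · intro hle
    have h2 := (Finset.card_eq_iff_eq_univ _).1
      (le_antisymm (Finset.card_le_univ l₁.toFinset) hle)
    have h3 : ∀ x, H.Reachable p x := fun x =>
      (h.mem_iff x).1 (List.mem_toFinset.1 (h2 ▸ Finset.mem_univ x))
    have : Nonempty V := ⟨p⟩
    exact ⟨fun x y => (h3 x).symm.trans (h3 y)⟩

theorem not_isBipartite {x y : V} (hx : H.Reachable p x) (hxy : H.Adj x y)
    (hd : H.dist p x = H.dist p y) : ¬ H.IsBipartite := by
  intro hb
  obtain ⟨W, hW⟩ := hx.exists_walk_length_eq_dist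
  obtain ⟨W', hW'⟩ := (hx.trans hxy.reachable).exists_walk_length_eq_dist
  have := (SimpleGraph.two_colorable_iff_forall_loop_even.1 hb) p ((W.concat hxy).append W'.reverse)
  rw [SimpleGraph.Walk.length_append, SimpleGraph.Walk.length_concat,
    SimpleGraph.Walk.length_reverse, hW, hW', hd, Nat.even_iff] at this
  omega

theorem dist_eq_or (hc : H.Connected) {x y : V} (hxy : H.Adj x y)
    (hd : H.dist p x ≠ H.dist p y) :
    H.dist p y = H.dist p x + 1 ∨ H.dist p x = H.dist p y + 1 := by
  have h1 := dist_le_succ (hc.preconnected p x) hxy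
  have h2 := dist_le_succ (hc.preconnected p y) hxy.symm
  omega

theorem isBipartite_of_dist_ne (hc : H.Connected)
    (h : ∀ x y, H.Adj x y → H.dist p x ≠ H.dist p y) : H.IsBipartite := by
  refine ⟨SimpleGraph.Coloring.mk
    (fun v => (⟨H.dist p v % 2, Nat.mod_lt _ two_pos⟩ : Fin 2)) fun {u v} huv => ?_⟩
  simp only [ne_eq, Fin.mk.injEq]
  rcases dist_eq_or hc huv (h u v huv) with h | h <;> omega

end

section

variable {V : Type} {n L w : ℕ} {H : SimpleGraph V} {ρ : ℕ → V} {enc : V → ℕ} {σ τ : Mem}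
  {nb : V → List V} {p u v : V}

/-- The array `a` begins with the entries of `l`. -/
def HoldsList (a : ℕ → ℕ) (l : List ℕ) : Prop := ∀ k (h : k < l.length), a k = l[k]

theorem HoldsList.push {a : ℕ → ℕ} {l : List ℕ} (h : HoldsList a l) {k : ℕ} (hk : k = l.length)
    (x : ℕ) : HoldsList (Function.update a k x) (l ++ [x]) := by
  intro i hi
  rw [Function.update_apply]
  split_ifs with h1
  · subst h1; simp [hk]
  · rw [List.length_append, List.length_singleton] at hi
    rw [List.getElem_append_left (by omega), h i]

/-- All pairs of a vertex of `l` and a neighbor of it. -/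
def darts (nb : V → List V) (l : List V) : List (V × V) :=
  l.flatMap fun x => (nb x).map fun y => (x, y)

/-- Those pairs in a list whose second vertex is farther from `p` than the first one. -/
noncomputable def ups (H : SimpleGraph V) (p : V) (l : List (V × V)) : List (V × V) :=
  l.filter fun e => decide (H.dist p e.2 = H.dist p e.1 + 1)

open Classical in
/-- The memory during a breadth-first search from `p`, when the vertices in `Q` have been found
and the pairs in `P` have been treated. -/
structure BfsMem (H : SimpleGraph V) (p : V) (enc : V → ℕ) (Q : List V) (P : List (V × V))
    (τ : Mem) : Prop where
  len : τ.reg rT = Q.length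
  que : HoldsList (τ.arr aQue) (Q.map enc)
  dst : ∀ x, τ.arr aDst (enc x) = if x ∈ Q then H.dist p x + 1 else 0
  num : τ.reg rU = (ups H p P).length
  up : HoldsList (τ.arr aUp) ((ups H p P).map fun e => enc e.1)
  dn : HoldsList (τ.arr aDn) ((ups H p P).map fun e => enc e.2)
  ok : (τ.reg rOk = 1 ∧ ∀ e ∈ P, H.dist p e.1 ≠ H.dist p e.2) ∨
    (τ.reg rOk = 0 ∧ ∃ e ∈ P, H.dist p e.1 = H.dist p e.2)

theorem visit_spec {l₁ l₂ : List V} {P : List (V × V)} (hW : Fits n w)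
    (henc : Function.Injective enc) (hlt : ∀ x, enc x < n) (hdist : ∀ x, H.dist p x < n)
    (hB : BfsInv H p l₁ (v :: l₂))
    (h : BfsMem H p enc (l₁ ++ v :: l₂) P τ) (hX : τ.reg rX = enc v) (hY : τ.reg rY = enc u)
    (hvu : H.Adj v u) :
    ∃ l₂', BfsInv H p l₁ (v :: l₂') ∧ (∀ x ∈ l₁ ++ v :: l₂, x ∈ l₁ ++ v :: l₂') ∧
      u ∈ l₁ ++ v :: l₂' ∧ BfsMem H p enc (l₁ ++ v :: l₂') P (visit.eval w τ) := by
  by_cases hu : u ∈ l₁ ++ v :: l₂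
  · refine ⟨l₂, hB, fun x hx => hx, hu, ?_⟩
    have e : visit.eval w τ = τ := by
      have := h.dst u
      rw [if_pos hu] at this
      simp [visit, Prog.eval, Term.val, Op.apply, hY, this]
    rwa [e]
  · have he : l₁ ++ v :: (l₂ ++ [u]) = (l₁ ++ v :: l₂) ++ [u] := by simp
    refine ⟨l₂ ++ [u], hB.push hvu hu, ?_, by simp, ?_⟩
    · rw [he]; exact fun x hx => List.mem_append_left _ hx
    · have hv : v ∈ l₁ ++ v :: l₂ := by simp
      have hlen : (l₁ ++ v :: l₂).length ≤ n := by
        rw [← List.length_map (f := enc)]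
        refine length_le_of_nodup (hB.nodup.map henc) fun a ha => ?_
        obtain ⟨x, -, rfl⟩ := List.mem_map.1 ha
        exact hlt x
      have m1 : (H.dist p v + 1 + 1) % 2 ^ w = H.dist p v + 1 + 1 :=
        hW.lt (by have := hdist v; nlinarith)
      have m2 : ((l₁ ++ v :: l₂).length + 1) % 2 ^ w = (l₁ ++ v :: l₂).length + 1 :=
        hW.lt (by omega)
      have hdu := h.dst u
      have hdv := h.dst v
      rw [if_neg hu] at hdu
      rw [if_pos hv] at hdv
      have e : visit.eval w τ = ((τ.setArr aDst (enc u) (H.dist p v + 1 + 1)).setArr aQue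
          (l₁ ++ v :: l₂).length (enc u)).setReg rT ((l₁ ++ v :: l₂).length + 1) := by
        have hl := h.len
        generalize (l₁ ++ v :: l₂).length = K at hl m2
        simp [visit, Prog.eval, Term.val, Op.apply, hX, hY, hdu, hdv, hl, m1, m2]
      rw [he, e]
      refine ⟨?_, ?_, fun x => ?_, h.num, h.up, h.dn, h.ok⟩
      · exact (List.length_append (bs := [u])).symm
      · simpa using h.que.push (by simp) (enc u)
      · have hx := h.dst x
        have hd := hB.dist_eq hvu hu
        simp only [setReg_arr, setArr_arr, Nat.reduceEqDiff, if_false, if_true,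
          Function.update_apply, hx]
        by_cases hxu : x = u
        · subst hxu
          rw [if_pos rfl, if_pos (by simp), hd]
        · rw [if_neg fun h' => hxu (henc h')]
          by_cases hxQ : x ∈ l₁ ++ v :: l₂
          · rw [if_pos hxQ, if_pos (List.mem_append_left _ hxQ)]
          · rw [if_neg hxQ, if_neg]
            rw [List.mem_append, List.mem_singleton]
            tauto

theorem record_spec {Q : List V} {P : List (V × V)} (hW : Fits n w)
    (hdist : ∀ x, H.dist p x < n) (hP : P.length ≤ (n + 1) * n)
    (h : BfsMem H p enc Q P τ) (hX : τ.reg rX = enc v) (hY : τ.reg rY = enc u)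
    (hv : v ∈ Q) (hu : u ∈ Q) : BfsMem H p enc Q (P ++ [(v, u)]) (record.eval w τ) := by
  have hdu := h.dst u
  have hdv := h.dst v
  rw [if_pos hu] at hdu
  rw [if_pos hv] at hdv
  have m1 : (H.dist p v + 1 + 1) % 2 ^ w = H.dist p v + 1 + 1 :=
    hW.lt (by have := hdist v; nlinarith)
  have m2 : ((ups H p P).length + 1) % 2 ^ w = (ups H p P).length + 1 := by
    have : (ups H p P).length ≤ P.length := List.length_filter_le _ _
    rw [add_mul] at hP
    exact hW.lt (by omega)
  have hups : ups H p (P ++ [(v, u)]) =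
      ups H p P ++ if H.dist p u = H.dist p v + 1 then [(v, u)] else [] := by
    rw [ups, List.filter_append, List.filter_singleton]
    simp only [ups]
    split_ifs <;> simp_all
  by_cases h1 : H.dist p u = H.dist p v
  · have e : record.eval w τ = τ.setReg rOk 0 := by
      simp [record, Prog.eval, Term.val, Op.apply, hX, hY, hdu, hdv, h1]
    rw [if_neg (by omega), List.append_nil] at hups
    rw [e]
    refine ⟨h.len, h.que, h.dst, by rw [hups]; exact h.num, by rw [hups]; exact h.up,
      by rw [hups]; exact h.dn, .inr ⟨rfl, (v, u), by simp, h1.symm⟩⟩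
  · have hok : ∀ τ' : Mem, τ'.reg rOk = τ.reg rOk →
        ((τ'.reg rOk = 1 ∧ ∀ e ∈ P ++ [(v, u)], H.dist p e.1 ≠ H.dist p e.2) ∨
        (τ'.reg rOk = 0 ∧ ∃ e ∈ P ++ [(v, u)], H.dist p e.1 = H.dist p e.2)) := by
      intro τ' hτ
      rw [hτ]
      rcases h.ok with ⟨h2, h3⟩ | ⟨h2, e, h3, h4⟩
      · refine .inl ⟨h2, fun e he => ?_⟩
        rcases List.mem_append.1 he with he | he
        · exact h3 e he
        · rw [List.mem_singleton.1 he]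
          exact fun h => h1 h.symm
      · exact .inr ⟨h2, e, List.mem_append_left _ h3, h4⟩
    by_cases h2 : H.dist p u = H.dist p v + 1
    · have e : record.eval w τ = ((τ.setArr aUp (ups H p P).length (enc v)).setArr aDn
          (ups H p P).length (enc u)).setReg rU ((ups H p P).length + 1) := by
        simp [record, Prog.eval, Term.val, Op.apply, hX, hY, hdu, hdv, h2, m1, m2, h.num]
      rw [if_pos h2] at hups
      rw [e]
      refine ⟨h.len, h.que, h.dst, ?_, ?_, ?_, hok _ rfl⟩
      · simp [hups]
      · rw [hups]; simpa using h.up.push (by simp) (enc v)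
      · rw [hups]; simpa using h.dn.push (by simp) (enc u)
    · have e : record.eval w τ = τ := by
        simp [record, Prog.eval, Term.val, Op.apply, hX, hY, hdu, hdv, h1, h2, m1]
      rw [if_neg h2, List.append_nil] at hups
      rw [e]
      exact ⟨h.len, h.que, h.dst, by rw [hups]; exact h.num, by rw [hups]; exact h.up,
        by rw [hups]; exact h.dn, hok _ rfl⟩

theorem darts_append (l l' : List V) : darts nb (l ++ l') = darts nb l ++ darts nb l' := by
  simp [darts]

theorem length_darts_le (hnb : ∀ x, (nb x).length ≤ n) (l : List V) :
    (darts nb l).length ≤ l.length * n := by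
  induction l with
  | nil => simp [darts]
  | cons a l ih =>
    rw [← List.singleton_append, darts_append, List.length_append, List.length_append, add_mul]
    refine add_le_add ?_ ih
    simpa [darts] using hnb a

/-- What the breadth-first search from `p` computes: the list `U` of the pairs of adjacent vertices
at different distances, directed away from `p` and ordered by distance. -/
structure BfsResult (H : SimpleGraph V) (p : V) (enc : V → ℕ) (U : List (V × V)) (τ : Mem) :
    Prop where
  num : τ.reg rU = U.length
  up : HoldsList (τ.arr aUp) (U.map fun e => enc e.1)
  dn : HoldsList (τ.arr aDn) (U.map fun e => enc e.2)
  nodup : U.Nodup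
  adj : ∀ e ∈ U, H.Adj e.1 e.2 ∧ H.dist p e.2 = H.dist p e.1 + 1
  disconnected : τ.reg rT < Nat.card V → ¬ H.Connected
  odd : τ.reg rOk = 0 → ¬ H.IsBipartite
  connected : ¬ τ.reg rT < Nat.card V → H.Connected
  ok : H.Connected → τ.reg rOk ≠ 0 → τ.reg rOk = 1 ∧ H.IsBipartite ∧
    (∀ x y, H.Adj x y → (x, y) ∈ U ∨ (y, x) ∈ U) ∧
    U.Pairwise fun e e' => H.dist p e.1 ≤ H.dist p e'.1

theorem bfs_spec {d : ℕ} (hW : Fits n w) (h : LoopMem n H ρ enc L σ)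
    (hnb : NbrMem n H enc nb (σ.arr aDeg) (σ.arr aAdj)) (hp : σ.reg rP = enc p)
    (hd : ∀ x, (nb x).length ≤ d) :
    Runs w bfs σ (200 * (n * (d + 1))) (fun τ => ∃ U, BfsResult H p enc U τ) := by
  have hfin := h.finite
  have hn : 0 < n := (Nat.zero_le _).trans_lt h.lim_lt
  have hn' : n < 2 ^ w := lt_of_lt_of_le (by omega) hW
  have hdist : ∀ x, H.dist p x < n := fun x => (dist_lt_card x).trans_le h.card_le
  have henc := h.enc_injective
  have hlt : ∀ l : List V, l.Nodup → l.length ≤ n := fun l hl => by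
    rw [← List.length_map (f := enc)]
    refine length_le_of_nodup (hl.map henc) fun a ha => ?_
    obtain ⟨x, -, rfl⟩ := List.mem_map.1 ha
    exact h.enc_lt x
  have m1 : 1 % 2 ^ w = 1 := hW.lt (by omega)
  refine Runs.mono (T := (20 * n + 10) + (20 + (n * ((d * (80 + 10) + 8 + 8) + 10) + 8) + 1) + 1)
    ?_ (by nlinarith) fun _ _ h => h
  refine Runs.seq (clear_spec hW h.num aDst) fun τ1 hS1 hQ1 => ?_
  refine Runs.seq (Q := fun τ => BfsMem H p enc [p] [] τ)
    (Runs.straight rfl (by decide) ?_) fun τ2 hS2 hQ2 => ?_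
  · have hP1 : τ1.reg rP = enc p := (hS1.reg rfl).trans hp
    have hok1 : τ1.reg rOk = 1 := (hS1.reg rfl).trans h.ok
    refine ⟨?_, ?_, fun x => ?_, ?_, ?_, ?_, .inl ⟨?_, by simp⟩⟩
    · simp [Prog.eval, Term.val, m1]
    · intro k hk
      obtain rfl : k = 0 := by simpa using hk
      simp [Prog.eval, Term.val, hP1]
    · simp only [Prog.eval, Term.val, setReg_arr, setArr_arr, setArr_reg, Nat.reduceEqDiff,
        if_false, if_true, Function.update_apply, hP1, m1, hQ1 _ (h.enc_lt x)]
      by_cases hx : x = p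
      · subst hx; simp
      · rw [if_neg fun h' => hx (henc h'), if_neg (by simpa using hx)]
    · simp [Prog.eval, Term.val, ups]
    · intro k hk; simp [ups] at hk
    · intro k hk; simp [ups] at hk
    · simpa [Prog.eval] using hok1
  have hdeg2 : τ2.arr aDeg = σ.arr aDeg := (hS2.arr rfl).trans (hS1.arr rfl)
  have hadj2 : τ2.arr aAdj = σ.arr aAdj := (hS2.arr rfl).trans (hS1.arr rfl)
  refine Runs.mono (Runs.for (N := n) (B := d * (80 + 10) + 8 + 8) (fun i τ => ∃ l₁ l₂,
    BfsInv H p l₁ l₂ ∧ (l₁.length = i ∨ (l₂ = [] ∧ l₁.length ≤ i)) ∧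
      BfsMem H p enc (l₁ ++ l₂) (darts nb l₁) τ) hn' rfl (by decide)
      (fun τ hS => (hS.reg (x := rN) rfl).trans ((hS2.reg rfl).trans
        ((hS1.reg rfl).trans h.num))) ?_ ?_) le_rfl ?_
  · exact ⟨[], [p], .init, .inl rfl,
      ⟨hQ2.len, hQ2.que, hQ2.dst, hQ2.num, hQ2.up, hQ2.dn, hQ2.ok⟩⟩
  · rintro i τ hi hS hr ⟨l₁, l₂, hB, hor, hM⟩
    have hdeg : τ.arr aDeg = σ.arr aDeg := (hS.arr rfl).trans hdeg2
    have hadj : τ.arr aAdj = σ.arr aAdj := (hS.arr rfl).trans hadj2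
    have hnum : τ.reg rN = n := (hS.reg rfl).trans ((hS2.reg rfl).trans ((hS1.reg rfl).trans h.num))
    refine Runs.mono (T := 3 + (d * (80 + 10) + 8 + 4) + 1) (Runs.ite (fun hc => ?_)
      (fun hc => Runs.straight rfl (by simp [Prog.steps]) ?_)) (by omega) fun _ _ h => h
    swap
    · have hlen := hM.len
      obtain rfl : l₂ = [] := by
        rcases hor with hor | hor
        · rw [← List.length_eq_zero_iff]
          by_contra hne
          rw [List.length_append] at hlen
          simp [Term.val, Op.apply, hr, hlen] at hc
          omega
        · exact hor.1
      refine ⟨l₁, [], hB, .inr ⟨rfl, by omega⟩, ?_⟩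
      exact ⟨hM.len, hM.que, hM.dst, hM.num, hM.up, hM.dn, hM.ok⟩
    obtain ⟨v, l₂, rfl⟩ : ∃ v l, l₂ = v :: l := by
      cases l₂ with
      | cons v l => exact ⟨v, l, rfl⟩
      | nil =>
        have hlen := hM.len
        simp only [List.append_nil] at hlen
        simp [Term.val, Op.apply, hr, hlen] at hc
        omega
    obtain hor : l₁.length = i := by
      rcases hor with hor | hor
      · exact hor
      · simp at hor
    have hv : τ.arr aQue i = enc v := by
      rw [hM.que i (by simp [hor])]
      simp [← hor]
    refine Runs.mono (T := 3 + (d * (80 + 10) + 8) + 1) (Runs.seq (Q := fun τ' => τ'.reg rX = enc v ∧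
      BfsMem H p enc (l₁ ++ v :: l₂) (darts nb l₁) τ') (Runs.straight rfl (by decide) ⟨?_, ?_⟩)
      fun τ' hS' hQ' => ?_) (by omega) fun _ _ h => h
    · simp [Prog.eval, Term.val, hr, hv]
    · exact ⟨hM.len, hM.que, hM.dst, hM.num, hM.up, hM.dn, hM.ok⟩
    have hvn : (nb v).length < 2 ^ w := (hnb.length_lt v).trans_lt hn'
    refine Runs.mono (Runs.for (N := (nb v).length) (B := 80) (fun k τ'' => ∃ l₂,
      BfsInv H p l₁ (v :: l₂) ∧ (∀ u ∈ (nb v).take k, u ∈ l₁ ++ v :: l₂) ∧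
      BfsMem H p enc (l₁ ++ v :: l₂) (darts nb l₁ ++ ((nb v).take k).map fun y => (v, y)) τ'') hvn
      rfl (by decide) (fun τ'' hS'' => ?_) ?_ ?_) ?_ ?_
    · have hX : τ''.reg rX = enc v := (hS''.reg rfl).trans hQ'.1
      simp only [Term.val, hX]
      rw [hS''.arr rfl, hS'.arr rfl, hdeg, hnb.deg]
    · refine ⟨l₂, hB, by simp, ?_⟩
      have hQ := hQ'.2
      simp only [List.take_zero, List.map_nil, List.append_nil]
      exact ⟨hQ.len, hQ.que, hQ.dst, hQ.num, hQ.up, hQ.dn, hQ.ok⟩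
    · rintro k τ'' hk hS'' hr'' ⟨l₂, hB, hcur, hM⟩
      have hX : τ''.reg rX = enc v := (hS''.reg rfl).trans hQ'.1
      have hN : τ''.reg rN = n := (hS''.reg rfl).trans ((hS'.reg rfl).trans hnum)
      have hJ : τ''.arr aAdj (enc v * n + k) = enc (nb v)[k] := by
        rw [hS''.arr rfl, hS'.arr rfl, hadj, hnb.get v k hk]
      have hvu : H.Adj v (nb v)[k] := hnb.mem.1 (List.getElem_mem hk)
      have m2 := hW.cell (h.enc_lt v) (hk.trans_le (hnb.length_lt v) : k < n)
      refine Runs.straight rfl (by decide) ?_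
      have e : (rY ≔ ag aAdj (cell (rg rX) (rg rK)) ;; visit ;; record).eval w τ'' =
          record.eval w (visit.eval w (τ''.setReg rY (enc (nb v)[k]))) := by
        simp [Prog.eval, Term.val, Op.apply, cell, hX, hN, hr'', m2, hJ]
      rw [e]
      obtain ⟨l₂', hB', hsub, hu, hM'⟩ := visit_spec hW henc h.enc_lt hdist hB
        (τ := τ''.setReg rY (enc (nb v)[k]))
        ⟨hM.len, hM.que, hM.dst, hM.num, hM.up, hM.dn, hM.ok⟩ hX rfl hvu
      obtain ⟨t, hex, -⟩ := exec_eval (w := w) (P := visit) (σ := τ''.setReg rY (enc (nb v)[k])) rfl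
      have hM'' := record_spec hW hdist ?_ hM' ((hex.sameOn.reg rfl).trans hX)
        (hex.sameOn.reg rfl) (by simp) hu
      · refine ⟨l₂', hB', fun u hu' => ?_, ?_⟩
        · rw [List.take_add_one, List.getElem?_eq_getElem hk, Option.toList_some,
            List.mem_append, List.mem_singleton] at hu'
          rcases hu' with hu' | rfl
          · exact hsub u (hcur u hu')
          · exact hu
        · rw [List.take_add_one, List.getElem?_eq_getElem hk, Option.toList_some,
            List.map_append, ← List.append_assoc]
          exact ⟨hM''.len, hM''.que, hM''.dst, hM''.num, hM''.up, hM''.dn, hM''.ok⟩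
      · have h1 := length_darts_le hnb.length_lt l₁
        have h2 : l₁.length * n ≤ n * n := Nat.mul_le_mul_right n (by omega)
        rw [List.length_append, List.length_map, List.length_take, add_mul, one_mul]
        have := hnb.length_lt v
        omega
    · have := Nat.mul_le_mul_right 90 (hd v)
      omega
    · rintro τ'' hS'' ⟨l₂, hB, hcur, hM⟩
      rw [List.take_length] at hcur hM
      refine ⟨l₁ ++ [v], l₂, hB.advance fun u hu => hcur u (hnb.mem.2 hu), .inl (by simp [hor]), ?_⟩
      have e1 : l₁ ++ [v] ++ l₂ = l₁ ++ v :: l₂ := by simp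
      have e2 : darts nb (l₁ ++ [v]) = darts nb l₁ ++ (nb v).map fun y => (v, y) := by simp [darts]
      rw [e1, e2]
      exact ⟨hM.len, hM.que, hM.dst, hM.num, hM.up, hM.dn, hM.ok⟩
  · rintro τ hS ⟨l₁, l₂, hB, hor, hM⟩
    obtain rfl : l₂ = [] := by
      rcases hor with hor | hor
      · have := hlt _ hB.nodup
        rw [List.length_append] at this
        rw [← List.length_eq_zero_iff]
        omega
      · exact hor.1
    rw [List.append_nil] at hM
    have hmem : ∀ e, e ∈ darts nb l₁ ↔ e.1 ∈ l₁ ∧ H.Adj e.1 e.2 := by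
      rintro ⟨x, y⟩
      simp [darts, hnb.mem]
    have hconn := hB.connected_iff
    refine ⟨ups H p (darts nb l₁), ⟨hM.num, hM.up, hM.dn, ?_, ?_, ?_, ?_, ?_, ?_⟩⟩
    · refine List.Nodup.filter _ (List.nodup_flatMap.2 ⟨fun x _ => ?_, ?_⟩)
      · exact (hnb.nodup x).map fun a b hab => (Prod.mk.inj hab).2
      · refine List.Pairwise.imp (fun {a b} hab => ?_) (by simpa using hB.nodup : l₁.Nodup)
        simp only [Function.onFun, List.disjoint_left, List.mem_map]
        rintro e ⟨y, -, rfl⟩ ⟨z, -, h'⟩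
        exact hab (Prod.mk.inj h').1.symm
    · intro e he
      simp only [ups, List.mem_filter, decide_eq_true_eq, hmem] at he
      exact ⟨he.1.2, he.2⟩
    · intro hT hc
      rw [hM.len] at hT
      have := hconn.1 hc
      omega
    · intro h0
      rcases hM.ok with ⟨h1, -⟩ | ⟨-, e, he, hd⟩
      · omega
      · rw [hmem] at he
        exact not_isBipartite ((hB.mem_iff _).1 he.1) he.2 hd
    · intro hT
      rw [hM.len] at hT
      exact hconn.2 (by omega)
    · intro hc h0
      have hall : ∀ x, x ∈ l₁ := fun x => (hB.mem_iff x).2 (hc.preconnected p x)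
      rcases hM.ok with ⟨h1, h2⟩ | ⟨h1, -⟩
      swap
      · exact absurd h1 h0
      have hne : ∀ x y, H.Adj x y → H.dist p x ≠ H.dist p y := fun x y hxy =>
        h2 (x, y) ((hmem _).2 ⟨hall x, hxy⟩)
      refine ⟨h1, isBipartite_of_dist_ne hc hne, fun x y hxy => ?_, ?_⟩
      · simp only [ups, List.mem_filter, decide_eq_true_eq, hmem]
        rcases dist_eq_or hc hxy (hne x y hxy) with hd | hd
        · exact .inl ⟨⟨hall x, hxy⟩, hd⟩
        · exact .inr ⟨⟨hall y, hxy.symm⟩, hd⟩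
      · refine List.Pairwise.filter _ (List.pairwise_flatMap.2 ⟨fun x _ => ?_, ?_⟩)
        · exact List.pairwise_map.2 (List.pairwise_of_forall fun _ _ => le_rfl)
        · refine List.Pairwise.imp (fun {a b} hab => ?_) (by simpa using hB.sorted)
          intro e he e' he'
          obtain ⟨y, -, rfl⟩ := List.mem_map.1 he
          obtain ⟨z, -, rfl⟩ := List.mem_map.1 he'
          exact hab

end

/-! ### Bitvectors -/

section

variable {V : Type} {n L w d b : ℕ} {H : SimpleGraph V} {ρ : ℕ → V} {enc : V → ℕ} {σ τ : Mem}
  {nb : V → List V} {p : V} {U : List (V × V)} {bit : V → ℕ → Bool}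

/-- The list `U` contains exactly the pairs of adjacent vertices whose second vertex is farther
from `p`, and is ordered by the distance of the first one. -/
structure UpList (H : SimpleGraph V) (p : V) (U : List (V × V)) : Prop where
  mem : ∀ x y, (x, y) ∈ U ↔ H.Adj x y ∧ H.dist p y = H.dist p x + 1
  sorted : U.Pairwise fun e e' => H.dist p e.1 ≤ H.dist p e'.1

/-- In the order of the list, all edges that lead to `x` precede those that leave `x`. -/
theorem UpList.mem_take (hU : UpList H p U) {t : ℕ} (ht : t < U.length) {x : V}
    (hx : (x, U[t].1) ∈ U) : (x, U[t].1) ∈ U.take t := by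
  have h1 := ((hU.mem _ _).1 hx).2
  have h2 : U = U.take t ++ (U[t] :: U.drop (t + 1)) := by
    rw [← List.drop_eq_getElem_cons ht, List.take_append_drop]
  have h3 := hU.sorted
  have h4 : (x, U[t].1) ∈ U.take t ++ (U[t] :: U.drop (t + 1)) := h2 ▸ hx
  rw [h2, List.pairwise_append, List.pairwise_cons] at h3
  rcases List.mem_append.1 h4 with h4 | h4
  · exact h4
  exfalso
  rcases List.mem_cons.1 h4 with h5 | h5
  · have := congrArg (fun e => H.dist p e.1) h5
    simp only at this
    omega
  · have := h3.2.1.1 _ h5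
    simp only at this
    omega

/-- A bit is set at `x` as soon as all edges that lead to `x` have been processed. -/
theorem UpList.bfsBit_iff (hU : UpList H p U) {t : ℕ} {x y : V}
    (hx : ∀ z, (z, x) ∈ U → (z, x) ∈ U.take t) :
    BfsBit H p y x ↔ y = x ∨ ∃ e ∈ U.take t, e.2 = x ∧ BfsBit H p y e.1 := by
  constructor
  · rintro (_ | ⟨hadj, hd, hb⟩)
    · exact .inl rfl
    · exact .inr ⟨_, hx _ ((hU.mem _ _).2 ⟨hadj, hd⟩), rfl, hb⟩
  · rintro (rfl | ⟨e, he, rfl, hb⟩)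
    · exact .start
    · have := (hU.mem _ _).1 (List.mem_of_mem_take he)
      exact .step this.1 this.2 hb

/-- One pass over the edges suffices for all bits of a block, since a word operation joins all of
them at once. -/
theorem block_spec {i : ℕ} (hW : Fits n w) (hn : σ.reg rN = n) (hlt : ∀ x, enc x < n)
    (henc : Function.Injective enc) (hnb : NbrMem n H enc nb (σ.arr aDeg) (σ.arr aAdj))
    (hP : σ.reg rP = enc p) (hD : σ.reg rD = (nb p).length) (hB : σ.reg rB = b)
    (hb : 2 ^ b ≤ 2 * n) (hI : σ.reg rI = i) (hi : i < (nb p).length) (hUn : σ.reg rU = U.length)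
    (hUl : U.length ≤ n * n)
    (hup : HoldsList (σ.arr aUp) (U.map fun e => enc e.1))
    (hdn : HoldsList (σ.arr aDn) (U.map fun e => enc e.2)) (hU : UpList H p U) :
    Runs w block σ (180 * (n + U.length)) (fun τ => ∀ x j, (τ.arr aVec (enc x)).testBit j = true ↔
      j < b ∧ ∃ y, (nb p)[i + j]? = some y ∧ BfsBit H p y x) := by
  have hbn : b < 2 * n := Nat.lt_two_pow_self.trans_le hb
  have hn' : n < 2 ^ w := lt_of_lt_of_le (by omega) hW
  have hpn := hnb.length_lt p
  have m1 : 1 % 2 ^ w = 1 := hW.lt (by omega)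
  refine Runs.mono (T := 2 + ((n * (3 + 10) + 8) + (2 + ((b * (30 + 10) + 8) +
    (U.length * (20 + 10) + 8) + 1) + 1) + 1) + 1) ?_ (by omega) fun _ _ h => h
  refine Runs.seq (Q := fun τ => τ.reg rX = i) (Runs.straight rfl (by decide) ?_)
    fun τ1 hS1 hQ1 => ?_
  · simp [Prog.eval, Term.val, hI]
  refine Runs.seq (Runs.for (N := n) (B := 3) (fun i τ => ∀ j < i, τ.arr aVec j = 0) hn' rfl
    (by decide) (fun τ hS => (hS.reg (x := rN) rfl).trans ((hS1.reg rfl).trans hn))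
    (fun j hj => by omega) ?_) fun τ2 hS2 hQ2 => ?_
  · intro i τ hi hS hr hI
    refine Runs.straight rfl (by decide) fun j hj => ?_
    simp only [Prog.eval, Term.val, hr, setReg_arr, setArr_arr, if_true, Function.update_apply]
    split_ifs with h
    · rfl
    · exact hI j (by omega)
  refine Runs.seq (Q := fun τ => τ.reg rW = 1) (Runs.straight rfl (by decide) ?_)
    fun τ3 hS3 hQ3 => ?_
  · simp [Prog.eval, Term.val, m1]
  have r3 : ∀ {x}, x ≠ rX → x ≠ rK → x ≠ rW → τ3.reg x = σ.reg x := fun {x} h1 h2 h3 =>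
    (hS3.reg (by simpa [Prog.modR] using h3)).trans ((hS2.reg (by
      simpa [forLoop, Prog.modR] using h2)).trans (hS1.reg (by simpa [Prog.modR] using h1)))
  have a3 : ∀ {a}, a ≠ aVec → τ3.arr a = σ.arr a := fun {a} h1 =>
    (hS3.arr rfl).trans ((hS2.arr (by simpa [forLoop, Prog.modA] using h1)).trans (hS1.arr rfl))
  have hX3 : τ3.reg rX = i := (hS3.reg rfl).trans ((hS2.reg rfl).trans hQ1)
  refine Runs.seq (Runs.for (N := b) (B := 30) (fun k τ => τ.reg rW = 2 ^ k ∧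
    ∀ x j, (τ.arr aVec (enc x)).testBit j = true ↔ j < k ∧ (nb p)[i + j]? = some x)
    (lt_of_lt_of_le (by omega) hW) rfl (by decide)
    (fun τ hS => (hS.reg (x := rB) rfl).trans ((r3 (by decide) (by decide) (by decide)).trans hB))
    ⟨by simpa using hQ3, fun x j => ?_⟩ ?_) fun τ4 hS4 hQ4 => ?_
  · rw [setReg_arr, hS3.arr rfl, hQ2 _ (hlt x)]
    simp
  · rintro k τ hk hS hr ⟨hw, hv⟩
    have hN : τ.reg rN = n := (hS.reg rfl).trans
      ((r3 (by decide) (by decide) (by decide)).trans hn)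
    have hP' : τ.reg rP = enc p := (hS.reg rfl).trans
      ((r3 (by decide) (by decide) (by decide)).trans hP)
    have hD' : τ.reg rD = (nb p).length := (hS.reg rfl).trans
      ((r3 (by decide) (by decide) (by decide)).trans hD)
    have hX' : τ.reg rX = i := (hS.reg rfl).trans hX3
    have hJ' : τ.arr aAdj = σ.arr aAdj := (hS.arr rfl).trans (a3 (by decide))
    have hpow : 2 ^ (k + 1) ≤ 2 ^ b := Nat.pow_le_pow_right two_pos hk
    have m2 : (2 ^ k + 2 ^ k) % 2 ^ w = 2 ^ (k + 1) := by
      rw [pow_succ] at hpow ⊢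
      rw [hW.lt (by omega)]; omega
    have m3 : (i + k) % 2 ^ w = i + k := hW.lt (by omega)
    refine Runs.straight rfl (by decide) ⟨?_, fun x j => ?_⟩
    · simp only [Prog.eval]
      split_ifs <;> simp [Term.val, Op.apply, hw, m2]
    · by_cases hik : i + k < (nb p).length
      · have m4 := hW.cell (hlt p) (hik.trans_le hpn : i + k < n)
        have e : (((Prog.ite (.op .lt (rg rX + rg rK) (rg rD))
            (.store aVec (ag aAdj (cell (rg rP) (rg rX + rg rK))) (rg rW)) .skip ;;
            rW ≔ rg rW + rg rW).eval w τ).setReg rK (k + 1)).arr aVec =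
            Function.update (τ.arr aVec) (enc (nb p)[i + k]) (2 ^ k) := by
          have hg := hnb.get p (i + k) hik
          simp [Prog.eval, Term.val, Op.apply, cell, hX', hr, hD', hP', hN, hw, m3, m4, hik, hJ', hg]
        rw [e, Function.update_apply]
        by_cases hx : x = (nb p)[i + k]
        · subst hx
          rw [if_pos rfl, Nat.testBit_two_pow]
          simp only [decide_eq_true_eq]
          constructor
          · rintro rfl
            exact ⟨by omega, List.getElem?_eq_getElem hik⟩
          · rintro ⟨-, h1⟩
            obtain ⟨h2, h3⟩ := List.getElem?_eq_some_iff.1 h1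
            have := (hnb.nodup p).getElem_inj_iff.1 h3
            omega
        · rw [if_neg fun h => hx (henc h), hv]
          refine ⟨fun h => ⟨by omega, h.2⟩, fun h => ⟨?_, h.2⟩⟩
          by_contra hjk
          obtain rfl : j = k := by omega
          rw [List.getElem?_eq_getElem hik, Option.some.injEq] at h
          exact hx h.2.symm
      · have e : (((Prog.ite (.op .lt (rg rX + rg rK) (rg rD))
            (.store aVec (ag aAdj (cell (rg rP) (rg rX + rg rK))) (rg rW)) .skip ;;
            rW ≔ rg rW + rg rW).eval w τ).setReg rK (k + 1)).arr aVec = τ.arr aVec := by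
          simp [Prog.eval, Term.val, Op.apply, hX', hr, hD', m3, hik]
        rw [e, hv]
        refine ⟨fun h => ⟨by omega, h.2⟩, fun h => ⟨?_, h.2⟩⟩
        obtain ⟨h2, -⟩ := List.getElem?_eq_some_iff.1 h.2
        omega
  have r4 : ∀ {x}, x ≠ rX → x ≠ rK → x ≠ rW → τ4.reg x = σ.reg x := fun {x} h1 h2 h3 =>
    (hS4.reg (by simp [forLoop, Prog.modR, h2, h3])).trans (r3 h1 h2 h3)
  have a4 : ∀ {a}, a ≠ aVec → τ4.arr a = σ.arr a := fun {a} h1 =>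
    (hS4.arr (by simp [forLoop, Prog.modA, h1])).trans (a3 h1)
  refine Runs.mono (Runs.for (N := U.length) (B := 20) (fun t τ => ∀ x j,
    (τ.arr aVec (enc x)).testBit j = true ↔ j < b ∧ ∃ y, (nb p)[i + j]? = some y ∧
      (y = x ∨ ∃ e ∈ U.take t, e.2 = x ∧ BfsBit H p y e.1))
    (lt_of_lt_of_le (by omega) hW) rfl (by decide)
    (fun τ hS => (hS.reg (x := rU) rfl).trans
      ((r4 (by decide) (by decide) (by decide)).trans hUn)) ?_ ?_) le_rfl ?_
  · intro x j
    simpa using hQ4.2 x j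
  · intro t τ ht hS hr hv
    have hup' : τ.arr aUp t = enc U[t].1 := by
      rw [hS.arr rfl, a4 (by decide), hup t (by simpa using ht), List.getElem_map]
    have hdn' : τ.arr aDn t = enc U[t].2 := by
      rw [hS.arr rfl, a4 (by decide), hdn t (by simpa using ht), List.getElem_map]
    have h1 : ∀ j, (τ.arr aVec (enc U[t].1)).testBit j = true ↔
        j < b ∧ ∃ y, (nb p)[i + j]? = some y ∧ BfsBit H p y U[t].1 := by
      intro j
      rw [hv]
      simp only [hU.bfsBit_iff fun z hz => hU.mem_take ht hz]
    refine Runs.straight rfl (by decide) fun x j => ?_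
    simp only [Prog.eval, Term.val, Op.apply, hr, hup', hdn', setReg_arr, setArr_arr, if_true,
      Function.update_apply]
    rw [List.take_add_one, List.getElem?_eq_getElem ht, Option.toList_some]
    by_cases hx : x = U[t].2
    · rw [hx, if_pos rfl, Nat.testBit_or, Bool.or_eq_true, hv, h1, ← and_or_left, ← exists_or]
      refine and_congr_right fun _ => exists_congr fun y => ?_
      rw [← and_or_left]
      refine and_congr_right fun _ => ?_
      rw [or_assoc]
      refine or_congr_right ?_
      constructor
      · rintro (⟨e, he, h2⟩ | h2)
        · exact ⟨e, List.mem_append_left _ he, h2⟩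
        · exact ⟨_, List.mem_append_right _ (List.mem_singleton_self _), rfl, h2⟩
      · rintro ⟨e, he, h2, h3⟩
        rcases List.mem_append.1 he with he | he
        · exact .inl ⟨e, he, h2, h3⟩
        · rw [List.mem_singleton.1 he] at h3; exact .inr h3
    · rw [if_neg fun h => hx (henc h), hv]
      refine and_congr_right fun _ => exists_congr fun y => and_congr_right fun _ =>
        or_congr_right ⟨?_, ?_⟩
      · rintro ⟨e, he, h2⟩
        exact ⟨e, List.mem_append_left _ he, h2⟩
      · rintro ⟨e, he, h2, h3⟩
        rcases List.mem_append.1 he with he | he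
        · exact ⟨e, he, h2, h3⟩
        · rw [List.mem_singleton.1 he] at h2
          exact absurd h2.symm hx
  · intro τ hS hv x j
    rw [hv]
    refine and_congr_right fun _ => exists_congr fun y => and_congr_right fun _ => ?_
    rw [hU.bfsBit_iff (t := U.length) fun z hz => by rwa [List.take_length]]

theorem extract_spec {i j : ℕ} (hW : Fits n w) (hn : σ.reg rN = n)
    (hrep : ∀ v < n, σ.arr aRep v = enc (ρ v)) (hI : σ.reg rI = i) (hL : σ.reg rL = L)
    (hLi : L + i < n) (hC : σ.reg rC = 2 ^ j)
    (hvec : ∀ x, (σ.arr aVec (enc x)).testBit j = bit x i)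
    (hcnt : ∀ v < n, σ.arr aCnt v ≤ i) :
    Runs w extract σ (60 * n + 10) (fun τ =>
      (∀ v < n, τ.arr aCnt v = σ.arr aCnt v + (bit (ρ v) i).toNat) ∧
      (∀ v < n, ∀ c < n, τ.arr aLab (v * n + c) =
        if c = L + i then (bit (ρ v) i).toNat else σ.arr aLab (v * n + c))) := by
  have hn' : n < 2 ^ w := lt_of_lt_of_le (by omega) hW
  have m1 : 1 % 2 ^ w = 1 := hW.lt (by omega)
  have m2 : (L + i) % 2 ^ w = L + i := hW.lt (by omega)
  refine Runs.mono (Runs.for (N := n) (B := 40) (fun k τ =>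
    (∀ v < n, τ.arr aCnt v = σ.arr aCnt v + if v < k then (bit (ρ v) i).toNat else 0) ∧
      (∀ v < n, ∀ c < n, τ.arr aLab (v * n + c) =
        if c = L + i ∧ v < k then (bit (ρ v) i).toNat else σ.arr aLab (v * n + c))) hn' rfl
    (by decide) (fun τ hS => (hS.reg (x := rN) rfl).trans hn) ?_ ?_) (by omega) ?_
  · exact ⟨fun v _ => by simp, fun v _ c _ => by simp⟩
  · rintro k τ hk hS hr ⟨h1, h2⟩
    have hN : τ.reg rN = n := (hS.reg rfl).trans hn
    have hI' : τ.reg rI = i := (hS.reg rfl).trans hI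
    have hL' : τ.reg rL = L := (hS.reg rfl).trans hL
    have hC' : τ.reg rC = 2 ^ j := (hS.reg rfl).trans hC
    have hrep' : τ.arr aRep k = enc (ρ k) := by rw [hS.arr rfl, hrep k hk]
    have hvec' : τ.arr aVec = σ.arr aVec := hS.arr rfl
    have m3 := hW.cell hk hLi
    have hck := h1 k hk
    have hck' := hcnt k hk
    rw [if_neg (lt_irrefl k), add_zero] at hck
    have m4 : (σ.arr aCnt k + 1) % 2 ^ w = σ.arr aCnt k + 1 := hW.lt (by omega)
    have hland : (σ.arr aVec (enc (ρ k)) &&& 2 ^ j) = 0 ↔ bit (ρ k) i = false := by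
      rw [Nat.and_two_pow, hvec]
      cases bit (ρ k) i <;> simp
    have hcell : ∀ v c, c < n → (v * n + c = k * n + (L + i) ↔ v = k ∧ c = L + i) :=
      fun v c hc => cell_inj hc hLi
    refine Runs.straight rfl (by decide) ?_
    cases hbit : bit (ρ k) i
    · have hz := hland.2 hbit
      have e : extractBit.eval w τ = τ.setArr aLab (k * n + (L + i)) 0 := by
        simp [extractBit, Prog.eval, Term.val, Op.apply, cell, hr, hrep', hC', hN, hL', hI', hvec',
          hz, m2, m3]
      rw [e]
      refine ⟨fun v hv => ?_, fun v hv c hc => ?_⟩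
      · have := h1 v hv
        by_cases hvk : v = k
        · subst hvk; simp [this, hbit]
        · simp [this, show v < k + 1 ↔ v < k by omega]
      · have := h2 v hv c hc
        simp only [setReg_arr, setArr_arr, if_true, Function.update_apply, hcell v c hc, this]
        by_cases hvk : v = k
        · subst hvk
          by_cases hcl : c = L + i <;> simp [hcl, hbit]
        · simp [hvk, show v < k + 1 ↔ v < k by omega]
    · have hz : ¬ _ := fun h => by simpa [hbit] using hland.1 h
      have e : extractBit.eval w τ =
          (τ.setArr aLab (k * n + (L + i)) 1).setArr aCnt k (σ.arr aCnt k + 1) := by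
        simp [extractBit, Prog.eval, Term.val, Op.apply, cell, hr, hrep', hC', hN, hL', hI', hvec',
          hz, m1, m2, m3, hck, m4]
      rw [e]
      refine ⟨fun v hv => ?_, fun v hv c hc => ?_⟩
      · have := h1 v hv
        by_cases hvk : v = k
        · subst hvk; simp [hbit]
        · simp [this, hvk, show v < k + 1 ↔ v < k by omega]
      · have := h2 v hv c hc
        simp only [setReg_arr, setArr_arr, Nat.reduceEqDiff, if_false, if_true,
          Function.update_apply, hcell v c hc, this]
        by_cases hvk : v = k
        · subst hvk
          by_cases hcl : c = L + i <;> simp [hcl, hbit]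
        · simp [hvk, show v < k + 1 ↔ v < k by omega]
  · rintro τ hS ⟨h1, h2⟩
    refine ⟨fun v hv => by rw [h1 v hv, if_pos hv], fun v hv c hc => ?_⟩
    rw [h2 v hv c hc]
    simp only [hv, and_true]

/-- There are at most `d / b + 1` blocks, and each of them takes `O(n + |U|)` steps with
`|U| ≤ n * min b d`, so that `O(n * d)` steps suffice for `d` bits. -/
theorem bitvectors_spec (hW : Fits n w) (hn : σ.reg rN = n) (hlt : ∀ x, enc x < n)
    (henc : Function.Injective enc) (hrep : ∀ v < n, σ.arr aRep v = enc (ρ v))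
    (hnb : NbrMem n H enc nb (σ.arr aDeg) (σ.arr aAdj)) (hP : σ.reg rP = enc p)
    (hd0 : 0 < (nb p).length) (hD : σ.reg rD = (nb p).length) (hB : σ.reg rB = b) (hb0 : 0 < b)
    (hb : 2 ^ b ≤ 2 * n) (hL : σ.reg rL = L) (hLn : L < n) (hdL : (nb p).length ≤ L)
    (hUn : σ.reg rU = U.length) (hUb : U.length ≤ n * b) (hUd : U.length ≤ n * (nb p).length)
    (hup : HoldsList (σ.arr aUp) (U.map fun e => enc e.1))
    (hdn : HoldsList (σ.arr aDn) (U.map fun e => enc e.2)) (hU : UpList H p U)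
    (hbit : ∀ x i y, (nb p)[i]? = some y → (bit x i = true ↔ BfsBit H p y x)) :
    Runs w bitvectors σ (1000 * (n * (nb p).length)) (fun τ =>
      τ.reg rL = L - (nb p).length ∧
      (∀ v < n, τ.arr aCnt v = ∑ i ∈ Finset.range (nb p).length, (bit (ρ v) i).toNat) ∧
      (∀ v < n, ∀ i < (nb p).length,
        τ.arr aLab (v * n + (L - (nb p).length + i)) = (bit (ρ v) i).toNat) ∧
      (∀ v < n, ∀ c < n, L ≤ c → τ.arr aLab (v * n + c) = σ.arr aLab (v * n + c))) := by
  have hdn' := hnb.length_lt p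
  have hUl : U.length ≤ n * n := hUd.trans (Nat.mul_le_mul_left n hdn')
  have hbn : b < 2 * n := Nat.lt_two_pow_self.trans_le hb
  have m1 : 1 % 2 ^ w = 1 := hW.lt (by omega)
  have hnd : n ≤ n * (nb p).length := Nat.le_mul_of_pos_right n hd0
  have hnb' : n ≤ n * b := Nat.le_mul_of_pos_right n hb0
  set d := (nb p).length with hd
  refine Runs.mono (T := 5 + ((20 * n + 10) + (2 +
    ((d * ((60 * n + 40) + 380 * n + 10) + 8 + 190 * (n + U.length))) + 1) + 1) + 1) ?_ ?_
    fun _ _ h => h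
  swap
  · have e1 : d * (60 * n + 40 + 380 * n + 10) = 440 * (n * d) + 50 * d := by ring
    have e2 : d ≤ n * d := Nat.le_mul_of_pos_left d (by omega)
    omega
  refine Runs.seq (Q := fun τ => τ.reg rL = L - d) (Runs.straight rfl (by decide) ?_)
    fun τ1 hS1 hQ1 => ?_
  · change (σ.reg rL + 2 ^ w - σ.reg rD) % 2 ^ w = _
    rw [hL, hD]
    exact sub_mod_eq hdL (lt_of_lt_of_le (by omega) hW)
  refine Runs.seq (clear_spec hW ((hS1.reg rfl).trans hn) aCnt) fun τ2 hS2 hQ2 => ?_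
  refine Runs.seq (Q := fun τ => τ.reg rJ = 0) (Runs.straight rfl (by decide) ?_)
    fun τ3 hS3 hQ3 => ?_
  · simp [Prog.eval, Term.val]
  have r3 : ∀ {x}, x ≠ rL → x ≠ rI → x ≠ rJ → τ3.reg x = σ.reg x := fun {x} h1 h2 h3 =>
    (hS3.reg (by simpa [Prog.modR] using h3)).trans ((hS2.reg (by
      simpa [clear, forLoop, Prog.modR] using h2)).trans (hS1.reg (by simpa [Prog.modR] using h1)))
  have a3 : ∀ {a}, a ≠ aCnt → τ3.arr a = σ.arr a := fun {a} h1 =>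
    (hS3.arr rfl).trans ((hS2.arr (by simpa [clear, forLoop, Prog.modA] using h1)).trans
      (hS1.arr rfl))
  have hL3 : τ3.reg rL = L - d := (hS3.reg rfl).trans ((hS2.reg rfl).trans hQ1)
  let X := 190 * (n + U.length)
  -- One block pays for all its bits: the potential grows with every bit that is extracted.
  let φ : Mem → ℕ := fun τ => if τ.reg rJ = 0 then X else 380 * n * τ.reg rJ
  have hX : X ≤ 380 * n * b := by
    have e1 : 380 * n * b = 380 * (n * b) := by ring
    simp only [X]
    omega
  let I : ℕ → Mem → Prop := fun i τ =>
    (∃ j, τ.reg rJ = j ∧ j < b ∧ j ≤ i ∧ (j ≠ 0 → τ.reg rC = 2 ^ j ∧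
      ∀ x k, (τ.arr aVec (enc x)).testBit k = true ↔
        k < b ∧ ∃ y, (nb p)[i - j + k]? = some y ∧ BfsBit H p y x)) ∧
    (∀ v < n, τ.arr aCnt v = ∑ i ∈ Finset.range i, (bit (ρ v) i).toNat) ∧
    (∀ v < n, ∀ i' < i, τ.arr aLab (v * n + (L - d + i')) = (bit (ρ v) i').toNat) ∧
    (∀ v < n, ∀ c < n, L ≤ c → τ.arr aLab (v * n + c) = σ.arr aLab (v * n + c))
  refine Exists.elim (exec_for (σ := τ3) (x := rI) (b := rg rD) (N := d)
    (B := 60 * n + 40 + 380 * n) (w := w) (P := .ite (.op .eq (rg rJ) 0) (block ;; rC ≔ 1) .skip ;;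
      extract ;; rC ≔ rg rC + rg rC ;; rJ ≔ rg rJ + 1 ;;
      .ite (.op .eq (rg rJ) (rg rB)) (rJ ≔ 0) .skip) I φ (lt_of_lt_of_le (by omega) hW) rfl
    (by decide) (fun τ hS => (hS.reg (x := rD) rfl).trans
      ((r3 (by decide) (by decide) (by decide)).trans hD)) ?_ ?_)
    fun t h => ?_
  · refine ⟨⟨0, by simpa using hQ3, hb0, le_rfl, fun h => absurd rfl h⟩, fun v hv => ?_,
      fun v _ i' hi' => by omega, fun v hv c hc _ => ?_⟩
    · rw [setReg_arr, hS3.arr rfl, hQ2 v hv]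
      simp
    · rw [setReg_arr, a3 (by decide)]
  · rintro i τ hi hS hr ⟨⟨j, hj, hjb, hji, hjv⟩, hcnt, hlab, hold⟩
    have rr : ∀ {x}, x ≠ rL → x ≠ rI → x ≠ rJ → x ≠ rX → x ≠ rK → x ≠ rW → x ≠ rC →
        τ.reg x = σ.reg x := fun {x} h1 h2 h3 h4 h5 h6 h7 =>
      (hS.reg (by simp [forLoop, Prog.modR, block, extract, extractBit, *])).trans (r3 h1 h2 h3)
    have aa : ∀ {a}, a ≠ aCnt → a ≠ aVec → a ≠ aLab → τ.arr a = σ.arr a := fun {a} h1 h2 h3 =>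
      (hS.arr (by simp [forLoop, Prog.modA, block, extract, extractBit, *])).trans (a3 h1)
    have hN' : τ.reg rN = n := by rw [rr, hn] <;> decide
    have hD' : τ.reg rD = d := by rw [rr, hD] <;> decide
    have hB' : τ.reg rB = b := by rw [rr, hB] <;> decide
    have hP' : τ.reg rP = enc p := by rw [rr, hP] <;> decide
    have hU' : τ.reg rU = U.length := by rw [rr, hUn] <;> decide
    have hL' : τ.reg rL = L - d := (hS.reg rfl).trans hL3
    have hdeg' : τ.arr aDeg = σ.arr aDeg := aa (by decide) (by decide) (by decide)
    have hadj' : τ.arr aAdj = σ.arr aAdj := aa (by decide) (by decide) (by decide)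
    have hup' : τ.arr aUp = σ.arr aUp := aa (by decide) (by decide) (by decide)
    have hdn' : τ.arr aDn = σ.arr aDn := aa (by decide) (by decide) (by decide)
    have hrep' : τ.arr aRep = σ.arr aRep := aa (by decide) (by decide) (by decide)
    -- The first part leaves the block that contains bit `i`, and the mask of this bit.
    have first : Runs w (.ite (.op .eq (rg rJ) 0) (block ;; rC ≔ 1) .skip) τ
        (if j = 0 then X else 5) (fun τ' => τ'.reg rJ = j ∧ τ'.reg rC = 2 ^ j ∧
          ∀ x k, (τ'.arr aVec (enc x)).testBit k = true ↔
            k < b ∧ ∃ y, (nb p)[i - j + k]? = some y ∧ BfsBit H p y x) := by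
      by_cases hj0 : j = 0
      · rw [if_pos hj0]
        refine Runs.mono (T := 3 + (180 * (n + U.length) + 2 + 1) + 1) (Runs.ite (fun _ => ?_)
          fun hc => ?_) (by simp only [X]; omega) fun _ _ h => h
        · refine Runs.seq (block_spec hW hN' hlt henc (hdeg' ▸ hadj' ▸ hnb) hP' hD' hB' hb hr hi hU'
            hUl (hup' ▸ hup) (hdn' ▸ hdn) hU) fun τ' hS' hQ' => ?_
          refine Runs.straight rfl (by decide) ⟨?_, ?_, fun x k => ?_⟩
          · exact (hS'.reg rfl).trans hj
          · simp [Prog.eval, Term.val, m1, hj0]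
          · rw [hj0, Nat.sub_zero]
            exact hQ' x k
        · simp [Term.val, Op.apply, hj, hj0] at hc
      · rw [if_neg hj0]
        obtain ⟨h1, h2⟩ := hjv hj0
        refine Runs.mono (T := 3 + 1 + 1) (Runs.ite (fun hc => ?_) fun hc => ?_) le_rfl
          fun _ _ h => h
        · simp [Term.val, Op.apply, hj, hj0] at hc
        · exact Runs.straight rfl (by decide) ⟨hj, h1, h2⟩
    have whole : Runs w (.ite (.op .eq (rg rJ) 0) (block ;; rC ≔ 1) .skip ;;
      extract ;; rC ≔ rg rC + rg rC ;; rJ ≔ rg rJ + 1 ;;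
      .ite (.op .eq (rg rJ) (rg rB)) (rJ ≔ 0) .skip) τ
        ((if j = 0 then X else 5) + (60 * n + 10 + 20 + 1) + 1) (fun τ' => I (i + 1)
          (τ'.setReg rI (i + 1)) ∧ τ'.reg rJ = if j + 1 = b then 0 else j + 1) := by
      refine Runs.seq first fun τ1 hS1 ⟨hj1, hC1, hv1⟩ => ?_
      have hex1 : ∀ v < n, τ1.arr aCnt v = ∑ i ∈ Finset.range i, (bit (ρ v) i).toNat :=
        fun v hv => by rw [hS1.arr rfl, hcnt v hv]
      have hLi : L - d + i < n := by omega
      have hvec1 : ∀ x, (τ1.arr aVec (enc x)).testBit j = bit x i := by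
        intro x
        have h1 := hbit x i _ (List.getElem?_eq_getElem hi)
        rw [Bool.eq_iff_iff, hv1, h1, Nat.sub_add_cancel hji, List.getElem?_eq_getElem hi]
        simp [hjb]
      refine Runs.seq (T := 60 * n + 10) (T' := 20) (extract_spec hW ((hS1.reg rfl).trans hN') (ρ := ρ) (enc := enc) (bit := bit)
        (j := j) (fun v hv => by rw [hS1.arr rfl, hrep', hrep v hv]) ((hS1.reg rfl).trans hr)
        ((hS1.reg rfl).trans hL') hLi hC1 hvec1 fun v hv => ?_) fun τ2 hS2 ⟨hc2, hl2⟩ => ?_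
      · rw [hex1 v hv]
        refine (Finset.sum_le_card_nsmul _ _ 1 fun a _ => Bool.toNat_le _).trans_eq (by simp)
      have hj2 : τ2.reg rJ = j := (hS2.reg rfl).trans hj1
      have hC2 : τ2.reg rC = 2 ^ j := (hS2.reg rfl).trans hC1
      have hB2 : τ2.reg rB = b := (hS2.reg rfl).trans ((hS1.reg rfl).trans hB')
      have hpow : 2 ^ (j + 1) ≤ 2 ^ b := Nat.pow_le_pow_right two_pos hjb
      have m2 : (2 ^ j + 2 ^ j) % 2 ^ w = 2 ^ (j + 1) := by
        rw [pow_succ] at hpow ⊢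
        rw [hW.lt (by omega)]; omega
      have m3 : (j + 1) % 2 ^ w = j + 1 := hW.lt (by omega)
      have e : (rC ≔ rg rC + rg rC ;; rJ ≔ rg rJ + 1 ;;
          .ite (.op .eq (rg rJ) (rg rB)) (rJ ≔ 0) .skip).eval w τ2 =
          if j + 1 = b then ((τ2.setReg rC (2 ^ (j + 1))).setReg rJ (j + 1)).setReg rJ 0
          else (τ2.setReg rC (2 ^ (j + 1))).setReg rJ (j + 1) := by
        simp only [Prog.eval, Term.val, Op.apply, hj2, hC2, hB2, setReg_reg,
          Nat.reduceEqDiff, if_true, if_false, m1, m2, m3]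
        by_cases hjb' : j + 1 = b <;> simp [hjb']
      have hJ : ((rC ≔ rg rC + rg rC ;; rJ ≔ rg rJ + 1 ;;
          .ite (.op .eq (rg rJ) (rg rB)) (rJ ≔ 0) .skip).eval w τ2).reg rJ =
          if j + 1 = b then 0 else j + 1 := by
        rw [e]; split_ifs <;> simp
      have hA : ((rC ≔ rg rC + rg rC ;; rJ ≔ rg rJ + 1 ;;
          .ite (.op .eq (rg rJ) (rg rB)) (rJ ≔ 0) .skip).eval w τ2).arr = τ2.arr := by
        rw [e]; split_ifs <;> rfl
      refine Runs.straight rfl (by decide) ⟨⟨⟨_, rfl, ?_, ?_, ?_⟩, ?_, ?_, ?_⟩, hJ⟩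
      · rw [setReg_reg, if_neg (by decide), hJ]; split_ifs <;> omega
      · rw [setReg_reg, if_neg (by decide), hJ]; split_ifs <;> omega
      · rw [setReg_reg, if_neg (by decide), hJ, setReg_arr, hA]
        by_cases hjb' : j + 1 = b
        · rw [if_pos hjb']
          exact fun h => absurd rfl h
        · rw [if_neg hjb', setReg_reg, if_neg (show ¬ rC = rI by decide), e, if_neg hjb']
          intro _
          refine ⟨by simp, fun x k => ?_⟩
          rw [hS2.arr rfl, hv1, show i + 1 - (j + 1) + k = i - j + k by omega]
      · intro v hv
        rw [setReg_arr, hA, hc2 v hv, hex1 v hv, Finset.sum_range_succ]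
      · intro v hv i' hi'
        rw [setReg_arr, hA, hl2 v hv _ (by omega)]
        by_cases hii : i' = i
        · rw [hii, if_pos rfl]
        · rw [if_neg (by omega), hS1.arr rfl, hlab v hv i' (by omega)]
      · intro v hv c hc hLc
        rw [setReg_arr, hA, hl2 v hv _ hc, if_neg (by omega), hS1.arr rfl, hold v hv c hc hLc]
    obtain ⟨t, τ', hex, ht, hI', hJ'⟩ := whole
    refine ⟨t, τ', hex, ?_, hI'⟩
    have hφ : φ τ = if j = 0 then X else 380 * n * j := by simp only [φ, hj]
    have hφ' : φ (τ'.setReg rI (i + 1)) = if j + 1 = b then X else 380 * n * (j + 1) := by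
      simp only [φ, setReg_reg, Nat.reduceEqDiff, if_false, hJ']
      by_cases hjb' : j + 1 = b <;> simp [hjb']
    have e3 : 380 * n * (j + 1) = 380 * n * j + 380 * n := by ring
    have hX' : j + 1 = b → X ≤ 380 * n * (j + 1) := fun h => by rwa [h]
    rw [hφ, hφ']
    by_cases hj0 : j = 0
    · rw [if_pos hj0] at ht ⊢
      rw [hj0, mul_zero] at e3
      rw [hj0, e3] at hX' ⊢
      split_ifs with hjb'
      · have := hX' hjb'
        omega
      · omega
    · rw [if_neg hj0] at ht ⊢
      split_ifs with hjb'
      · have := hX' hjb'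
        omega
      · omega
  · obtain ⟨τ, hex, ht, hI⟩ := h
    refine ⟨t, τ, hex, ?_, (hex.sameOn.reg rfl).trans hL3, hI.2.1, hI.2.2.1, hI.2.2.2⟩
    have : φ (τ3.setReg rI 0) = X := by simp [φ, hQ3]
    rw [this] at ht
    omega

end

/-! ### Clashes and the contraction -/

section

variable {V : Type} {n w d : ℕ} {H : SimpleGraph V} {ρ : ℕ → V} {enc : V → ℕ} {σ τ : Mem}
  {p : V} {U : List (V × V)} {one : V → ℕ} {F : Set (Sym2 V)}

/-- The number of bits that are set in the bitvector of `x`. -/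
noncomputable def ones (H : SimpleGraph V) (q : Fin d ≃ H.neighborSet p) (x : V) : ℕ :=
  ∑ i, (bits H q x i).toNat

/-- Along an edge that leads away from `p`, bits are only added. -/
theorem ones_eq_add (q : Fin d ≃ H.neighborSet p) {x y : V} (hadj : H.Adj x y)
    (hd : H.dist p y = H.dist p x + 1) :
    ones H q y = ones H q x + (Finset.univ.filter fun i => bits H q x i ≠ bits H q y i).card := by
  rw [ones, ones, Finset.card_filter, ← Finset.sum_add_distrib]
  refine Finset.sum_congr rfl fun i _ => ?_
  have h : bits H q x i = true → bits H q y i = true := by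
    rw [bits_eq_true, bits_eq_true]
    exact .step hadj hd
  cases hx : bits H q x i <;> cases hy : bits H q y i <;> simp_all

/-- The number of bits that are set decides whether an edge is found at `p`. -/
theorem mem_foundEdges_iff_ones (q : Fin d ≃ H.neighborSet p) {x y : V} (hadj : H.Adj x y)
    (hd : H.dist p y = H.dist p x + 1) :
    s(x, y) ∈ foundEdges H q ↔ ones H q x < ones H q y := by
  rw [mem_foundEdges, ones_eq_add q hadj hd, Nat.lt_add_right_iff_pos, Finset.card_pos]
  simp [Finset.Nonempty, hadj]

theorem hasClash_iff_ones (q : Fin d ≃ H.neighborSet p)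
    (hU : ∀ e ∈ U, H.Adj e.1 e.2 ∧ H.dist p e.2 = H.dist p e.1 + 1)
    (hcov : ∀ x y, H.Adj x y → (x, y) ∈ U ∨ (y, x) ∈ U) :
    HasClash H q ↔ ∃ e ∈ U, ones H q e.1 + 1 < ones H q e.2 := by
  have key : ∀ e ∈ U, ones H q e.1 + 1 < ones H q e.2 ↔
      ∃ i j, i ≠ j ∧ bits H q e.1 i ≠ bits H q e.2 i ∧ bits H q e.1 j ≠ bits H q e.2 j := by
    intro e he
    rw [ones_eq_add q (hU e he).1 (hU e he).2, Nat.add_lt_add_iff_left, Finset.one_lt_card]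
    constructor
    · rintro ⟨i, hi, j, hj, hij⟩
      exact ⟨i, j, hij, (Finset.mem_filter.1 hi).2, (Finset.mem_filter.1 hj).2⟩
    · rintro ⟨i, j, hij, hi, hj⟩
      exact ⟨i, by simp [hi], j, by simp [hj], hij⟩
  constructor
  · rintro ⟨u, v, i, j, hadj, hij, hi, hj⟩
    rcases hcov u v hadj with h | h
    · exact ⟨_, h, (key _ h).2 ⟨i, j, hij, hi, hj⟩⟩
    · exact ⟨_, h, (key _ h).2 ⟨i, j, hij, hi.symm, hj.symm⟩⟩
  · rintro ⟨e, he, h⟩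
    obtain ⟨i, j, hij, hi, hj⟩ := (key e he).1 h
    exact ⟨_, _, i, j, (hU e he).1, hij, hi, hj⟩

theorem hasBadLoop_iff_list (hU : ∀ e ∈ U, H.Adj e.1 e.2)
    (hcov : ∀ x y, H.Adj x y → (x, y) ∈ U ∨ (y, x) ∈ U) :
    HasBadLoop H F ↔
      ∃ e ∈ U, s(e.1, e.2) ∉ F ∧ toContracted F e.1 = toContracted F e.2 := by
  constructor
  · rintro ⟨u, v, hadj, hF, h⟩
    rcases hcov u v hadj with h' | h'
    · exact ⟨_, h', hF, h⟩
    · exact ⟨_, h', by rwa [Sym2.eq_swap], h.symm⟩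
  · rintro ⟨e, he, hF, h⟩
    exact ⟨_, _, hU e he, hF, h⟩

/-- The register `rOk` is `0` if `b` holds, and `1` otherwise. -/
def Flag (b : Prop) (τ : Mem) : Prop := τ.reg rOk = 1 ∧ ¬ b ∨ τ.reg rOk = 0 ∧ b

theorem Flag.congr {b b' : Prop} (h : Flag b τ) (hb : b ↔ b') : Flag b' τ := by
  rwa [Flag, ← hb]

theorem exists_mem_take_succ {α : Type} {l : List α} {k : ℕ} (hk : k < l.length) (Q : α → Prop) :
    (∃ e ∈ l.take (k + 1), Q e) ↔ (∃ e ∈ l.take k, Q e) ∨ Q l[k] := by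
  rw [List.take_add_one, List.getElem?_eq_getElem hk, Option.toList_some]
  simp only [List.mem_append, List.mem_singleton, or_and_right, exists_or, exists_eq_left]

theorem clash_spec (hW : Fits n w) (hUn : σ.reg rU = U.length) (hUl : U.length ≤ n * n)
    (hup : HoldsList (σ.arr aUp) (U.map fun e => enc e.1))
    (hdn : HoldsList (σ.arr aDn) (U.map fun e => enc e.2))
    (hcnt : ∀ x, σ.arr aCnt (enc x) = one x) (hone : ∀ x, one x ≤ n) (hok : σ.reg rOk = 1) :
    Runs w clash σ (40 * U.length + 10) (Flag (∃ e ∈ U, one e.1 + 1 < one e.2)) := by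
  have m1 : 1 % 2 ^ w = 1 := hW.lt (by omega)
  refine Runs.mono (Runs.for (N := U.length) (B := 20)
    (fun k => Flag (∃ e ∈ U.take k, one e.1 + 1 < one e.2)) (lt_of_lt_of_le (by omega) hW) rfl
    (by decide) (fun τ hS => (hS.reg (x := rU) rfl).trans hUn) ?_ ?_) (by omega) ?_
  · exact .inl ⟨by simpa using hok, by simp⟩
  · intro k τ hk hS hr h
    have hup' : τ.arr aUp k = enc U[k].1 := by
      rw [hS.arr rfl, hup k (by simpa using hk), List.getElem_map]
    have hdn' : τ.arr aDn k = enc U[k].2 := by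
      rw [hS.arr rfl, hdn k (by simpa using hk), List.getElem_map]
    have hc1 : τ.arr aCnt (enc U[k].1) = one U[k].1 := by rw [hS.arr rfl, hcnt]
    have hc2 : τ.arr aCnt (enc U[k].2) = one U[k].2 := by rw [hS.arr rfl, hcnt]
    have := hone U[k].1
    have m2 : (one U[k].1 + 1) % 2 ^ w = one U[k].1 + 1 := hW.lt (by omega)
    refine Runs.straight rfl (by decide) ?_
    rw [Flag, exists_mem_take_succ hk]
    by_cases hlt : one U[k].1 + 1 < one U[k].2
    · right
      simp [Prog.eval, Term.val, Op.apply, hr, hup', hdn', hc1, hc2, m1, m2, hlt]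
    · have e : ((Prog.ite (.op .lt (ag aCnt (ag aUp (rg rI)) + 1) (ag aCnt (ag aDn (rg rI))))
          (rOk ≔ 0) .skip).eval w τ) = τ := by
        simp [Prog.eval, Term.val, Op.apply, hr, hup', hdn', hc1, hc2, m1, m2, hlt]
      rw [e]
      simpa [hlt, Flag] using h
  · intro τ hS h
    rwa [List.take_length] at h

/-- The array `rep` of representatives of a partition of the vertices that is finer than the
partition into the components of the graph with edge set `F`. -/
structure Partial (n : ℕ) (ρ : ℕ → V) (F : Set (Sym2 V)) (rep : ℕ → ℕ) : Prop where
  lt : ∀ v < n, rep v < n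
  idem : ∀ v < n, rep (rep v) = rep v
  congr : ∀ u < n, ∀ v < n, ρ u = ρ v → rep u = rep v
  reach : ∀ v < n, toContracted F (ρ (rep v)) = toContracted F (ρ v)

/-- The number of the vertices that represent themselves. -/
def roots (n : ℕ) (rep : ℕ → ℕ) : ℕ := ((Finset.range n).filter fun v => rep v = v).card

theorem roots_eq_card {rep : ℕ → ℕ} (henc : ∀ x, enc x < n) (hρ : ∀ x, ρ (enc x) = x)
    (hrep : ∀ v < n, rep v = enc (ρ v)) : roots n rep = Nat.card V := by
  rw [roots, ← Fintype.card_coe, ← Nat.card_eq_fintype_card]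
  refine Nat.card_congr ⟨fun v => ρ v, fun x => ⟨enc x, ?_⟩, fun v => ?_, hρ⟩
  · simp [henc, hrep _ (henc x), hρ]
  · obtain ⟨v, hv⟩ := v
    rw [Finset.mem_filter, Finset.mem_range] at hv
    simp [← hrep v hv.1, hv.2]

/-- The effect of merging the class of `b` into that of `a`. -/
theorem Partial.merge {rep : ℕ → ℕ} (h : Partial n ρ F rep) {a b : ℕ} (ha : a < n) (hb : b < n)
    (hF : s(ρ a, ρ b) ∈ F) (hne : rep a ≠ rep b) :
    Partial n ρ F (fun v => if rep v = rep b then rep a else rep v) ∧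
      roots n (fun v => if rep v = rep b then rep a else rep v) + 1 = roots n rep := by
  have hab := toContracted_adj hF
  refine ⟨⟨fun v hv => ?_, fun v hv => ?_, fun u hu v hv huv => ?_, fun v hv => ?_⟩, ?_⟩
  · split_ifs
    exacts [h.lt a ha, h.lt v hv]
  · by_cases hv' : rep v = rep b
    · rw [if_pos hv', h.idem a ha, if_neg hne]
    · rw [if_neg hv', h.idem v hv, if_neg hv']
  · rw [h.congr u hu v hv huv]
  · split_ifs with hv'
    · rw [h.reach a ha, hab, ← h.reach b hb, ← hv', h.reach v hv]
    · exact h.reach v hv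
  · rw [roots, roots, ← Finset.card_erase_add_one (s := (Finset.range n).filter fun v => rep v = v)
      (a := rep b) (by simp [h.lt b hb, h.idem b hb])]
    congr 2
    ext v
    simp only [Finset.mem_filter, Finset.mem_range, Finset.mem_erase]
    constructor
    · rintro ⟨hv, he⟩
      split_ifs at he with hv'
      · rw [← he, h.idem a ha] at hv'
        exact absurd hv' hne
      · exact ⟨fun h' => hv' (by rw [h', h.idem b hb]), hv, he⟩
    · rintro ⟨h1, hv, h2⟩
      refine ⟨hv, ?_⟩
      rw [if_neg fun h' => h1 (by rw [← h2, h']), h2]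

theorem Partial.congr_of_eq {rep rep' : ℕ → ℕ} (h : Partial n ρ F rep)
    (he : ∀ v < n, rep' v = rep v) : Partial n ρ F rep' ∧ roots n rep' = roots n rep := by
  refine ⟨⟨fun v hv => ?_, fun v hv => ?_, fun u hu v hv huv => ?_, fun v hv => ?_⟩, ?_⟩
  · rw [he v hv]; exact h.lt v hv
  · rw [he v hv, he _ (h.lt v hv), h.idem v hv]
  · rw [he u hu, he v hv, h.congr u hu v hv huv]
  · rw [he v hv, h.reach v hv]
  · refine congrArg Finset.card (Finset.filter_congr fun v hv => ?_)
    rw [he v (Finset.mem_range.1 hv)]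

/-- When all edges in `F` have been contracted, the partition is that into components. -/
theorem Partial.exists_enc {rep : ℕ → ℕ} (h : Partial n ρ F rep) (henc : ∀ x, enc x < n)
    (hρ : ∀ x, ρ (enc x) = x) (hF : ∀ x y, s(x, y) ∈ F → rep (enc x) = rep (enc y)) :
    ∃ enc' : ContractedVertex F → ℕ, (∀ c, enc' c < n) ∧
      (∀ c, toContracted F (ρ (enc' c)) = c) ∧
      ∀ v < n, rep v = enc' (toContracted F (ρ v)) := by
  have key : ∀ x y, toContracted F x = toContracted F y → rep (enc x) = rep (enc y) := by
    intro x y hxy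
    obtain ⟨W⟩ := SimpleGraph.ConnectedComponent.eq.1 hxy
    clear hxy
    induction W with
    | nil => rfl
    | cons hadj _ ih => exact (hF _ _ (SimpleGraph.fromEdgeSet_adj _ |>.1 hadj).1).trans ih
  refine ⟨fun c => rep (enc c.out), fun c => h.lt _ (henc _), fun c => ?_, fun v hv => ?_⟩
  · rw [h.reach _ (henc _), hρ]
    exact Quot.out_eq c
  · rw [h.congr v hv _ (henc (ρ v)) (hρ _).symm]
    exact key _ _ (Quot.out_eq _).symm

/-- Every merger of two classes takes `O(n)` steps and decreases the number of vertices. -/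
theorem merge_spec (hW : Fits n w) (hn : σ.reg rN = n) (hUn : σ.reg rU = U.length)
    (hUl : U.length ≤ n * n) (hup : HoldsList (σ.arr aUp) (U.map fun e => enc e.1))
    (hdn : HoldsList (σ.arr aDn) (U.map fun e => enc e.2))
    (hcnt : ∀ x, σ.arr aCnt (enc x) = one x) (henc : ∀ x, enc x < n) (hρ : ∀ x, ρ (enc x) = x)
    (hrep : ∀ v < n, σ.arr aRep v = enc (ρ v)) (hV : σ.reg rV = Nat.card V)
    (hF : ∀ e ∈ U, one e.1 < one e.2 ↔ s(e.1, e.2) ∈ F)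
    (hcov : ∀ x y, s(x, y) ∈ F → (x, y) ∈ U ∨ (y, x) ∈ U) :
    Runs w merge σ
      (80 * U.length + 10 + 60 * n * (Nat.card V - Nat.card (ContractedVertex F)))
      (fun τ => τ.reg rV = Nat.card (ContractedVertex F) ∧
        ∃ enc' : ContractedVertex F → ℕ, (∀ c, enc' c < n) ∧
          (∀ c, toContracted F (ρ (enc' c)) = c) ∧
          ∀ v < n, τ.arr aRep v = enc' (toContracted F (ρ v))) := by
  have hn' : n < 2 ^ w := lt_of_lt_of_le (by omega) hW
  have m1 : 1 % 2 ^ w = 1 := hW.lt (by omega)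
  let I : ℕ → Mem → Prop := fun k τ => Partial n ρ F (τ.arr aRep) ∧
    τ.reg rV = roots n (τ.arr aRep) ∧
    ∀ e ∈ U.take k, s(e.1, e.2) ∈ F → τ.arr aRep (enc e.1) = τ.arr aRep (enc e.2)
  -- A merger of two vertices takes time `O(n)`, but decreases the number of vertices.
  let φ : Mem → ℕ := fun τ => 60 * n * τ.reg rV
  have hφ : φ (σ.setReg rI 0) = 60 * n * Nat.card V := by simp [φ, hV]
  refine Exists.elim (show ∃ t τ, Exec w merge σ t τ ∧
    t + φ τ ≤ U.length * (70 + 10) + 8 + φ (σ.setReg rI 0) ∧ I U.length τ from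
    exec_for I φ (lt_of_lt_of_le (by omega) hW) rfl (by decide)
    (fun τ hS => (hS.reg (x := rU) rfl).trans hUn) ?_ ?_) fun t h => ?_
  · refine ⟨⟨fun v hv => ?_, fun v hv => ?_, fun u hu v hv huv => ?_, fun v hv => ?_⟩, ?_,
      by simp⟩
    · simp [hrep v hv, henc]
    · simp [hrep v hv, hrep _ (henc _), hρ]
    · simp [hrep v hv, hrep u hu, huv]
    · simp [hrep v hv, hρ]
    · rw [setReg_reg, setReg_arr, if_neg (by decide), hV, roots_eq_card henc hρ hrep]
  · rintro k τ hk hS hr ⟨h1, h2, h3⟩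
    have hup' : τ.arr aUp k = enc U[k].1 := by
      rw [hS.arr rfl, hup k (by simpa using hk), List.getElem_map]
    have hdn' : τ.arr aDn k = enc U[k].2 := by
      rw [hS.arr rfl, hdn k (by simpa using hk), List.getElem_map]
    have hc1 : τ.arr aCnt (enc U[k].1) = one U[k].1 := by rw [hS.arr rfl, hcnt]
    have hc2 : τ.arr aCnt (enc U[k].2) = one U[k].2 := by rw [hS.arr rfl, hcnt]
    have hN : τ.reg rN = n := (hS.reg rfl).trans hn
    have hFk := hF U[k] (List.getElem_mem hk)
    have htake : ∀ {Q : V × V → Prop}, (∀ e ∈ U.take k, Q e) → Q U[k] →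
        ∀ e ∈ U.take (k + 1), Q e := by
      intro Q hQ hQk e he
      rw [List.take_add_one, List.getElem?_eq_getElem hk, Option.toList_some,
        List.mem_append, List.mem_singleton] at he
      rcases he with he | rfl
      exacts [hQ e he, hQk]
    have step : ∃ T, Runs w (.ite (.op .lt (ag aCnt (ag aUp (rg rI))) (ag aCnt (ag aDn (rg rI))))
        (rX ≔ ag aRep (ag aUp (rg rI)) ;; rY ≔ ag aRep (ag aDn (rg rI)) ;;
         .ite (.op .eq (rg rX) (rg rY)) .skip
          (rV ≔ rg rV - 1 ;;
           forLoop rK (rg rN)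
            (.ite (.op .eq (ag aRep (rg rK)) (rg rY)) (.store aRep (rg rK) (rg rX)) .skip)))
        .skip) τ T (fun τ' => I (k + 1) (τ'.setReg rI (k + 1)) ∧
          T + 60 * n * τ'.reg rV ≤ 70 + 60 * n * τ.reg rV) := by
      by_cases hlt : one U[k].1 < one U[k].2
      swap
      · refine ⟨_, Runs.ite (T := 1) (fun hc => ?_) fun _ => Runs.straight rfl (by decide)
          ⟨⟨h1, by simpa [Prog.eval] using h2, htake h3 fun h => absurd (hFk.2 h) hlt⟩, ?_⟩⟩
        · simp [Term.val, Op.apply, hr, hup', hdn', hc1, hc2, hlt] at hc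
        · simp only [Prog.eval, Term.cost]; omega
      have load : ∀ {P' T' R}, (∀ τ2, τ2.arr = τ.arr ∧ τ2.reg rN = n ∧
          τ2.reg rV = τ.reg rV ∧ τ2.reg rX = τ.arr aRep (enc U[k].1) ∧
          τ2.reg rY = τ.arr aRep (enc U[k].2) → Runs w P' τ2 T' R) →
          Runs w (rX ≔ ag aRep (ag aUp (rg rI)) ;; rY ≔ ag aRep (ag aDn (rg rI)) ;; P') τ
            (4 + (4 + T' + 1) + 1) R := by
        intro P' T' R h
        refine Runs.seq (Q := fun τ' => τ' = τ.setReg rX (τ.arr aRep (enc U[k].1)))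
          (Runs.straight rfl (by decide) ?_) fun τ1 _ hτ1 => Runs.seq (Q := fun τ' => τ' =
          (τ.setReg rX (τ.arr aRep (enc U[k].1))).setReg rY (τ.arr aRep (enc U[k].2)))
          (Runs.straight rfl (by decide) ?_) fun τ2 _ hτ2 => h τ2 ?_
        · simp [Prog.eval, Term.val, hr, hup']
        · simp [Prog.eval, Term.val, hτ1, hr, hdn']
        · simp [hτ2, hN]
      by_cases hxy : τ.arr aRep (enc U[k].1) = τ.arr aRep (enc U[k].2)
      · refine ⟨_, Runs.ite (fun _ => load (T' := 5) fun τ2 ⟨ha, hN2, hV2, hX2, hY2⟩ =>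
          Runs.mono (T := 3 + 1 + 1) (Runs.ite (fun _ => Runs.straight rfl (by decide)
            ⟨⟨?_, ?_, ?_⟩, ?_⟩) fun hc => ?_) (by decide) fun _ _ h => h) fun hc => ?_⟩
        · simp [Term.val, Op.apply, hX2, hY2, hxy] at hc
        · simpa [Prog.eval, ha] using h1
        · simpa [Prog.eval, ha, hV2] using h2
        · simp only [Prog.eval, setReg_arr, ha]
          exact htake h3 fun _ => hxy
        · simp only [Prog.eval, hV2, Term.cost]
          omega
        · simp [Term.val, Op.apply, hr, hup', hdn', hc1, hc2, hlt] at hc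
      · have hFk' := hFk.1 hlt
        rw [← hρ U[k].1, ← hρ U[k].2] at hFk'
        obtain ⟨h4, h5⟩ := h1.merge (henc _) (henc _) hFk' hxy
        have hpos : τ.reg rV < 2 ^ w := by
          have : roots n (τ.arr aRep) ≤ n := by
            have := Finset.card_filter_le (Finset.range n) fun v => τ.arr aRep v = v
            rwa [Finset.card_range] at this
          omega
        refine ⟨_, Runs.ite (fun _ => load (T' := 20 * n + 25) fun τ2 ⟨ha, hN2, hV2, hX2, hY2⟩ =>
          Runs.mono (T := 3 + (4 + (n * (10 + 10) + 8) + 1) + 1) (Runs.ite (fun hc => ?_)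
            fun hc => Runs.seq (Q := fun τ => τ.reg rV = τ2.reg rV - 1)
              (Runs.straight rfl (by decide) ?_) fun τ3 hS3 hQ3 => ?_)
              (show _ ≤ 20 * n + 25 by omega) fun _ _ h => h) fun hc => ?_⟩
        · simp [Term.val, Op.apply, hX2, hY2, hxy] at hc
        · have := sub_mod_eq (a := τ.reg rV) (b := 1) (W := 2 ^ w) (by omega) (by omega)
          simp only [Prog.eval, setReg_reg, if_true, val_sub, val_one, m1]
          rw [Term.val, hV2, this]
        · have hN3 : τ3.reg rN = n := (hS3.reg rfl).trans hN2
          have hX3 := (hS3.reg (x := rX) rfl).trans hX2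
          have hY3 := (hS3.reg (x := rY) rfl).trans hY2
          have ha3 : τ3.arr aRep = τ.arr aRep := (hS3.arr rfl).trans (by rw [ha])
          refine Runs.mono (Runs.for (N := n) (B := 10) (fun j τ' => ∀ v < n, τ'.arr aRep v =
            if v < j ∧ τ.arr aRep v = τ.arr aRep (enc U[k].2) then τ.arr aRep (enc U[k].1)
            else τ.arr aRep v) hn' rfl (by decide)
            (fun τ hS => (hS.reg (x := rN) rfl).trans hN3) ?_ ?_) le_rfl ?_
          · intro v hv
            simp [ha3]
          · intro j τ' hj hS' hr' h'
            have hX' := (hS'.reg (x := rX) rfl).trans hX3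
            have hY' := (hS'.reg (x := rY) rfl).trans hY3
            have hj' := h' j hj
            rw [if_neg (by omega)] at hj'
            refine Runs.straight rfl (by decide) fun v hv => ?_
            have hv' := h' v hv
            by_cases hc : τ.arr aRep j = τ.arr aRep (enc U[k].2)
            · by_cases hvj : v = j
              · subst hvj
                simp [Prog.eval, Term.val, Op.apply, hr', hj', hX', hY', hc]
              · simp [Prog.eval, Term.val, Op.apply, hr', hj', hX', hY', hc, hvj, hv',
                  show v < j + 1 ↔ v < j by omega]
            · by_cases hvj : v = j
              · subst hvj
                simp [Prog.eval, Term.val, Op.apply, hr', hj', hY', hc]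
              · simp [Prog.eval, Term.val, Op.apply, hr', hj', hY', hc, hv',
                  show v < j + 1 ↔ v < j by omega]
          · intro τ' hS' h'
            have hV' : τ'.reg rV + 1 = τ.reg rV := by
              rw [hS'.reg rfl, hQ3, hV2]; omega
            obtain ⟨h6, h7⟩ := h4.congr_of_eq (rep' := τ'.arr aRep) fun v hv => by
              rw [h' v hv]
              simp [hv]
            refine ⟨⟨h6, ?_, htake (fun e he hFe => ?_) fun _ => ?_⟩, ?_⟩
            · rw [setReg_reg, if_neg (by decide), setReg_arr]
              omega
            · rw [setReg_arr, h' _ (henc _), h' _ (henc _), h3 e he hFe]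
              simp [henc]
            · rw [setReg_arr, h' _ (henc _), h' _ (henc _)]
              simp [henc]
            · rw [← hV', mul_add]
              simp only [Term.cost]
              omega
        · simp [Term.val, Op.apply, hr, hup', hdn', hc1, hc2, hlt] at hc
    obtain ⟨T, t, τ', hex, ht, hI, hT⟩ := step
    refine ⟨t, τ', hex, ?_, hI⟩
    have : φ (τ'.setReg rI (k + 1)) = 60 * n * τ'.reg rV := by simp [φ]
    rw [this]
    simp only [φ]
    omega
  · obtain ⟨τ, hex, ht, h1, h2, h3⟩ := h
    rw [List.take_length] at h3
    have hF' : ∀ x y, s(x, y) ∈ F → τ.arr aRep (enc x) = τ.arr aRep (enc y) := by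
      intro x y hxy
      rcases hcov x y hxy with h | h
      · exact h3 _ h hxy
      · exact (h3 _ h (by rwa [Sym2.eq_swap])).symm
    obtain ⟨enc', he1, he2, he3⟩ := h1.exists_enc henc hρ hF'
    have hcard := roots_eq_card he1 he2 he3
    refine ⟨t, τ, hex, ?_, h2.trans hcard, enc', he1, he2, he3⟩
    rw [hφ] at ht
    simp only [φ, h2, hcard] at ht
    rw [Nat.mul_sub]
    omega

end

/-! ### The contracted graph -/

section

variable {V : Type} {n w d : ℕ} {H : SimpleGraph V} {ρ : ℕ → V} {enc : V → ℕ} {σ τ : Mem}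
  {p : V} {U : List (V × V)} {one : V → ℕ} {F : Set (Sym2 V)}

theorem GraphMem.of_arr {z : ℕ} {E : ℕ → ℕ → Prop} (h : GraphMem n z E σ) (ha : τ.arr = σ.arr) :
    GraphMem n z E τ := by
  refine ⟨?_, ?_, ?_, ?_, h.lt, h.symm⟩ <;> rw [ha]
  exacts [h.mat, h.fresh, h.nodup, h.mem]

/-- The pairs of representatives of the two ends of the edges in `U` that remain edges. -/
def Joined (F : Set (Sym2 V)) (U : List (V × V)) (enc' : ContractedVertex F → ℕ) (a b : ℕ) :
    Prop :=
  ∃ e ∈ U, s(e.1, e.2) ∉ F ∧ toContracted F e.1 ≠ toContracted F e.2 ∧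
    (a = enc' (toContracted F e.1) ∧ b = enc' (toContracted F e.2) ∨
      a = enc' (toContracted F e.2) ∧ b = enc' (toContracted F e.1))

theorem joined_iff {enc' : ContractedVertex F → ℕ} (hU : ∀ e ∈ U, H.Adj e.1 e.2)
    (hcov : ∀ x y, H.Adj x y → (x, y) ∈ U ∨ (y, x) ∈ U) (a b : ℕ) :
    Joined F U enc' a b ↔ ∃ u v, enc' u = a ∧ enc' v = b ∧ (contract H F).Adj u v := by
  constructor
  · rintro ⟨e, he, -, hne, ⟨rfl, rfl⟩ | ⟨rfl, rfl⟩⟩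
    · exact ⟨_, _, rfl, rfl, contract_adj.2 ⟨hne, _, _, hU e he, rfl, rfl⟩⟩
    · exact ⟨_, _, rfl, rfl, contract_adj.2 ⟨hne.symm, _, _, (hU e he).symm, rfl, rfl⟩⟩
  · rintro ⟨u, v, rfl, rfl, h⟩
    obtain ⟨hne, x, y, hadj, rfl, rfl⟩ := contract_adj.1 h
    have hF : s(x, y) ∉ F := fun h => hne (toContracted_adj h)
    rcases hcov x y hadj with h' | h'
    · exact ⟨_, h', hF, hne, .inl ⟨rfl, rfl⟩⟩
    · exact ⟨_, h', by rwa [Sym2.eq_swap], hne.symm, .inr ⟨rfl, rfl⟩⟩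

theorem rebuild_spec {z : ℕ} {enc' : ContractedVertex F → ℕ} (hW : Fits n w) (hn : σ.reg rN = n)
    (hUn : σ.reg rU = U.length)
    (hUl : U.length ≤ n * n) (hup : HoldsList (σ.arr aUp) (U.map fun e => enc e.1))
    (hdn : HoldsList (σ.arr aDn) (U.map fun e => enc e.2))
    (hcnt : ∀ x, σ.arr aCnt (enc x) = one x)
    (hrep : ∀ x, σ.arr aRep (enc x) = enc' (toContracted F x))
    (henc' : ∀ c, enc' c < n) (hinj : Function.Injective enc') (hV : σ.reg rV = z) (hz : 0 < z)
    (hfresh : ∀ i, σ.arr aMat i = 0 ∨ z < σ.arr aMat i) (hok : σ.reg rOk = 1)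
    (hF : ∀ e ∈ U, one e.1 < one e.2 ↔ s(e.1, e.2) ∈ F)
    (hU : ∀ e ∈ U, H.Adj e.1 e.2)
    (hcov : ∀ x y, H.Adj x y → (x, y) ∈ U ∨ (y, x) ∈ U) :
    Runs w rebuild σ (20 * n + 110 * U.length + 20) (fun τ => Flag (HasBadLoop H F) τ ∧
      GraphMem n z (fun x y => ∃ u v, enc' u = x ∧ enc' v = y ∧ (contract H F).Adj u v) τ) := by
  refine Runs.mono (T := (20 * n + 10) + (U.length * (100 + 10) + 8) + 1) (Runs.seq
    (clear_spec hW hn aDeg) fun τ1 hS1 hQ1 => Runs.for (N := U.length) (B := 100)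
    (fun k τ => Flag (∃ e ∈ U.take k, s(e.1, e.2) ∉ F ∧
      toContracted F e.1 = toContracted F e.2) τ ∧ GraphMem n z (Joined F (U.take k) enc') τ)
    (lt_of_lt_of_le (by omega) hW) rfl
    (by decide) (fun τ hS => (hS.reg (x := rU) rfl).trans ((hS1.reg rfl).trans hUn)) ?_ ?_)
    (by omega) fun τ _ h => ?_
  · refine ⟨.inl ⟨?_, by simp⟩, ⟨fun {x} hx {y} hy => ?_, ?_, fun {x} hx => ?_,
      fun {x} hx {y} => ?_, ?_, ?_⟩⟩
    · rw [setReg_reg, if_neg (by decide), hS1.reg rfl, hok]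
    · rw [setReg_arr, hS1.arr rfl]
      have := hfresh (x * n + y)
      simp only [Joined, List.take_zero, List.not_mem_nil, false_and, exists_false, iff_false]
      omega
    · intro i
      rw [setReg_arr, hS1.arr rfl]
      have := hfresh i
      omega
    · simp [row, hQ1 x hx]
    · simp [row, hQ1 x hx, Joined]
    · simp [Joined]
    · simp [Joined]
  · rintro k τ hk hS hr ⟨h1, h2⟩
    have hup' : τ.arr aUp k = enc U[k].1 := by
      rw [hS.arr rfl, hS1.arr rfl, hup k (by simpa using hk), List.getElem_map]
    have hdn' : τ.arr aDn k = enc U[k].2 := by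
      rw [hS.arr rfl, hS1.arr rfl, hdn k (by simpa using hk), List.getElem_map]
    have hc1 : τ.arr aCnt (enc U[k].1) = one U[k].1 := by rw [hS.arr rfl, hS1.arr rfl, hcnt]
    have hc2 : τ.arr aCnt (enc U[k].2) = one U[k].2 := by rw [hS.arr rfl, hS1.arr rfl, hcnt]
    have hr1 : τ.arr aRep (enc U[k].1) = enc' (toContracted F U[k].1) := by
      rw [hS.arr rfl, hS1.arr rfl, hrep]
    have hr2 : τ.arr aRep (enc U[k].2) = enc' (toContracted F U[k].2) := by
      rw [hS.arr rfl, hS1.arr rfl, hrep]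
    have hN : τ.reg rN = n := (hS.reg rfl).trans ((hS1.reg rfl).trans hn)
    have hV' : τ.reg rV = z := (hS.reg rfl).trans ((hS1.reg rfl).trans hV)
    have hFk := hF U[k] (List.getElem_mem hk)
    have hJ : ∀ a b, Joined F (U.take (k + 1)) enc' a b ↔ Joined F (U.take k) enc' a b ∨
        s(U[k].1, U[k].2) ∉ F ∧ toContracted F U[k].1 ≠ toContracted F U[k].2 ∧
          (a = enc' (toContracted F U[k].1) ∧ b = enc' (toContracted F U[k].2) ∨
            a = enc' (toContracted F U[k].2) ∧ b = enc' (toContracted F U[k].1)) :=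
      fun a b => exists_mem_take_succ hk _
    refine Runs.straight rfl (by decide) ?_
    by_cases hlt : one U[k].1 < one U[k].2
    · have hFk' := hFk.1 hlt
      simp only [Prog.eval, Term.val, Op.apply, hr, hup', hdn', hc1, hc2, if_pos hlt, one_ne_zero,
        if_false]
      refine ⟨Flag.congr (b := ∃ e ∈ U.take k, _) h1 ?_, GraphMem.of_arr (h2.congr fun a b => ?_) rfl⟩
      · rw [exists_mem_take_succ hk]; simp [hFk']
      · rw [hJ]; simp [hFk']
    have hFk' : s(U[k].1, U[k].2) ∉ F := fun h => hlt (hFk.2 h)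
    set x := enc' (toContracted F U[k].1) with hx
    set y := enc' (toContracted F U[k].2) with hy
    have e1 : ∀ P' : Prog, (rX ≔ ag aRep (ag aUp (rg rI)) ;; rY ≔ ag aRep (ag aDn (rg rI)) ;;
        P').eval w τ = P'.eval w ((τ.setReg rX x).setReg rY y) := by
      intro P'
      simp [Prog.eval, Term.val, hr, hup', hdn', hr1, hr2]
    by_cases hxy : x = y
    · have hxy' := hinj hxy
      have e : (Prog.ite (.op .lt (ag aCnt (ag aUp (rg rI))) (ag aCnt (ag aDn (rg rI)))) .skip
          (rX ≔ ag aRep (ag aUp (rg rI)) ;; rY ≔ ag aRep (ag aDn (rg rI)) ;;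
          .ite (.op .eq (rg rX) (rg rY)) (rOk ≔ 0) insert)).eval w τ =
          ((τ.setReg rX x).setReg rY y).setReg rOk 0 := by
        rw [Prog.eval, e1]
        simp [Prog.eval, Term.val, Op.apply, hr, hup', hdn', hc1, hc2, hlt, hxy]
      rw [e]
      refine ⟨.inr ⟨by simp, ?_⟩, GraphMem.of_arr (h2.congr fun a b => ?_) rfl⟩
      · rw [exists_mem_take_succ hk]
        exact .inr ⟨hFk', hxy'⟩
      · rw [hJ]; simp [hxy']
    · have hxy' : toContracted F U[k].1 ≠ toContracted F U[k].2 := fun h => hxy (congrArg enc' h)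
      have e : (Prog.ite (.op .lt (ag aCnt (ag aUp (rg rI))) (ag aCnt (ag aDn (rg rI)))) .skip
          (rX ≔ ag aRep (ag aUp (rg rI)) ;; rY ≔ ag aRep (ag aDn (rg rI)) ;;
          .ite (.op .eq (rg rX) (rg rY)) (rOk ≔ 0) insert)).eval w τ =
          insert.eval w ((τ.setReg rX x).setReg rY y) := by
        rw [Prog.eval, e1]
        simp [Prog.eval, Term.val, Op.apply, hr, hup', hdn', hc1, hc2, hlt, hxy]
      rw [e]
      have h3 := insert_spec (σ := (τ.setReg rX x).setReg rY y) (x := x) (y := y) hW (h2.of_arr rfl)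
        (by simpa using hN) (by simpa using hV') (by simp) (by simp) (henc' _) (henc' _) hxy
      refine ⟨?_, GraphMem.of_arr (h3.congr fun a b => ?_) rfl⟩
      · have h4 : ((insert.eval w ((τ.setReg rX x).setReg rY y)).setReg rI (k + 1)).reg rOk =
            τ.reg rOk := by
          rw [setReg_reg, if_neg (by decide), (insert_sameOn _ _).reg rfl]
          simp
        rw [Flag, h4, exists_mem_take_succ hk]
        simpa [hxy', Flag] using h1
      · rw [hJ]
        simp [hFk', hxy']
  · rw [List.take_length] at h
    exact ⟨h.1.congr (hasBadLoop_iff_list hU hcov).symm, h.2.congr (joined_iff hU hcov)⟩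

end

/-! ### A recursive call -/

section

variable {V : Type} {n w d L : ℕ} {H : SimpleGraph V} {ρ : ℕ → V} {enc : V → ℕ} {σ τ : Mem}
  {nb : V → List V} {p : V} {U : List (V × V)}

theorem length_le_ncard_edgeSet [Finite V] (hU : U.Nodup)
    (h : ∀ e ∈ U, H.Adj e.1 e.2 ∧ H.dist p e.2 = H.dist p e.1 + 1) :
    U.length ≤ H.edgeSet.ncard := by
  classical
  have h1 : (U.map fun e => s(e.1, e.2)).Nodup := by
    refine (List.nodup_map_iff_inj_on hU).2 fun e he e' he' hee => ?_
    rcases Sym2.eq_iff.1 hee with ⟨h1, h2⟩ | ⟨h1, h2⟩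
    · exact Prod.ext h1 h2
    · have h3 := (h e he).2
      have h4 := (h e' he').2
      rw [h1, h2] at h3
      omega
  rw [← List.length_map (f := fun e : V × V => s(e.1, e.2)), ← List.toFinset_card_of_nodup h1,
    ← Set.ncard_coe_finset]
  refine Set.ncard_le_ncard (fun e he => ?_) (Set.toFinite _)
  simp only [List.coe_toFinset, Set.mem_ofPred_eq, List.mem_map] at he
  obtain ⟨e, he, rfl⟩ := he
  exact (h e he).1

/-- The enumeration of the neighbors of `p` in the order of the list. -/
def NbrMem.enumeration {D J : ℕ → ℕ} (h : NbrMem n H enc nb D J) [DecidableEq V] (p : V) :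
    Fin (nb p).length ≃ H.neighborSet p :=
  ((h.nodup p).getEquiv _).trans (Equiv.subtypeEquivRight fun _ => h.mem)

theorem LoopMem.of_sameOn {P : Prog} (h : LoopMem n H ρ enc L σ) (hS : SameOn P σ τ)
    (hr : ∀ x ∈ [rN, rL, rV, rOk], P.modR x = false)
    (ha : ∀ a ∈ [aRep, aDeg, aAdj, aMat], P.modA a = false) : LoopMem n H ρ enc L τ := by
  refine ⟨?_, ?_, ?_, ?_, h.lim_lt, h.enc_lt, h.rho_enc, ?_, ?_, ?_, ?_, ?_, h.graph.lt,
    h.graph.symm⟩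
  · rw [hS.reg (hr _ (by decide)), h.num]
  · rw [hS.reg (hr _ (by decide)), h.lim]
  · rw [hS.reg (hr _ (by decide)), h.card]
  · rw [hS.reg (hr _ (by decide)), h.ok]
  · rw [hS.arr (ha _ (by decide))]; exact h.rep
  · rw [hS.arr (ha _ (by decide))]; exact h.graph.mat
  · rw [hS.arr (ha _ (by decide))]; exact h.graph.fresh
  · rw [hS.arr (ha _ (by decide)), hS.arr (ha _ (by decide))]; exact h.graph.nodup
  · rw [hS.arr (ha _ (by decide)), hS.arr (ha _ (by decide))]; exact h.graph.mem

/-- The situation after a recursive call up to the next one: the contracted graph has been set up,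
and the bits of the bitvectors have been copied to the labels. -/
structure Contracted (n : ℕ) (H : SimpleGraph V) (ρ : ℕ → V) (L : ℕ) {p : V} {d : ℕ}
    (q : Fin d ≃ H.neighborSet p) (σ τ : Mem) : Prop where
  passes : Passes H L q
  mem : ∃ enc, LoopMem n (contract H (foundEdges H q))
    (fun v => toContracted (foundEdges H q) (ρ v)) enc (L - d) τ
  new : ∀ v < n, ∀ i : Fin d, τ.arr aLab (v * n + (L - d + i)) = (bits H q (ρ v) i).toNat
  old : ∀ v < n, ∀ c < n, L ≤ c → τ.arr aLab (v * n + c) = σ.arr aLab (v * n + c)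

/-- The part of a call that follows the tests of the degree, the number of edges, connectivity and
bipartiteness. -/
theorem contraction_spec (hW : Fits n w) (h : LoopMem n H ρ enc L σ)
    (hnb : NbrMem n H enc nb (σ.arr aDeg) (σ.arr aAdj)) (hP : σ.reg rP = enc p)
    (q : Fin (nb p).length ≃ H.neighborSet p) (hq : ∀ i, (q i : V) = (nb p)[i])
    (hone : Nat.card V ≠ 1) (hmax : ∀ x, (nb x).length ≤ (nb p).length)
    (hD : σ.reg rD = (nb p).length) (hB : σ.reg rB = Nat.clog 2 (Nat.card V))
    (hdL : (nb p).length ≤ L) (hconn : H.Connected) (hbip : H.IsBipartite)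
    (hedges : H.edgeSet.ncard ≤ Nat.card V * Nat.clog 2 (Nat.card V))
    (hres : BfsResult H p enc U σ) :
    Runs w (bitvectors ;; clash ;; .ite (.op .eq (rg rOk) 0) .skip (merge ;; rebuild)) σ
      (1500 * (n * ((nb p).length + (Nat.card V -
        Nat.card (ContractedVertex (foundEdges H q)))))) (fun τ =>
      τ.reg rOk = 0 ∧ Run H L none ∨
        Contracted n H ρ L q σ τ) := by
  have hfin := h.finite
  have hne := hconn.nonempty
  set F := foundEdges H q
  have hcard : Nat.card V ≤ n := h.card_le
  have hcard2 : 1 < Nat.card V := by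
    have := Nat.card_pos (α := V)
    omega
  have hdpos : 0 < (nb p).length := pos_of_connected q hconn hone hfin
  have hlt : Nat.card (ContractedVertex F) < Nat.card V := card_contracted_lt q hdpos
  have hzpos : 0 < Nat.card (ContractedVertex F) := by
    have : Nonempty (ContractedVertex F) := ⟨toContracted F p⟩
    exact Nat.card_pos
  set b := Nat.clog 2 (Nat.card V) with hb
  have hb0 : 0 < b := Nat.clog_pos (by omega) hcard2
  have hb2 : 2 ^ b ≤ 2 * n := by
    have := Nat.pow_pred_clog_lt_self (b := 2) (by omega) hcard2
    rw [← hb] at this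
    have h2 : 2 ^ b = 2 * 2 ^ b.pred := by
      rw [← pow_succ', Nat.pred_eq_sub_one, Nat.sub_add_cancel hb0]
    omega
  obtain ⟨hok1, -, hcov, hsorted⟩ := hres.ok hconn (by rw [h.ok]; exact one_ne_zero)
  have hU : UpList H p U := by
    refine ⟨fun x y => ⟨hres.adj _, fun ⟨hadj, hdist⟩ => ?_⟩, hsorted⟩
    rcases hcov x y hadj with h' | h'
    · exact h'
    · have := (hres.adj _ h').2
      simp only at this
      omega
  have hUe := length_le_ncard_edgeSet hres.nodup hres.adj
  have hUb : U.length ≤ n * b := hUe.trans (hedges.trans (Nat.mul_le_mul_right b hcard))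
  have hUd : U.length ≤ n * (nb p).length := by
    have := Fintype.ofFinite V
    have h1 := hnb.sum_length
    have h2 : ∑ x, (nb x).length ≤ Nat.card V * (nb p).length := by
      refine (Finset.sum_le_card_nsmul _ _ (nb p).length fun x _ => hmax x).trans_eq ?_
      simp
    have := Nat.mul_le_mul_right (nb p).length hcard
    omega
  have hdn : (nb p).length ≤ n := hnb.length_lt p
  have hUn : U.length ≤ n * n := hUd.trans (Nat.mul_le_mul_left n hdn)
  have hnd : n ≤ n * (nb p).length := Nat.le_mul_of_pos_right n hdpos
  set Δ := Nat.card V - Nat.card (ContractedVertex F)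
  have hpass : ∀ v, (H.neighborSet v).ncard ≤ (nb p).length := fun v => by
    rw [hnb.ncard_neighborSet]
    exact hmax v
  let bit : V → ℕ → Bool := fun x i => if hi : i < (nb p).length then bits H q x ⟨i, hi⟩ else false
  have hbit : ∀ x (i : Fin (nb p).length), bit x i = bits H q x i := fun x i => by simp [bit]
  refine Runs.mono (T := 1000 * (n * (nb p).length) + ((40 * U.length + 10) + (3 + ((80 * U.length + 10 +
    60 * n * Δ) + (20 * n + 110 * U.length + 20) + 1) + 1) + 1) + 1) ?_ ?_ fun _ _ h => h
  swap
  · have e1 : n * ((nb p).length + Δ) = n * (nb p).length + n * Δ := mul_add _ _ _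
    have e2 : 60 * n * Δ = 60 * (n * Δ) := mul_assoc _ _ _
    have e3 : 0 < n := by omega
    omega
  refine Runs.seq (bitvectors_spec (bit := bit) hW h.num h.enc_lt h.enc_injective h.rep hnb hP
    hdpos hD hB hb0 hb2 h.lim h.lim_lt hdL hres.num hUb hUd hres.up hres.dn hU ?_)
    fun τ1 hS1 ⟨hL1, hcnt1, hnew1, hold1⟩ => ?_
  · intro x i y hi
    obtain ⟨hi', rfl⟩ := List.getElem?_eq_some_iff.1 hi
    rw [show bit x i = bits H q x ⟨i, hi'⟩ from hbit x ⟨i, hi'⟩, bits_eq_true, hq]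
    rfl
  have hcnt1' : ∀ x, τ1.arr aCnt (enc x) = ones H q x := by
    intro x
    rw [hcnt1 _ (h.enc_lt x), Finset.sum_range, h.rho_enc]
    exact Finset.sum_congr rfl fun i _ => by rw [hbit]
  have hones : ∀ x, ones H q x ≤ n := by
    intro x
    refine (Finset.sum_le_card_nsmul _ _ 1 fun a _ => Bool.toNat_le _).trans ?_
    simpa using hdn
  have hok1' : τ1.reg rOk = 1 := (hS1.reg rfl).trans h.ok
  have hUτ1 : τ1.reg rU = U.length := (hS1.reg rfl).trans hres.num
  have hup1 : HoldsList (τ1.arr aUp) (U.map fun e => enc e.1) := by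
    rw [hS1.arr rfl]; exact hres.up
  have hdn1 : HoldsList (τ1.arr aDn) (U.map fun e => enc e.2) := by
    rw [hS1.arr rfl]; exact hres.dn
  refine Runs.seq (clash_spec hW hUτ1 hUn hup1 hdn1 hcnt1' hones hok1') fun τ2 hS2 hflag => ?_
  have hflag' := hflag.congr (hasClash_iff_ones q hres.adj hcov).symm
  refine Runs.ite (fun hc => ?_) fun hc => ?_
  · have h0 : τ2.reg rOk = 0 := by
      by_contra h0
      simp [Term.val, Op.apply, h0] at hc
    refine Runs.straight rfl (by simp only [Prog.steps]; omega) (.inl ⟨h0, ?_⟩)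
    rcases hflag' with ⟨h1, -⟩ | ⟨-, h1⟩
    · exact absurd (h0.symm.trans h1) zero_ne_one
    · exact .reject_clash hone q hpass h1
  have h0 : τ2.reg rOk ≠ 0 := by
    intro h0
    simp [Term.val, Op.apply, h0] at hc
  obtain ⟨hok2, hclash⟩ : τ2.reg rOk = 1 ∧ ¬ HasClash H q := by
    rcases hflag' with h1 | ⟨h1, -⟩
    exacts [h1, absurd h1 h0]
  have hF : ∀ e ∈ U, ones H q e.1 < ones H q e.2 ↔ s(e.1, e.2) ∈ F := fun e he =>
    (mem_foundEdges_iff_ones q (hres.adj e he).1 (hres.adj e he).2).symm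
  have hUτ2 : τ2.reg rU = U.length := (hS2.reg rfl).trans hUτ1
  have hn2 : τ2.reg rN = n := (hS2.reg rfl).trans ((hS1.reg rfl).trans h.num)
  have hup2 : HoldsList (τ2.arr aUp) (U.map fun e => enc e.1) := by
    rw [hS2.arr rfl]; exact hup1
  have hdn2 : HoldsList (τ2.arr aDn) (U.map fun e => enc e.2) := by
    rw [hS2.arr rfl]; exact hdn1
  refine Runs.seq (merge_spec (one := ones H q) (F := F) (ρ := ρ) (enc := enc) hW hn2 hUτ2 hUn hup2
    hdn2 (fun x => by rw [hS2.arr rfl, hcnt1']) h.enc_lt h.rho_enc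
    (fun v hv => by rw [hS2.arr rfl, hS1.arr rfl, h.rep v hv])
    ((hS2.reg rfl).trans ((hS1.reg rfl).trans h.card)) hF
    fun x y hxy => hcov x y (foundEdges_subset q hxy)) fun τ3 hS3 ⟨hV3, enc', he1, he2, he3⟩ => ?_
  refine Runs.mono (rebuild_spec (one := ones H q) (F := F) (enc := enc) (enc' := enc') hW
    ((hS3.reg rfl).trans hn2) ((hS3.reg rfl).trans hUτ2) hUn (by rw [hS3.arr rfl]; exact hup2)
    (by rw [hS3.arr rfl]; exact hdn2)
    (fun x => by rw [hS3.arr rfl, hS2.arr rfl, hcnt1'])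
    (fun x => by rw [he3 _ (h.enc_lt x), h.rho_enc]) he1
    (fun c c' hcc => by rw [← he2 c, hcc, he2]) hV3 hzpos (fun i => ?_) ((hS3.reg rfl).trans hok2) hF
    (fun e he => (hres.adj e he).1) hcov) le_rfl fun τ4 hS4 ⟨hflag4, hgraph⟩ => ?_
  · rw [hS3.arr rfl, hS2.arr rfl, hS1.arr rfl]
    have := h.graph.fresh i
    omega
  rcases hflag4 with ⟨hok4, hloop⟩ | ⟨hok4, hloop⟩
  · refine .inr ⟨⟨hpass, hdL, hconn, hbip, hedges, hclash, hloop⟩, ⟨enc', ?_⟩, ?_, ?_⟩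
    · have hV4 : τ4.reg rV = Nat.card (ContractedVertex F) := (hS4.reg rfl).trans hV3
      refine ⟨?_, ?_, hV4, hok4, (Nat.sub_le _ _).trans_lt h.lim_lt, he1, he2, ?_, hgraph⟩
      · exact (hS4.reg rfl).trans ((hS3.reg rfl).trans hn2)
      · exact (hS4.reg rfl).trans ((hS3.reg rfl).trans ((hS2.reg rfl).trans hL1))
      · intro v hv
        rw [hS4.arr rfl, he3 v hv]
    · intro v hv i
      rw [hS4.arr rfl, hS3.arr rfl, hS2.arr rfl, hnew1 v hv i i.2, hbit]
    · intro v hv c hc hLc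
      rw [hS4.arr rfl, hS3.arr rfl, hS2.arr rfl, hold1 v hv c hc hLc]
  · exact .inl ⟨hok4, .reject_loop hone q hpass hloop⟩

end

/-! ### The recursion -/

section

variable {V : Type} {n w d L : ℕ} {H : SimpleGraph V} {ρ : ℕ → V} {enc : V → ℕ} {σ τ : Mem}
  {nb : V → List V} {p : V} {U : List (V × V)}

/-- One call takes `O(n²)` steps if it rejects, and `O(n)` steps for every class that it finds and
every vertex that disappears if it does not. -/
theorem phase_spec (hW : Fits n w) (h : LoopMem n H ρ enc L σ) (hone : Nat.card V ≠ 1) :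
    ∃ t τ, Exec w phase σ t τ ∧
      (t ≤ 6000 * (n * n) ∧ τ.reg rOk = 0 ∧ Run H L none ∨
        ∃ (p : V) (d : ℕ) (q : Fin d ≃ H.neighborSet p), t ≤ 4000 * (n * (d + (Nat.card V -
          Nat.card (ContractedVertex (foundEdges H q))))) ∧ Contracted n H ρ L q σ τ) := by
  classical
  have hfin := h.finite
  have hn : 0 < n := (Nat.zero_le _).trans_lt h.lim_lt
  obtain ⟨nb, hnb⟩ := h.exists_nbrMem
  obtain ⟨t1, τ1, hex1, ht1, p, hP, hD, hmax, hS⟩ := scan_spec hW h hnb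
  have hS1 := hex1.sameOn
  have h1 : LoopMem n H ρ enc L τ1 := h.of_sameOn hS1 (by decide) (by decide)
  have hdn := hnb.length_lt p
  set q := hnb.enumeration p
  set Δ := Nat.card V - Nat.card (ContractedVertex (foundEdges H q)) with hΔ
  have hpass : ∀ v, (H.neighborSet v).ncard ≤ (nb p).length := fun v => by
    rw [hnb.ncard_neighborSet]
    exact hmax v
  have rest : Runs w (logarithm ;; .ite (.op .lt (rg rL) (rg rD)) (rOk ≔ 0)
      (.ite (.op .lt (2 * (rg rV * rg rB)) (rg rS)) (rOk ≔ 0)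
        (bfs ;; .ite (.op .lt (rg rT) (rg rV)) (rOk ≔ 0)
          (.ite (.op .eq (rg rOk) 0) .skip
            (bitvectors ;; clash ;;
              .ite (.op .eq (rg rOk) 0) .skip (merge ;; rebuild)))))) τ1
      (1900 * (n * ((nb p).length + 1 + Δ))) (fun τ => τ.reg rOk = 0 ∧ Run H L none ∨
        Contracted n H ρ L q σ τ) := by
    have e1 : n * ((nb p).length + 1 + Δ) = n * ((nb p).length + Δ) + n := by ring
    have e2 : n * ((nb p).length + 1) = n * (nb p).length + n := by ring
    have e3 : n * ((nb p).length + Δ) = n * (nb p).length + n * Δ := by ring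
    refine Runs.mono (T := (50 * n + 50) + (3 + (7 + (200 * (n * ((nb p).length + 1)) +
      (3 + (3 + (1500 * (n * ((nb p).length + Δ)) + 1) + 1) + 1) + 1) + 1) + 1) + 1) ?_ (by omega)
      fun _ _ h => h
    refine Runs.seq (logarithm_spec hW h1.num h1.card h.card_le) fun τ2 hS2 hB => ?_
    have h2 : LoopMem n H ρ enc L τ2 := h1.of_sameOn hS2 (by decide) (by decide)
    have hD2 : τ2.reg rD = (nb p).length := (hS2.reg rfl).trans hD
    have hP2 : τ2.reg rP = enc p := (hS2.reg rfl).trans hP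
    have hSum2 : τ2.reg rS = 2 * H.edgeSet.ncard := (hS2.reg rfl).trans hS
    have hdeg2 : τ2.arr aDeg = σ.arr aDeg := (hS2.arr rfl).trans (hS1.arr rfl)
    have hadj2 : τ2.arr aAdj = σ.arr aAdj := (hS2.arr rfl).trans (hS1.arr rfl)
    have reject : ∀ {T τ}, 2 ≤ T → Run H L none → Runs w (rOk ≔ 0) τ T
        (fun τ => τ.reg rOk = 0 ∧ Run H L none ∨ Contracted n H ρ L q σ τ) := fun hT hr =>
      Runs.straight rfl hT (.inl ⟨by simp [Prog.eval, Term.val], hr⟩)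
    refine Runs.ite (fun hc => reject (by omega) ?_) fun hc => ?_
    · refine .reject_degree hone (v := p) ?_
      rw [hnb.ncard_neighborSet]
      by_contra hle
      simp [Term.val, Op.apply, h2.lim, hD2, hle] at hc
    have hdL : (nb p).length ≤ L := by
      by_contra hle
      simp [Term.val, Op.apply, h2.lim, hD2, Nat.lt_of_not_le hle] at hc
    have hb2 : Nat.card V * Nat.clog 2 (Nat.card V) ≤ n * n :=
      Nat.mul_le_mul h.card_le ((Nat.clog_le_of_le_pow Nat.lt_two_pow_self.le).trans h.card_le)
    have m2 : 2 % 2 ^ w = 2 := hW.lt (by omega)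
    have m3 : (Nat.card V * Nat.clog 2 (Nat.card V)) % 2 ^ w =
      Nat.card V * Nat.clog 2 (Nat.card V) := hW.lt (by omega)
    have m4 : (2 * (Nat.card V * Nat.clog 2 (Nat.card V))) % 2 ^ w =
      2 * (Nat.card V * Nat.clog 2 (Nat.card V)) := hW.lt (by omega)
    have hval : (Term.op .lt (2 * (rg rV * rg rB)) (rg rS)).val w τ2 =
        if 2 * (Nat.card V * Nat.clog 2 (Nat.card V)) < 2 * H.edgeSet.ncard then 1 else 0 := by
      simp only [Term.val, Op.apply, m2, h2.card, hB, m3, m4, hSum2]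
    refine Runs.ite (fun hc => reject (by omega) ?_) fun hc => ?_
    · refine .reject_edges hone (many_edges_of_not_le fun hle => ?_)
      rw [hval, if_neg (by omega)] at hc
      exact hc rfl
    have hedges : H.edgeSet.ncard ≤ Nat.card V * Nat.clog 2 (Nat.card V) := by
      by_contra hle
      rw [hval, if_pos (by omega)] at hc
      exact one_ne_zero hc
    refine Runs.seq (bfs_spec hW h2 (hdeg2 ▸ hadj2 ▸ hnb) hP2 hmax) fun τ3 hS3 ⟨U, hU⟩ => ?_
    have hV3 : τ3.reg rV = Nat.card V := (hS3.reg rfl).trans h2.card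
    refine Runs.ite (fun hc => reject (by omega) ?_) fun hc => ?_
    · refine .reject_disconnected hone (hU.disconnected ?_)
      by_contra hle
      simp [Term.val, Op.apply, hV3, hle] at hc
    have hconn : H.Connected := by
      refine hU.connected fun hlt => ?_
      simp [Term.val, Op.apply, hV3, hlt] at hc
    refine Runs.ite (fun hc => ?_) fun hc => ?_
    · have h0 : τ3.reg rOk = 0 := by
        by_contra h0
        simp [Term.val, Op.apply, h0] at hc
      exact Runs.straight rfl (by simp only [Prog.steps]; omega)
        (.inl ⟨h0, .reject_odd hone (hU.odd h0)⟩)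
    have h0 : τ3.reg rOk ≠ 0 := by
      intro h0
      simp [Term.val, Op.apply, h0] at hc
    obtain ⟨hok3, hbip, -⟩ := hU.ok hconn h0
    have h3 : LoopMem n H ρ enc L τ3 := by
      refine ⟨(hS3.reg rfl).trans h2.num, (hS3.reg rfl).trans h2.lim, hV3, hok3, h.lim_lt,
        h.enc_lt, h.rho_enc, ?_, ⟨?_, ?_, ?_, ?_, h2.graph.lt, h2.graph.symm⟩⟩
      · rw [hS3.arr rfl]; exact h2.rep
      · rw [hS3.arr rfl]; exact h2.graph.mat
      · rw [hS3.arr rfl]; exact h2.graph.fresh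
      · rw [hS3.arr rfl, hS3.arr rfl]; exact h2.graph.nodup
      · rw [hS3.arr rfl, hS3.arr rfl]; exact h2.graph.mem
    have hdeg3 : τ3.arr aDeg = σ.arr aDeg := (hS3.arr rfl).trans hdeg2
    have hadj3 : τ3.arr aAdj = σ.arr aAdj := (hS3.arr rfl).trans hadj2
    have hlab3 : τ3.arr aLab = σ.arr aLab :=
      (hS3.arr rfl).trans ((hS2.arr rfl).trans (hS1.arr rfl))
    refine Runs.mono (contraction_spec hW h3 (hdeg3 ▸ hadj3 ▸ hnb) ((hS3.reg rfl).trans hP2) q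
      (fun i => rfl) hone hmax ((hS3.reg rfl).trans hD2) ((hS3.reg rfl).trans hB) hdL hconn hbip
      hedges hU) (Nat.le_succ _) fun τ4 _ h4 => h4.imp_right fun h5 => ⟨h5.passes, h5.mem, h5.new, ?_⟩
    rw [← hlab3]
    exact h5.old
  obtain ⟨t2, τ2, hex2, ht2, h2⟩ := rest
  refine ⟨_, τ2, .seq hex1 hex2, ?_⟩
  have e1 : n * ((nb p).length + 1 + Δ) = n * (nb p).length + n + n * Δ := by ring
  rcases h2 with ⟨h2, h3⟩ | h2
  · refine .inl ⟨?_, h2, h3⟩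
    have e2 : n * (nb p).length ≤ n * n := Nat.mul_le_mul_left n hdn
    have e3 : n * Δ ≤ n * n := Nat.mul_le_mul_left n ((Nat.sub_le _ _).trans h.card_le)
    have e4 : n ≤ n * n := Nat.le_mul_of_pos_left n hn
    omega
  · refine .inr ⟨p, _, q, ?_, h2⟩
    have hd := pos_of_connected q h2.passes.2.2.1 hone hfin
    have e2 : n ≤ n * (nb p).length := Nat.le_mul_of_pos_right n hd
    rw [← hΔ, mul_add]
    omega

/-- The memory holds the result `r` of the recursive calls from the one with limit `L` on. -/
def ResultMem (n L : ℕ) (ρ : ℕ → V) (σ τ : Mem) : Option (Output V) → Prop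
  | none => τ.reg rOk = 0
  | some o => τ.reg rOk = 1 ∧ τ.reg rL + o.k = L ∧
      (∀ v < n, ∀ i : Fin o.k, τ.arr aLab (v * n + (τ.reg rL + i)) = (o.label (ρ v) i).toNat) ∧
      ∀ v < n, ∀ c < n, L ≤ c → τ.arr aLab (v * n + c) = σ.arr aLab (v * n + c)

/-- The label of a vertex is that of its image in the contracted graph, followed by the bits that
were written before the next call. -/
theorem ResultMem.of_contracted {q : Fin d ≃ H.neighborSet p} {σ' : Mem} (hL : L < n)
    (h : Contracted n H ρ L q σ σ')
    {r : Option (Output (ContractedVertex (foundEdges H q)))}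
    (hr : ResultMem n (L - d) (fun v => toContracted (foundEdges H q) (ρ v)) σ' τ r) :
    ResultMem n L ρ σ τ (r.map (extend H q)) := by
  have hdL := h.passes.2.1
  cases r with
  | none => exact hr
  | some o =>
    obtain ⟨h1, h2, h3, h4⟩ := hr
    have hk : τ.reg rL + (o.k + d) = L := by omega
    refine ⟨h1, hk, fun v hv i => ?_, fun v hv c hc hLc => ?_⟩
    · refine Fin.addCases (m := o.k) (n := d) (motive := fun i =>
        τ.arr aLab (v * n + (τ.reg rL + i)) = ((extend H q o).label (ρ v) i).toNat)
        (fun i => ?_) (fun i => ?_) i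
      · change _ = (Fin.append (o.label _) (bits H q (ρ v)) (Fin.castAdd d i)).toNat
        rw [Fin.append_left]
        exact h3 v hv i
      · change τ.arr aLab (v * n + (τ.reg rL + (o.k + i))) =
          (Fin.append (o.label _) (bits H q (ρ v)) (Fin.natAdd o.k i)).toNat
        have hi := i.2
        rw [Fin.append_right, show τ.reg rL + (o.k + (i : ℕ)) = L - d + i by omega,
          h4 v hv _ (by omega) (by omega), h.new v hv i]
    · rw [h4 v hv c hc (by omega), h.old v hv c hc hLc]

/-- Every call takes `O(n)` steps for every class that it finds and for every vertex that the
contraction removes, so all calls together take `O(n²)` steps. -/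
theorem loop_spec (hW : Fits n w) (h : LoopMem n H ρ enc L σ) :
    ∃ t τ r, Exec w (.loop (.op .lt 1 (rg rV * rg rOk)) phase) σ t τ ∧
      t ≤ 4010 * (n * (L + Nat.card V)) + 6100 * (n * n) ∧ Run H L r ∧
      ResultMem n L ρ σ τ r := by
  induction hN : Nat.card V using Nat.strong_induction_on generalizing V L σ with
  | _ N ih =>
    have hn : 0 < n := (Nat.zero_le _).trans_lt h.lim_lt
    have hnn : 0 < n * n := Nat.mul_pos hn hn
    have m1 : 1 % 2 ^ w = 1 := hW.lt (by omega)
    have hcn := h.card_le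
    have hval : ∀ τ : Mem, (Term.op .lt 1 (rg rV * rg rOk)).val w τ =
        if 1 < (τ.reg rV * τ.reg rOk) % 2 ^ w then 1 else 0 := fun τ => by
      simp only [Term.val, Op.apply, m1]
    have hcost : (Term.op .lt 1 (rg rV * rg rOk)).cost = 5 := rfl
    have m2 : N % 2 ^ w = N := hW.lt (by omega)
    have hσ := hval σ
    rw [h.card, h.ok, hN, mul_one, m2] at hσ
    have hNpos : 0 < N := by
      have := h.finite
      have : Nonempty V := ⟨ρ 0⟩
      rw [← hN]
      exact Nat.card_pos
    by_cases hone : N = 1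
    · rw [if_neg (by omega)] at hσ
      refine ⟨_, σ, _, .loop_done hσ, ?_, .single (hN.trans hone), h.ok, ?_, ?_, ?_⟩
      · omega
      · exact h.lim
      · exact fun v hv i => i.elim0
      · exact fun v hv c hc _ => rfl
    · rw [if_pos (by omega)] at hσ
      have hσ' : (Term.op .lt 1 (rg rV * rg rOk)).val w σ ≠ 0 := by rw [hσ]; exact one_ne_zero
      obtain ⟨t1, τ1, hex1, ⟨ht1, hok, hr⟩ | ⟨p, d, q, ht1, hc⟩⟩ :=
        phase_spec hW h (by rwa [hN])
      · have hτ := hval τ1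
        rw [hok, mul_zero, Nat.zero_mod, if_neg (by omega)] at hτ
        exact ⟨_, τ1, none, .loop_step hσ' hex1 (.loop_done hτ), by omega, hr, hok⟩
      · have hfin := h.finite
        obtain ⟨enc', hmem⟩ := hc.mem
        have hd : 0 < d := pos_of_connected q hc.passes.2.2.1 (by rwa [hN]) hfin
        have hlt := card_contracted_lt q hd
        obtain ⟨t2, τ2, r, hex2, ht2, hrun, hres⟩ := ih _ (hN ▸ hlt) hmem rfl
        refine ⟨_, τ2, _, .loop_step hσ' hex1 hex2, ?_, .recurse (by rwa [hN]) q hc.passes hrun,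
          hres.of_contracted h.lim_lt hc⟩
        have hdL := hc.passes.2.1
        set N' := Nat.card (ContractedVertex (foundEdges H q))
        rw [hN] at ht1 hlt
        have e1 : n * (L + N) = n * (d + (N - N')) + n * (L - d + N') := by
          rw [← mul_add]
          congr 1
          omega
        have e2 : 0 < n * (d + (N - N')) := Nat.mul_pos hn (by omega)
        omega

end

/-! ### The output -/

section

variable {n m w k L : ℕ} {σ τ : Mem} {β : ℕ → ℕ → Bool}

/-- The sum of the numbers, counted from `1`, of the bits that are set. -/
def bitSum (β : ℕ → Bool) (k : ℕ) : ℕ := ∑ i ∈ Finset.range k, (i + 1) * (β i).toNat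

theorem bitSum_le (β : ℕ → Bool) (hk : k ≤ n) : bitSum β k ≤ n * n := by
  refine (Finset.sum_le_card_nsmul (Finset.range k) _ n fun i hi => ?_).trans ?_
  · have := Finset.mem_range.1 hi
    cases β i <;> simp
    omega
  · simpa using Nat.mul_le_mul_right n hk

/-- If the bit `i` is the only one that differs, it can be recovered from the sums. -/
theorem bitSum_eq_add {β γ : ℕ → Bool} {i : ℕ} (hi : i < k) (h0 : β i = false) (h1 : γ i = true)
    (h : ∀ j < k, j ≠ i → β j = γ j) : bitSum γ k = bitSum β k + (i + 1) := by
  rw [bitSum, bitSum, ← Finset.add_sum_erase _ _ (Finset.mem_range.2 hi),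
    ← Finset.add_sum_erase (Finset.range k) _ (Finset.mem_range.2 hi), h0, h1]
  rw [Finset.sum_congr rfl fun j hj => by
    rw [← h j (Finset.mem_range.1 (Finset.mem_of_mem_erase hj)) (Finset.ne_of_mem_erase hj)]]
  simp
  omega

theorem writeLabel_spec {v : ℕ} (hW : Fits n w) (hn : σ.reg rN = n) (hD : σ.reg rD = k)
    (hL : σ.reg rL = L) (hk : L + k < n) (hv : v < n) (hI : σ.reg rI = v)
    (hlab : ∀ i < k, σ.arr aLab (v * n + (L + i)) = (β v i).toNat) :
    Runs w writeLabel σ (50 * k + 12) (fun τ =>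
      (∀ v' < n, v' ≠ v → ∀ i < k, τ.arr aOut (v' * n + i) = σ.arr aOut (v' * n + i)) ∧
      (∀ v', v' ≠ v → τ.arr aSum v' = σ.arr aSum v') ∧
      (∀ i < k, τ.arr aOut (v * n + i) = (β v i).toNat) ∧ τ.arr aSum v = bitSum (β v) k) := by
  have hn' : n < 2 ^ w := lt_of_lt_of_le (by omega) hW
  have m1 : 1 % 2 ^ w = 1 := hW.lt (by omega)
  unfold writeLabel
  refine Runs.mono (T := 3 + (k * (40 + 10) + 8) + 1) ?_ (by omega) fun _ _ h => h
  refine Runs.seq (Q := fun τ => (∀ v', v' ≠ v → τ.arr aSum v' = σ.arr aSum v') ∧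
    τ.arr aSum v = 0) (Runs.straight rfl (by decide) ?_) fun τ3 hS3 ⟨h4, h5⟩ => ?_
  · refine ⟨fun v' hv' => ?_, ?_⟩
    · simp [Prog.eval, Term.val, hI, hv']
    · simp [Prog.eval, Term.val, hI]
  refine Runs.for (N := k) (B := 40) (fun i τ =>
      (∀ v' < n, v' ≠ v → ∀ i < k, τ.arr aOut (v' * n + i) = σ.arr aOut (v' * n + i)) ∧
      (∀ v', v' ≠ v → τ.arr aSum v' = σ.arr aSum v') ∧
      (∀ i' < i, τ.arr aOut (v * n + i') = (β v i').toNat) ∧ τ.arr aSum v = bitSum (β v) i)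
    (by omega) rfl (by decide)
    (fun τ hS => (hS.reg (x := rD) rfl).trans ((hS3.reg rfl).trans hD)) ?_ ?_
  · refine ⟨fun v' _ _ i _ => ?_, h4, fun i hi => by omega, by simpa [bitSum] using h5⟩
    rw [setReg_arr, hS3.arr rfl]
  · rintro i τ hi hS hr ⟨h6, h7, h8, h9⟩
    have hI' : τ.reg rI = v := (hS.reg rfl).trans ((hS3.reg rfl).trans hI)
    have hN' : τ.reg rN = n := (hS.reg rfl).trans ((hS3.reg rfl).trans hn)
    have hL' : τ.reg rL = L := (hS.reg rfl).trans ((hS3.reg rfl).trans hL)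
    have hlab' : τ.arr aLab (v * n + (L + i)) = (β v i).toNat := by
      rw [hS.arr rfl, hS3.arr rfl, hlab i hi]
    have hb : (β v i).toNat ≤ 1 := Bool.toNat_le _
    have hbs : bitSum (β v) i ≤ n * n := bitSum_le _ (by omega)
    have hmul : (i + 1) * (β v i).toNat ≤ i + 1 := (Nat.mul_le_mul_left _ hb).trans_eq (mul_one _)
    have m2 : (L + i) % 2 ^ w = L + i := hW.lt (by omega)
    have hLi : L + i < n := by omega
    have hin : i < n := by omega
    have m3 := hW.cell hv hLi
    have m4 := hW.cell hv hin
    have m5 : (i + 1) % 2 ^ w = i + 1 := hW.lt (by omega)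
    have m6 : ((i + 1) * (β v i).toNat) % 2 ^ w = (i + 1) * (β v i).toNat := hW.lt (by omega)
    have m7 : (bitSum (β v) i + (i + 1) * (β v i).toNat) % 2 ^ w =
      bitSum (β v) (i + 1) := by
      rw [hW.lt (by omega), bitSum, bitSum, Finset.sum_range_succ]
    have e : (rX ≔ ag aLab (cell (rg rI) (rg rL + rg rK)) ;;
        .store aOut (cell (rg rI) (rg rK)) (rg rX) ;;
        .store aSum (rg rI) (ag aSum (rg rI) + (rg rK + 1) * rg rX)).eval w τ =
        ((τ.setReg rX (β v i).toNat).setArr aOut (v * n + i) (β v i).toNat).setArr aSum v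
          (bitSum (β v) (i + 1)) := by
      simp [Prog.eval, Term.val, Op.apply, cell, hr, hI', hN', hL', m1, m2, m3, m4, m5, hlab',
        h9, m6, m7]
    refine Runs.straight rfl (by decide) ?_
    rw [e]
    refine ⟨fun v' hvn hv' i' hi' => ?_, fun v' hv' => ?_, fun i' hi' => ?_, by simp⟩
    · have hin' : i' < n := by omega
      have : ¬ v' * n + i' = v * n + i := fun h => hv' ((cell_inj hin' hin).1 h).1
      simp [this, h6 v' hvn hv' i' hi']
    · simp [hv', h7 v' hv']
    · by_cases hii : i' = i
      · simp [hii]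
      · simp [hii, h8 i' (by omega)]

/-- The class of an edge whose ends have the sums `a` and `b`. -/
def classOf (a b : ℕ) : ℕ := if a < b then b - a - 1 else a - b - 1

theorem output_spec (hW : Fits n w) (hn : σ.reg rN = n) (hM : σ.reg rM = m) (hm : m ≤ n * n)
    (hok : σ.reg rOk = 1) (hL : σ.reg rL = L) (hk : L + k + 1 = n)
    (hlab : ∀ v < n, ∀ i < k, σ.arr aLab (v * n + (L + i)) = (β v i).toNat)
    (h0 : ∀ j < m, σ.arr 0 j < n) (h1 : ∀ j < m, σ.arr 1 j < n)
    (hne : ∀ j < m, bitSum (β (σ.arr 0 j)) k ≠ bitSum (β (σ.arr 1 j)) k) :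
    Runs w output σ (300 * (n * n)) (fun τ => τ.reg rN = 1 ∧ τ.reg rM = k ∧
      (∀ v < n, ∀ i < k, τ.arr aOut (v * n + i) = (β v i).toNat) ∧
      ∀ j < m, τ.arr aCls j =
        classOf (bitSum (β (σ.arr 0 j)) k) (bitSum (β (σ.arr 1 j)) k)) := by
  have hn' : n < 2 ^ w := lt_of_lt_of_le (by omega) hW
  have hnn : n ≤ n * n := Nat.le_mul_of_pos_left n (by omega)
  have hnk : n * k ≤ n * n := Nat.mul_le_mul_left n (by omega)
  have m1 : 1 % 2 ^ w = 1 := hW.lt (by omega)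
  refine Runs.mono (T := 3 + (7 + ((n * ((50 * k + 12) + 10) + 8) +
    ((m * (40 + 10) + 8) + 5 + 1) + 1) + 1) + 1) ?_ ?_ fun _ _ h => h
  swap
  · have e : n * ((50 * k + 12) + 10) = 50 * (n * k) + 22 * n := by ring
    omega
  refine Runs.ite (fun hc => ?_) fun _ => ?_
  · simp [Term.val, Op.apply, hok] at hc
  refine Runs.seq (Q := fun τ => τ.reg rD = k) (Runs.straight rfl (by decide) ?_)
    fun τ1 hS1 hQ1 => ?_
  · have e1 := sub_mod_eq (a := n) (b := 1) (W := 2 ^ w) (by omega) hn'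
    have e2 := sub_mod_eq (a := n - 1) (b := L) (W := 2 ^ w) (by omega) (by omega)
    simp only [Prog.eval, setReg_reg, if_true, val_sub, val_one, m1]
    rw [Term.val, Term.val, hn, hL, e1, e2]
    omega
  have hN1 : τ1.reg rN = n := (hS1.reg rfl).trans hn
  have hL1 : τ1.reg rL = L := (hS1.reg rfl).trans hL
  refine Runs.seq (Runs.for (N := n) (B := 50 * k + 12) (fun v τ =>
    (∀ v' < v, ∀ i < k, τ.arr aOut (v' * n + i) = (β v' i).toNat) ∧
      ∀ v' < v, τ.arr aSum v' = bitSum (β v') k) hn' rfl (by decide)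
    (fun τ hS => (hS.reg (x := rN) rfl).trans hN1) ?_ ?_) fun τ2 hS2 ⟨hout, hsum⟩ => ?_
  · exact ⟨fun v hv => by omega, fun v hv => by omega⟩
  · rintro v τ hv hS hr ⟨h2, h3⟩
    refine Runs.mono (writeLabel_spec (β := β) hW ((hS.reg rfl).trans hN1)
      ((hS.reg rfl).trans hQ1) ((hS.reg rfl).trans hL1) (by omega) hv hr fun i hi => ?_) le_rfl ?_
    · rw [hS.arr rfl, hS1.arr rfl, hlab v hv i hi]
    · rintro τ' hS' ⟨h6, h7, h8, h9⟩
      refine ⟨fun v' hv' i hi => ?_, fun v' hv' => ?_⟩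
      · rcases Nat.lt_succ_iff_lt_or_eq.1 hv' with h | rfl
        exacts [(h6 v' (h.trans hv) h.ne i hi).trans (h2 v' h i hi), h8 i hi]
      · rcases Nat.lt_succ_iff_lt_or_eq.1 hv' with h | rfl
        exacts [(h7 v' h.ne).trans (h3 v' h), h9]
  have hM2 : τ2.reg rM = m := (hS2.reg rfl).trans ((hS1.reg rfl).trans hM)
  have hD2 : τ2.reg rD = k := (hS2.reg rfl).trans hQ1
  refine Runs.seq (T := m * (40 + 10) + 8) (T' := 5) (Runs.for (N := m) (B := 40) (fun j τ => ∀ j' < j, τ.arr aCls j' =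
      classOf (bitSum (β (σ.arr 0 j')) k) (bitSum (β (σ.arr 1 j')) k))
    (lt_of_lt_of_le (by omega) hW) rfl (by decide)
    (fun τ hS => (hS.reg (x := rM) rfl).trans hM2) (fun j hj => by omega) ?_)
    fun τ3 hS3 hcls => ?_
  · intro j τ hj hS hr h2
    have ha0 : τ.arr 0 = σ.arr 0 := (hS.arr rfl).trans ((hS2.arr rfl).trans (hS1.arr rfl))
    have ha1 : τ.arr 1 = σ.arr 1 := (hS.arr rfl).trans ((hS2.arr rfl).trans (hS1.arr rfl))
    have hs : ∀ v < n, τ.arr aSum v = bitSum (β v) k := fun v hv => by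
      rw [hS.arr rfl, hsum v hv]
    have hs0 := hs _ (h0 j hj)
    have hs1 := hs _ (h1 j hj)
    have hj' := hne j hj
    have hb : ∀ γ : ℕ → Bool, bitSum γ k < 2 ^ w := fun γ =>
      lt_of_lt_of_le (by have := bitSum_le γ (show k ≤ n by omega); omega) hW
    generalize hA : bitSum (β (σ.arr 0 j)) k = A at *
    generalize hB : bitSum (β (σ.arr 1 j)) k = B at *
    have hA' : A < 2 ^ w := hA ▸ hb _
    have hB' : B < 2 ^ w := hB ▸ hb _
    have e : ((writeClass.eval w τ).setReg rI (j + 1)).arr aCls =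
        Function.update (τ.arr aCls) j (classOf A B) := by
      by_cases hlt : A < B
      · have e1 := sub_mod_eq (a := B) (b := A) hlt.le hB'
        have e2 := sub_mod_eq (a := B - A) (b := 1) (W := 2 ^ w) (by omega) (by omega)
        have e3 : (rg rY - rg rX - 1).val w ((τ.setReg rX A).setReg rY B) = B - A - 1 := by
          rw [val_sub, val_sub, val_one, m1]
          simp [Term.val, e1, e2]
        simp [writeClass, Prog.eval, Term.val, Op.apply, hr, ha0, ha1, hs0, hs1, hlt, e3, classOf]
      · have e1 := sub_mod_eq (a := A) (b := B) (by omega) hA'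
        have e2 := sub_mod_eq (a := A - B) (b := 1) (W := 2 ^ w) (by omega) (by omega)
        have e3 : (rg rX - rg rY - 1).val w ((τ.setReg rX A).setReg rY B) = A - B - 1 := by
          rw [val_sub, val_sub, val_one, m1]
          simp [Term.val, e1, e2]
        simp [writeClass, Prog.eval, Term.val, Op.apply, hr, ha0, ha1, hs0, hs1, hlt, e3, classOf]
    refine Runs.straight rfl (by decide) fun j' hj'' => ?_
    rw [e, Function.update_apply]
    split_ifs with hjj
    · rw [hjj, hA, hB]
    · exact h2 j' (by omega)
  · refine Runs.straight rfl (by decide) ⟨?_, ?_, ?_, ?_⟩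
    · simp [Prog.eval, Term.val, m1]
    · simp [Prog.eval, Term.val, (hS3.reg rfl).trans hD2]
    · intro v hv i hi
      change τ3.arr aOut _ = _
      rw [hS3.arr rfl, hout v hv i hi]
    · exact hcls

end

/-! ### The whole program -/

section

variable {n m w : ℕ} {G : SimpleGraph (Fin n)} {e : Fin m → Fin n × Fin n} {σ τ : Mem}

theorem IsEdgeList.le (he : IsEdgeList G e) : m ≤ n * n := by
  have h : Function.Injective e := fun i j hij => he.1 (by simp only [hij])
  simpa using Fintype.card_le_of_injective e h

/-- Words of `8 * (⌊log₂ n⌋ + 1)` bits hold all numbers below `(n + 1) ^ 8`. -/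
theorem fits_of_le (h : 8 * (Nat.log 2 n + 1) ≤ w) (hn : 1 ≤ n) : Fits n w := by
  have h1 : n + 1 ≤ 2 ^ (Nat.log 2 n + 1) := Nat.lt_pow_succ_log_self (by omega) n
  have h2 : (n + 1) ^ 8 ≤ 2 ^ w := by
    refine (Nat.pow_le_pow_left h1 8).trans ?_
    rw [← pow_mul, mul_comm]
    exact Nat.pow_le_pow_right two_pos h
  refine le_trans ?_ h2
  have h3 : 2 ^ 6 ≤ (n + 1) ^ 6 := Nat.pow_le_pow_left (by omega) 6
  calc 16 * (n * n) + 32 * n + 16 = 16 * (n + 1) ^ 2 := by ring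
    _ ≤ (n + 1) ^ 6 * (n + 1) ^ 2 := Nat.mul_le_mul_right _ (by omega)
    _ = (n + 1) ^ 8 := by ring

/-- The sums that belong to the two ends of an edge determine its class, since the labels of the
ends differ in exactly one bit. -/
theorem mem_cls_iff_classOf {k : ℕ} {cls : Fin k → Set (Sym2 (Fin n))}
    {label : Fin n → Fin k → Bool} (hpart : IsEdgePartition G cls)
    (hcut : IsCutLabeling G cls label) {β : ℕ → ℕ → Bool} (hβ : ∀ (v : Fin n) (i : Fin k),
      β v i = label v i) {u v : Fin n} (huv : G.Adj u v) :
    bitSum (β u) k ≠ bitSum (β v) k ∧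
      ∀ i : Fin k, s(u, v) ∈ cls i ↔ classOf (bitSum (β u) k) (bitSum (β v) k) = i := by
  have h1 : s(u, v) ∈ ⋃ i, cls i := by rw [hpart.2.2]; exact huv
  obtain ⟨i, hi⟩ := Set.mem_iUnion.1 h1
  have huniq : ∀ j, s(u, v) ∈ cls j → j = i := fun j hj => by
    by_contra hne
    exact Set.disjoint_left.1 (hpart.2.1 j i hne) hj hi
  have heq : ∀ j < k, j ≠ i → β u j = β v j := fun j hj hne => by
    by_contra h
    rw [hβ u ⟨j, hj⟩, hβ v ⟨j, hj⟩] at h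
    exact hne (congrArg Fin.val (huniq ⟨j, hj⟩ ((hcut _ u v).2 ⟨huv, h⟩)))
  have hdiff := ((hcut i u v).1 hi).2
  rw [← hβ, ← hβ] at hdiff
  have key : bitSum (β u) k ≠ bitSum (β v) k ∧
      classOf (bitSum (β u) k) (bitSum (β v) k) = i := by
    cases hu : β u i
    · have h2 := bitSum_eq_add i.2 hu (by rw [hu] at hdiff; simpa using hdiff.symm) heq
      rw [h2, classOf, if_pos (by omega)]
      omega
    · have h2 := bitSum_eq_add (γ := β u) i.2 (by rw [hu] at hdiff; simpa using hdiff.symm) hu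
        fun j hj hne => (heq j hj hne).symm
      rw [h2, classOf, if_neg (by omega)]
      omega
  refine ⟨key.1, fun j => ?_⟩
  rw [key.2]
  refine ⟨fun h => by rw [huniq j h], fun h => ?_⟩
  rwa [← Fin.ext h]

/-- The final part of the program translates the contents of the memory to the required format. -/
theorem output_represents (hW : Fits n w) (he : IsEdgeList G e) (hn : 1 ≤ n) {ρ : ℕ → Fin n}
    (hρ : ∀ v : Fin n, ρ v = v) (hN : σ.reg rN = n) (hM : σ.reg rM = m)
    (h0 : σ.arr 0 = (inputMem e).arr 0) (h1 : σ.arr 1 = (inputMem e).arr 1)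
    {r : Option (Output (Fin n))} (hr : ResultMem n (n - 1) ρ τ σ r)
    (hrun : Run G (n - 1) r) :
    Runs w output σ (300 * (n * n)) (fun σ' => Represents e σ' r) := by
  have hnn : 0 < n * n := Nat.mul_pos hn hn
  cases r with
  | none =>
    have hok : σ.reg rOk = 0 := hr
    have m1 : 1 % 2 ^ w = 1 := hW.lt (by omega)
    refine Runs.mono (T := 3 + 2 + 1) (Runs.ite (fun _ => Runs.straight rfl (by decide) ?_)
      fun hc => ?_) (by omega) fun _ _ h => h
    · simp [Represents, Prog.eval, Term.val]
    · simp [Term.val, Op.apply, hok] at hc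
  | some o =>
    obtain ⟨hok, hk, hlab, -⟩ := hr
    obtain ⟨hpart, hcut⟩ := hrun.isEdgePartition_isCutLabeling o rfl
    let β : ℕ → ℕ → Bool := fun v i => if hi : i < o.k then o.label (ρ v) ⟨i, hi⟩ else false
    have hβ : ∀ (v : Fin n) (i : Fin o.k), β v i = o.label v i := fun v i => by
      simp [β, hρ]
    have ha0 : ∀ j : Fin m, σ.arr 0 j = (e j).1 := fun j => by simp [h0, inputMem]
    have ha1 : ∀ j : Fin m, σ.arr 1 j = (e j).2 := fun j => by simp [h1, inputMem]
    have hadj : ∀ j, G.Adj (e j).1 (e j).2 := fun j => by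
      have : s((e j).1, (e j).2) ∈ G.edgeSet := he.2 ▸ Set.mem_range_self j
      exact this
    refine Runs.mono (output_spec (β := β) (k := o.k) hW hN hM he.le hok rfl (by omega)
      (fun v hv i hi => ?_) (fun j hj => ?_) (fun j hj => ?_) fun j hj => ?_) le_rfl
      fun σ' _ ⟨h2, h3, h4, h5⟩ => ⟨h2, h3, fun j i => ?_, fun v i => ?_⟩
    · rw [hlab v hv ⟨i, hi⟩]
      simp [β, hi]
    · rw [ha0 ⟨j, hj⟩]; exact Fin.is_lt _
    · rw [ha1 ⟨j, hj⟩]; exact Fin.is_lt _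
    · rw [ha0 ⟨j, hj⟩, ha1 ⟨j, hj⟩]
      exact (mem_cls_iff_classOf hpart hcut hβ (hadj _)).1
    · rw [h5 j j.2, ha0, ha1]
      exact (mem_cls_iff_classOf hpart hcut hβ (hadj _)).2 i
    · rw [← hβ, ← h4 v v.2 i i.2]

theorem program_spec (he : IsEdgeList G e) (hn : 1 ≤ n) (hW : Fits n w) :
    ∃ r, Run G (n - 1) r ∧
      Runs w program (inputMem e) (16000 * (n * n)) (fun σ => Represents e σ r) := by
  have hnn : n ≤ n * n := Nat.le_mul_of_pos_left n hn
  obtain ⟨t1, σ1, hex1, ht1, hL, hV, hok, hrep, hgraph⟩ := setup_spec he hn he.le hW rfl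
  have hS1 := hex1.sameOn
  let ρ : ℕ → Fin n := fun v => if hv : v < n then ⟨v, hv⟩ else ⟨0, hn⟩
  have hρ : ∀ v : Fin n, ρ v = v := fun v => by simp [ρ]
  have hloop : LoopMem n G ρ Fin.val (n - 1) σ1 := by
    refine ⟨?_, hL, by rw [hV, Nat.card_fin], hok, by omega, Fin.is_lt, hρ, fun v hv => ?_, ?_⟩
    · exact (hS1.reg rfl).trans (by simp [inputMem])
    · rw [hrep v hv]
      simp [ρ, hv]
    · rw [Nat.card_fin]
      exact hgraph
  obtain ⟨t2, σ2, r, hex2, ht2, hrun, hres⟩ := loop_spec hW hloop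
  have hS2 := hex2.sameOn
  obtain ⟨t3, σ3, hex3, ht3, hrep3⟩ := output_represents hW he hn hρ
    ((hS2.reg rfl).trans hloop.num)
    ((hS2.reg rfl).trans ((hS1.reg rfl).trans (by simp [inputMem])))
    ((hS2.arr rfl).trans (hS1.arr rfl)) ((hS2.arr rfl).trans (hS1.arr rfl)) hres hrun
  refine ⟨r, hrun, _, σ3, .seq hex1 (.seq hex2 hex3), ?_, hrep3⟩
  have h1 : n * (n - 1 + Nat.card (Fin n)) ≤ 2 * (n * n) := by
    rw [Nat.card_fin]
    calc n * (n - 1 + n) ≤ n * (2 * n) := Nat.mul_le_mul_left n (by omega)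
      _ = 2 * (n * n) := by ring
  omega

end

end PartialCube

theorem mainTheorem2 :
    -- Running time: one word RAM program carries out the algorithm in `O(n²)` steps.
    (∃ (P : WordRAM.Prog) (c C : ℕ), ∀ (n m : ℕ) (G : SimpleGraph (Fin n))
      (e : Fin m → Fin n × Fin n), 1 ≤ n → PartialCube.IsEdgeList G e →
      ∀ w : ℕ, c * (Nat.log 2 n + 1) ≤ w →
        ∃ (t : ℕ) (σ : WordRAM.Mem) (r : Option (PartialCube.Output (Fin n))),
          WordRAM.Exec w P (PartialCube.inputMem e) t σ ∧ t ≤ C * n ^ 2 ∧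
          PartialCube.Run G (n - 1) r ∧ PartialCube.Represents e σ r) ∧
    -- Termination and correctness of the algorithm, whatever choices it makes.
    (∀ (V : Type u) [Finite V] [Nonempty V] (G : SimpleGraph V),
      PartialCube.Terminates G (Nat.card V - 1) ∧
      (∃ r, PartialCube.Run G (Nat.card V - 1) r) ∧
      ∀ r : Option (PartialCube.Output V), PartialCube.Run G (Nat.card V - 1) r →
        (∀ o, r = some o →
          PartialCube.IsEdgePartition G o.cls ∧ PartialCube.IsCutLabeling G o.cls o.label) ∧
        (PartialCube.IsPartialCube G → ∃ o, r = some o ∧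
          PartialCube.IsWinklerPartition G o.cls ∧
          PartialCube.IsCorrectLabeling G o.label)) := by
  refine ⟨⟨PartialCube.program, 8, 16000, fun n m G e hn he w hw => ?_⟩, fun V _ _ G =>
    ⟨PartialCube.terminates G _, PartialCube.exists_run G _, fun r hr =>
      ⟨fun o => hr.isEdgePartition_isCutLabeling o, fun hG => PartialCube.partialCube_run hG hr⟩⟩⟩
  obtain ⟨r, hrun, t, σ, hex, ht, hrep⟩ :=
    PartialCube.program_spec he hn (PartialCube.fits_of_le hw hn)
  exact ⟨t, σ, r, hex, by rwa [pow_two], hrun, hrep⟩
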